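/- Let $N=N(n)$ be positive integers, put $c_n:=N/n$, and for each $n\ge 1$ let $A_n=(\zeta^{(n)}_{ij})_{1\le i\le n,\,1\le j\le N}$ be an $n\times N$ real random matrix with rows $r^{(n)}_1,\dots,r^{(n)}_n$. Let $\mathbb E_k$ denote conditional expectation with respect to the $\sigma$-algebra $\sigma(r^{(n)}_j : j\neq k)$. Assume that the sequence $\{A_n\}$ satisfies condition C0, that is, there are a sequence $\gamma_n\ge 0$ with $\gamma_n\to0$ and a sequence of non-negative integers $\beta_n=o(\sqrt n)$ such that: (i) $\mathbb E_k[\zeta^{(n)}_{ki}]=0$ almost surely for all $i,k,n$; (ii) $q_n:=\sup_k \frac1n\sum_{i=1}^N \mathbb E\bigl|\mathbb E_k[(\zeta^{(n)}_{ki})^2]-1\bigr| = o(1)$; (iii) $\sup_{k,\,i\ne j}|\mathbb E_k[\zeta^{(n)}_{ki}\zeta^{(n)}_{kj}]| + \sup_{k,\,i,\,j\neq l}|\mathbb E_k[(\zeta^{(n)}_{ki})^2\zeta^{(n)}_{kj}\zeta^{(n)}_{kl}]| = O(n^{-1/2}\gamma_n)$ almost surely, with a deterministic implied constant; (iv) $\sup|\mathbb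 E_k[\zeta^{(n)}_{ki}\zeta^{(n)}_{kj}\zeta^{(n)}_{kl}\zeta^{(n)}_{km}]| = O(n^{-1}\gamma_n)$ almost surely, with a deterministic implied constant, where the supremum is over all $k$ and all distinct $i,j,l,m$; (v) $\sup_{n,i,j}\mathbb E|\zeta^{(n)}_{ij}|^4<\infty$; (vi) $\rho_n:=\sup_k\frac1{n^2}\sum_{1\le i,j\le N}\mathbb E\bigl|\mathbb E_k[(\zeta^{(n)}_{ki})^2(\zeta^{(n)}_{kj})^2]-1\bigr|=o(1)$; (vii) for each $n$ the $\sigma$-algebras $\sigma(r^{(n)}_i:i\in S)$ and $\sigma(r^{(n)}_j:j\in T)$ are independent whenever $S,T\subseteq\{1,\dots,n\}$ satisfy $|i-j|>\beta_n$ for all $i\in S$, $j\in T$. Assume further that $c_n\ge1$ for all $n\ge 1$, that $c_n\to c\in[1,\infty)$, and that $$\limsup_{n\to\infty}\frac1n\,\mathbb E\|A_nA_n^{\mathrm T}\|<\infty,$$ where $\|\cdot\|$ is the spectral norm. Let $F^{\frac1nA_nA_n^{\mathrm T}}(x)=\frac1n\#\{i:\lambda_i\le x\}$ be the empirical spectral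 distribution, where $\lambda_1,\dots,\lambda_n$ are the eigenvalues of $\frac1nA_nA_n^{\mathrm T}$, and for $c>0$ let $F_c$ be the distribution function of the Marchenko–Pastur law with parameter $c$, which has density $\frac{\sqrt{(x-a)(b-x)}}{2\pi x}$ on $[a,b]$, where $a=(1-\sqrt c)^2$ and $b=(1+\sqrt c)^2$, and zero density elsewhere, together with a point mass $1-c$ at $0$ if $c<1$. Then $$\sup_{x\in\mathbb R}\bigl|\mathbb E F^{\frac1nA_nA_n^{\mathrm T}}(x)-F_{c_n}(x)\bigr| = O\!\left(\max\Bigl(q_n^{1/22},\gamma_n^{1/22},\rho_n^{1/22},\bigl(\tfrac{(\beta_n+1)^2}{n}\bigr)^{1/22}\Bigr)\right)\qquad\text{as } n\to\infty.$$ -/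

import Mathlib

open MeasureTheory ProbabilityTheory Filter Topology
open scoped ENNReal

noncomputable section

namespace MarchenkoPastur

/-! ### Empirical spectral distributions -/

/-- The matrix `(1/n) A Aᵀ` for a real `n × N` matrix `A`. -/
def gram {n N : ℕ} (A : Matrix (Fin n) (Fin N) ℝ) : Matrix (Fin n) (Fin n) ℝ :=
  (1 / (n : ℝ)) • (A * A.transpose)

theorem gram_isHermitian {n N : ℕ} (A : Matrix (Fin n) (Fin N) ℝ) : (gram A).IsHermitian := by
  ext i j
  simp [gram, Matrix.mul_apply, mul_comm]

/-- The empirical spectral distribution `F^M(x) = #{i : λ_i ≤ x} / n` of a real symmetric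
`n × n` matrix `M` with eigenvalues `λ_1, …, λ_n` (counted with multiplicity). -/
def esd {n : ℕ} {M : Matrix (Fin n) (Fin n) ℝ} (hM : M.IsHermitian) (x : ℝ) : ℝ :=
  ((Finset.univ.filter fun i => hM.eigenvalues i ≤ x).card : ℝ) / n

/-- The spectral norm (the operator norm for the Euclidean norm) of a real square matrix. -/
def specNorm {n : ℕ} (M : Matrix (Fin n) (Fin n) ℝ) : ℝ :=
  ‖Matrix.toEuclideanCLM (n := Fin n) (𝕜 := ℝ) M‖

/-! ### The Marchenko–Pastur law -/

/-- The density `p_c` of the absolutely continuous part of the Marchenko–Pastur law. -/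
def mpDensity (c x : ℝ) : ℝ :=
  if (1 - √c) ^ 2 ≤ x ∧ x ≤ (1 + √c) ^ 2 then
    √((x - (1 - √c) ^ 2) * ((1 + √c) ^ 2 - x)) / (2 * Real.pi * x)
  else 0

/-- The Marchenko–Pastur law with parameter `c > 0`: the density `p_c` together with a point mass
`1 - c` at the origin if `c < 1` (`ENNReal.ofReal` vanishes on nonpositive reals). -/
def mpLaw (c : ℝ) : Measure ℝ :=
  volume.withDensity (fun x => ENNReal.ofReal (mpDensity c x))
    + ENNReal.ofReal (1 - c) • Measure.dirac 0

/-- The distribution function `F_c` of the Marchenko–Pastur law. -/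
def mpCDF (c x : ℝ) : ℝ := (mpLaw c).real (Set.Iic x)

/-! ### Rows of random matrices -/

section RandomMatrix

variable {Ω : Type*} {n N : ℕ}

/-- The σ-algebra generated by the rows of the random matrix `A` with index in `S`. -/
@[reducible] def rowsSigma (A : Ω → Matrix (Fin n) (Fin N) ℝ) (S : Set (Fin n)) : MeasurableSpace Ω :=
  ⨆ i ∈ S, MeasurableSpace.comap (fun (ω : Ω) (j : Fin N) => A ω i j) inferInstance

/-- The conditional expectation `𝔼_k[X]` given all the rows of `A` except row `k`. -/
def condRow [MeasurableSpace Ω] (P : Measure Ω) (A : Ω → Matrix (Fin n) (Fin N) ℝ)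
    (k : Fin n) (X : Ω → ℝ) : Ω → ℝ :=
  P[X | rowsSigma A {k}ᶜ]

/-- The expected empirical spectral distribution `𝔼 F^{(1/n) A Aᵀ}(x)`. -/
def expectedESD [MeasurableSpace Ω] (P : Measure Ω) (A : Ω → Matrix (Fin n) (Fin N) ℝ)
    (x : ℝ) : ℝ :=
  ∫ ω, esd (gram_isHermitian (A ω)) x ∂P

/-- `q_n = sup_k (1/n) ∑_i 𝔼 |𝔼_k[ζ_{ki}²] - 1|`. -/
def qCoef [MeasurableSpace Ω] (P : Measure Ω) (A : Ω → Matrix (Fin n) (Fin N) ℝ) : ℝ :=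
  ⨆ k : Fin n, (1 / (n : ℝ)) *
    ∑ i : Fin N, ∫ ω, |condRow P A k (fun ω => A ω k i ^ 2) ω - 1| ∂P

/-- `ρ_n = sup_k (1/n²) ∑_{i,j} 𝔼 |𝔼_k[ζ_{ki}² ζ_{kj}²] - 1|`. -/
def rhoCoef [MeasurableSpace Ω] (P : Measure Ω) (A : Ω → Matrix (Fin n) (Fin N) ℝ) : ℝ :=
  ⨆ k : Fin n, (1 / (n : ℝ) ^ 2) *
    ∑ i : Fin N, ∑ j : Fin N,
      ∫ ω, |condRow P A k (fun ω => A ω k i ^ 2 * A ω k j ^ 2) ω - 1| ∂P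

end RandomMatrix

/-- Condition **C0** for a sequence of real random `n × N(n)` matrices `A n`, with a weak-correlation
sequence `γ` and a dependence range `β`. The matrices may live on different probability spaces. -/
structure ConditionC0 {Ω : ℕ → Type*} [∀ n, MeasurableSpace (Ω n)] (P : ∀ n, Measure (Ω n))
    (N : ℕ → ℕ) (A : ∀ n, Ω n → Matrix (Fin n) (Fin (N n)) ℝ) (γ : ℕ → ℝ) (β : ℕ → ℕ) :
    Prop where
  /-- the entries are random variables -/
  measurable_entry : ∀ n i j, Measurable fun ω => A n ω i j
  /-- `𝔼_k[ζ_{ki}] = 0` -/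
  cond_mean : ∀ n k i, condRow (P n) (A n) k (fun ω => A n ω k i) =ᵐ[P n] 0
  /-- `q_n = o(1)` -/
  q_tendsto : Tendsto (fun n => qCoef (P n) (A n)) atTop (𝓝 0)
  /-- `γ_n ≥ 0` -/
  gamma_nonneg : ∀ n, 0 ≤ γ n
  /-- `γ_n → 0` -/
  gamma_tendsto : Tendsto γ atTop (𝓝 0)
  /-- `sup_{k, i ≠ j} |𝔼_k[ζ_{ki} ζ_{kj}]| + sup_{k, i, j ≠ l} |𝔼_k[ζ_{ki}² ζ_{kj} ζ_{kl}]|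
  = O(n^{-1/2} γ_n)` almost surely (the index `i` in the second supremum is unrestricted; a sum
  of two nonnegative quantities is `O(·)` if and only if each of them is) -/
  cond_two : ∃ C : ℝ, ∀ᶠ n : ℕ in atTop, ∀ᵐ ω ∂(P n), ∀ k : Fin n,
    (∀ i j, i ≠ j →
      |condRow (P n) (A n) k (fun ω => A n ω k i * A n ω k j) ω|
        ≤ C * ((n : ℝ) ^ (-(1 / 2) : ℝ) * γ n)) ∧
    (∀ i j l, j ≠ l →
      |condRow (P n) (A n) k (fun ω => A n ω k i ^ 2 * A n ω k j * A n ω k l) ω|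
        ≤ C * ((n : ℝ) ^ (-(1 / 2) : ℝ) * γ n))
  /-- `sup |𝔼_k[ζ_{ki} ζ_{kj} ζ_{kl} ζ_{km}]| = O(n^{-1} γ_n)` almost surely, over all `k` and all
  distinct `i, j, l, m` -/
  cond_four : ∃ C : ℝ, ∀ᶠ n : ℕ in atTop, ∀ᵐ ω ∂(P n), ∀ k : Fin n,
    ∀ i j l m, i ≠ j → i ≠ l → i ≠ m → j ≠ l → j ≠ m → l ≠ m →
      |condRow (P n) (A n) k (fun ω => A n ω k i * A n ω k j * A n ω k l * A n ω k m) ω|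
        ≤ C * ((n : ℝ)⁻¹ * γ n)
  /-- `sup_{n,i,j} 𝔼 |ζ_{ij}|⁴ < ∞` -/
  fourth_moment : ∃ M : ℝ, ∀ n i j,
    Integrable (fun ω => |A n ω i j| ^ 4) (P n) ∧ ∫ ω, |A n ω i j| ^ 4 ∂(P n) ≤ M
  /-- `ρ_n = o(1)` -/
  rho_tendsto : Tendsto (fun n => rhoCoef (P n) (A n)) atTop (𝓝 0)
  /-- `β_n = o(√n)` -/
  beta_littleO : (fun n => (β n : ℝ)) =o[atTop] fun n : ℕ => √(n : ℝ)
  /-- families of rows at distance more than `β_n` from each other are independent -/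
  indep_rows : ∀ n, ∀ S T : Set (Fin n),
    (∀ i ∈ S, ∀ j ∈ T, (β n : ℤ) < |((i : ℕ) : ℤ) - ((j : ℕ) : ℤ)|) →
      Indep (rowsSigma (A n) S) (rowsSigma (A n) T) (P n)

end MarchenkoPastur

end

/-!
The rate is obtained from an approximate self-consistent equation for the Stieltjes transform, with
the spectral parameter written as a square `z = w²`, `w = u + i V`. In this variable the hard edge
at `0`, which is a singularity of the density when `c = 1`, disappears: the Marchenko–Pastur
distribution function `F_c(u²)` is Lipschitz in `u` (`mpCDF_sq_sub_le`), and the resolvent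
`(AᵀA/n - w²)⁻¹` is bounded by `1 / (V |w|)`.

*Self-consistent equation.* Let `m` be the expected normalized trace of `(AᵀA/n - w²)⁻¹`. By the
Sherman–Morrison formula the trace is exactly a sum of `1 - (1 + ξ_k)⁻¹` over the rows, with `ξ_k`
the quadratic form of row `k` in the resolvent without that row (`card_add_trace_eq_sum`). The
conditional moment assumptions make `ξ_k` close in `L²` to the normalized trace of that resolvent
(`integral_sq_quadForm_sub_trace_le`), removing a row changes the trace by at most `1 / (V |w|)`, and
the trace concentrates around its mean (`integral_norm_trace_sub_mean_le`): along the filtration of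
the first `k` rows, each martingale increment is bounded by the effect of erasing `β + 1` consecutive
rows, after which what remains is a function of two independent blocks. Altogether
`norm_selfConsistent_le` gives an error of order `√ε |w| / V³`, where `ε` is the maximum of `q`, `γ`,
`ρ` and `(β + 1)² / n`.

*Stability.* For `h = w m + κ / w` with `κ = N / n - 1`, which is `w` times the Stieltjes transform of
`AAᵀ/n` at `w²`, the equation becomes `h² + (w - κ / w) h + 1 = O(√ε / V⁴)`. Completing the square and
comparing imaginary parts of square roots gives `|Im h - √(mpDisc κ (u²)) / (2 u)| = O(√(V / u))` when
the error is at most `V` (`abs_im_sub_density_le`), that is, for `V = ε ^ (1 / 11)` and small `ε`.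

*Smoothing.* The integral of `Im h` over `u` in `[0, x]` is the spectral distribution function in the
variable `√λ`, smoothed by the Poisson kernel of width `V` (`integral_im_meanStieltjes`). Since
`√(V / u)` integrates to `O(√V)`, since the kernel has mass `O(√V)` beyond distance `√V`, and since
`F_c(u²)` is Lipschitz, the distribution functions differ by `O(√V)`, and `√V = ε ^ (1 / 22)`.
-/

namespace MarchenkoPastur

open Matrix Complex
open scoped ComplexOrder

/-! ### Resolvents at a squared spectral parameter -/

section Resolvent

variable {ι : Type*} [Fintype ι]

theorem star_dotProduct_self_eq (y : ι → ℂ) : star y ⬝ᵥ y = ((∑ i, ‖y i‖ ^ 2 : ℝ) : ℂ) := by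
  simp only [dotProduct, Pi.star_apply, RCLike.star_def, Complex.ofReal_sum]
  refine Finset.sum_congr rfl fun i _ => ?_
  rw [← Complex.normSq_eq_conj_mul_self, Complex.normSq_eq_norm_sq]

theorem norm_dotProduct_self_le (y : ι → ℂ) : ‖y ⬝ᵥ y‖ ≤ ∑ i, ‖y i‖ ^ 2 := by
  refine (norm_sum_le _ _).trans (Finset.sum_le_sum fun i _ => ?_)
  rw [norm_mul, pow_two]

theorem posSemidef_form {B : Matrix ι ι ℂ} (hB : B.PosSemidef) (y : ι → ℂ) :
    ∃ b : ℝ, 0 ≤ b ∧ star y ⬝ᵥ (B *ᵥ y) = b := by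
  have h := hB.dotProduct_mulVec_nonneg y
  rw [Complex.nonneg_iff] at h
  exact ⟨_, h.1, Complex.ext rfl (by simp [← h.2])⟩

theorem posSemidef_add_rankOne {B : Matrix ι ι ℂ} (hB : B.PosSemidef) {r : ι → ℂ}
    (hr : star r = r) {t : ℝ} (ht : 0 ≤ t) : (B + (t : ℂ) • vecMulVec r r).PosSemidef := by
  refine hB.add (PosSemidef.smul ?_ (by exact_mod_cast ht))
  have := posSemidef_vecMulVec_self_star r
  rwa [hr] at this

variable [DecidableEq ι]

/-- A Hermitian form shifted by `w²` is bounded below by the distance `Im w * |w|` from `w²` to the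
half-line `[0, ∞)`. -/
theorem norm_sub_sq_mul_ge (w : ℂ) (hw : 0 ≤ w.im) {b t : ℝ} (hb : 0 ≤ b) :
    w.im * ‖w‖ * t ≤ ‖(b : ℂ) - w ^ 2 * t‖ := by
  by_cases h0 : w = 0
  · simp [h0]
  have hpos : 0 < ‖w‖ := norm_pos_iff.mpr h0
  have h1 : -((starRingEnd ℂ w) * ((b : ℂ) - w ^ 2 * t)).im = w.im * b + w.im * ‖w‖ ^ 2 * t := by
    rw [Complex.sq_norm, Complex.normSq_apply]
    simp [pow_two]
    ring
  have h2 : -((starRingEnd ℂ w) * ((b : ℂ) - w ^ 2 * t)).im ≤ ‖w‖ * ‖(b : ℂ) - w ^ 2 * t‖ := by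
    refine (neg_le_abs _).trans ((Complex.abs_im_le_norm _).trans ?_)
    rw [norm_mul, Complex.norm_conj]
  have h3 : ‖w‖ * (w.im * ‖w‖ * t) ≤ ‖w‖ * ‖(b : ℂ) - w ^ 2 * t‖ := by
    have : 0 ≤ w.im * b := mul_nonneg hw hb
    nlinarith
  exact le_of_mul_le_mul_left h3 hpos

theorem form_sub_sq {B : Matrix ι ι ℂ} (hB : B.PosSemidef) (w : ℂ) (y : ι → ℂ) :
    ∃ b : ℝ, 0 ≤ b ∧ star y ⬝ᵥ ((B - w ^ 2 • (1 : Matrix ι ι ℂ)) *ᵥ y)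
      = b - w ^ 2 * ((∑ i, ‖y i‖ ^ 2 : ℝ) : ℂ) := by
  obtain ⟨b, hb, h⟩ := posSemidef_form hB y
  refine ⟨b, hb, ?_⟩
  rw [sub_mulVec, dotProduct_sub, h, smul_mulVec, one_mulVec, dotProduct_smul,
    star_dotProduct_self_eq, smul_eq_mul]

theorem isUnit_det_sub_sq {B : Matrix ι ι ℂ} (hB : B.PosSemidef) {w : ℂ} (hw : 0 < w.im) :
    IsUnit (B - w ^ 2 • (1 : Matrix ι ι ℂ)).det := by
  rw [isUnit_iff_ne_zero]
  intro h
  obtain ⟨y, hy, hy0⟩ := Matrix.exists_mulVec_eq_zero_iff.mpr h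
  obtain ⟨b, hb, h1⟩ := form_sub_sq hB w y
  have h2 := norm_sub_sq_mul_ge w hw.le hb (t := ∑ i, ‖y i‖ ^ 2)
  rw [← h1, hy0, dotProduct_zero, norm_zero] at h2
  have hwn : 0 < ‖w‖ := norm_pos_iff.mpr (by rintro rfl; simp at hw)
  have h3 : ∑ i, ‖y i‖ ^ 2 = 0 :=
    le_antisymm (nonpos_of_mul_nonpos_right h2 (mul_pos hw hwn))
      (Finset.sum_nonneg fun i _ => sq_nonneg _)
  rw [Finset.sum_eq_zero_iff_of_nonneg fun i _ => sq_nonneg _] at h3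
  apply hy
  funext i
  simpa using h3 i (Finset.mem_univ i)

/-- The resolvent `(B - w²)⁻¹`. The spectral parameter is written as a square `w²` because this
opens up the hard edge of the spectrum at `0`. -/
noncomputable def sqRes (B : Matrix ι ι ℂ) (w : ℂ) : Matrix ι ι ℂ :=
  (B - w ^ 2 • (1 : Matrix ι ι ℂ))⁻¹

theorem mul_sqRes {B : Matrix ι ι ℂ} (hB : B.PosSemidef) {w : ℂ} (hw : 0 < w.im) :
    (B - w ^ 2 • (1 : Matrix ι ι ℂ)) * sqRes B w = 1 :=
  mul_nonsing_inv _ (isUnit_det_sub_sq hB hw)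

theorem sqRes_mul {B : Matrix ι ι ℂ} (hB : B.PosSemidef) {w : ℂ} (hw : 0 < w.im) :
    sqRes B w * (B - w ^ 2 • (1 : Matrix ι ι ℂ)) = 1 :=
  nonsing_inv_mul _ (isUnit_det_sub_sq hB hw)

theorem sqRes_transpose {B : Matrix ι ι ℂ} (hs : Bᵀ = B) (w : ℂ) : (sqRes B w)ᵀ = sqRes B w := by
  rw [sqRes, transpose_nonsing_inv, transpose_sub, hs, transpose_smul, transpose_one]

theorem sqRes_mulVec_form {B : Matrix ι ι ℂ} (hB : B.PosSemidef) {w : ℂ} (hw : 0 < w.im)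
    (x : ι → ℂ) : ∃ b : ℝ, 0 ≤ b ∧ star (sqRes B w *ᵥ x) ⬝ᵥ x
      = b - w ^ 2 * ((∑ i, ‖(sqRes B w *ᵥ x) i‖ ^ 2 : ℝ) : ℂ) := by
  obtain ⟨b, hb, h⟩ := form_sub_sq hB w (sqRes B w *ᵥ x)
  refine ⟨b, hb, ?_⟩
  rwa [mulVec_mulVec, mul_sqRes hB hw, one_mulVec] at h

theorem sum_sq_norm_sqRes_col_le {B : Matrix ι ι ℂ} (hB : B.PosSemidef) {w : ℂ} (hw : 0 < w.im)
    (j : ι) : (w.im * ‖w‖) ^ 2 * ∑ i, ‖sqRes B w i j‖ ^ 2 ≤ 1 := by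
  obtain ⟨b, hb, h⟩ := sqRes_mulVec_form hB hw (Pi.single j 1)
  simp only [mulVec_single_one, Matrix.col_apply] at h
  set t := ∑ i, ‖sqRes B w i j‖ ^ 2 with ht
  have h2 := norm_sub_sq_mul_ge w hw.le hb (t := t)
  have ht0 : 0 ≤ t := Finset.sum_nonneg fun i _ => sq_nonneg _
  rw [← h, dotProduct_single_one] at h2
  simp only [Pi.star_apply, Matrix.col_apply, norm_star] at h2
  have h3 : ‖sqRes B w j j‖ ^ 2 ≤ t :=
    Finset.single_le_sum (f := fun i => ‖sqRes B w i j‖ ^ 2) (fun i _ => sq_nonneg _)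
      (Finset.mem_univ j)
  have hd : 0 ≤ w.im * ‖w‖ := by positivity
  have h4 : (w.im * ‖w‖ * t) ^ 2 ≤ t :=
    le_trans (pow_le_pow_left₀ (mul_nonneg hd ht0) h2 2) h3
  by_cases h0 : t = 0
  · rw [h0]; simp
  · have : 0 < t := lt_of_le_of_ne ht0 (Ne.symm h0)
    refine le_of_mul_le_mul_right ?_ this
    nlinarith

theorem norm_sqRes_apply_le {B : Matrix ι ι ℂ} (hB : B.PosSemidef) {w : ℂ} (hw : 0 < w.im)
    (i j : ι) : (w.im * ‖w‖) * ‖sqRes B w i j‖ ≤ 1 := by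
  have h := sum_sq_norm_sqRes_col_le hB hw j
  have h3 : ‖sqRes B w i j‖ ^ 2 ≤ ∑ i, ‖sqRes B w i j‖ ^ 2 :=
    Finset.single_le_sum (f := fun i => ‖sqRes B w i j‖ ^ 2) (fun i _ => sq_nonneg _)
      (Finset.mem_univ i)
  have h4 : ((w.im * ‖w‖) * ‖sqRes B w i j‖) ^ 2 ≤ 1 := by
    rw [mul_pow]
    exact (mul_le_mul_of_nonneg_left h3 (sq_nonneg _)).trans h
  exact (sq_le_one_iff₀ (by positivity)).mp h4

/-- For a real vector `r`, the number `w * rᵀ (B - w²)⁻¹ r` lies in the upper half-plane, with a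
quantitative bound. -/
theorem im_mul_form_ge {B : Matrix ι ι ℂ} (hB : B.PosSemidef) {w : ℂ} (hw : 0 < w.im)
    {r : ι → ℂ} (hr : star r = r) :
    w.im * ‖w‖ ^ 2 * ∑ i, ‖(sqRes B w *ᵥ r) i‖ ^ 2 ≤ (w * (r ⬝ᵥ (sqRes B w *ᵥ r))).im := by
  obtain ⟨b, hb, h⟩ := sqRes_mulVec_form hB hw r
  set t := ∑ i, ‖(sqRes B w *ᵥ r) i‖ ^ 2
  have h1 : r ⬝ᵥ (sqRes B w *ᵥ r) = starRingEnd ℂ (b - w ^ 2 * (t : ℂ)) := by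
    rw [← h, ← RCLike.star_def, star_dotProduct, star_star, hr, dotProduct_comm]
  have h2 : (w * (r ⬝ᵥ (sqRes B w *ᵥ r))).im = w.im * b + w.im * ‖w‖ ^ 2 * t := by
    rw [h1, Complex.sq_norm, Complex.normSq_apply]
    simp [pow_two]
    ring
  rw [h2]
  have := mul_nonneg hw.le hb
  linarith

theorem im_mul_trace_nonneg {B : Matrix ι ι ℂ} (hB : B.PosSemidef) {w : ℂ} (hw : 0 < w.im) :
    0 ≤ (w * (sqRes B w).trace).im := by
  rw [trace, Finset.mul_sum, Complex.im_sum]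
  refine Finset.sum_nonneg fun i _ => ?_
  have h := im_mul_form_ge hB hw (r := Pi.single i 1) (by
    ext j; by_cases h : j = i
    · subst h; simp
    · simp [h])
  rw [mulVec_single_one, single_one_dotProduct] at h
  refine le_trans ?_ h
  positivity

/-- If `w * x` is in the upper half-plane then `1 + x` is bounded away from `0`. -/
theorem im_le_norm_mul_norm_one_add {w x : ℂ} (hx : 0 ≤ (w * x).im) :
    w.im ≤ ‖w‖ * ‖1 + x‖ := by
  rw [← norm_mul]
  refine le_trans ?_ (Complex.im_le_norm _)
  rw [mul_add, mul_one, Complex.add_im]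
  linarith

/-! ### Rank-one perturbations -/

theorem im_mul_smul_form_ge {B : Matrix ι ι ℂ} (hB : B.PosSemidef) {w : ℂ} (hw : 0 < w.im)
    {r : ι → ℂ} (hr : star r = r) {t : ℝ} (ht : 0 ≤ t) :
    w.im * ‖w‖ ^ 2 * (t * ∑ i, ‖(sqRes B w *ᵥ r) i‖ ^ 2)
      ≤ (w * (t * (r ⬝ᵥ (sqRes B w *ᵥ r)))).im := by
  have h := mul_le_mul_of_nonneg_left (im_mul_form_ge hB hw hr) ht
  rw [show w * ((t : ℂ) * (r ⬝ᵥ (sqRes B w *ᵥ r))) = (t : ℂ) * (w * (r ⬝ᵥ (sqRes B w *ᵥ r))) by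
    ring, Complex.im_ofReal_mul]
  linarith

theorem one_add_form_ne_zero {B : Matrix ι ι ℂ} (hB : B.PosSemidef) {w : ℂ} (hw : 0 < w.im)
    {r : ι → ℂ} (hr : star r = r) {t : ℝ} (ht : 0 ≤ t) :
    1 + (t : ℂ) * (r ⬝ᵥ (sqRes B w *ᵥ r)) ≠ 0 := by
  intro h
  have h1 := im_mul_smul_form_ge hB hw hr ht
  have h2 := im_le_norm_mul_norm_one_add (le_trans (by positivity) h1)
  rw [h, norm_zero, mul_zero] at h2
  linarith

/-- The Sherman–Morrison formula, applied to the perturbing vector. -/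
theorem sqRes_rankOne_mulVec {B : Matrix ι ι ℂ} (hB : B.PosSemidef) {w : ℂ} (hw : 0 < w.im)
    {r : ι → ℂ} (hr : star r = r) {t : ℝ} (ht : 0 ≤ t) :
    sqRes (B + (t : ℂ) • vecMulVec r r) w *ᵥ r
      = (1 + (t : ℂ) * (r ⬝ᵥ (sqRes B w *ᵥ r)))⁻¹ • (sqRes B w *ᵥ r) := by
  have h1 : (B + (t : ℂ) • vecMulVec r r - w ^ 2 • (1 : Matrix ι ι ℂ)) *ᵥ (sqRes B w *ᵥ r)
      = (1 + (t : ℂ) * (r ⬝ᵥ (sqRes B w *ᵥ r))) • r := by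
    rw [add_sub_right_comm, add_mulVec, mulVec_mulVec, mul_sqRes hB hw, one_mulVec, smul_mulVec,
      vecMulVec_mulVec, op_smul_eq_smul, smul_smul, add_smul, one_smul]
  have h2 : (1 + (t : ℂ) * (r ⬝ᵥ (sqRes B w *ᵥ r))) •
      (sqRes (B + (t : ℂ) • vecMulVec r r) w *ᵥ r) = sqRes B w *ᵥ r := by
    rw [← mulVec_smul, ← h1, mulVec_mulVec, sqRes_mul (posSemidef_add_rankOne hB hr ht) hw,
      one_mulVec]
  exact (eq_inv_smul_iff₀ (one_add_form_ne_zero hB hw hr ht)).mpr h2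

theorem form_sqRes_rankOne {B : Matrix ι ι ℂ} (hB : B.PosSemidef) {w : ℂ} (hw : 0 < w.im)
    {r : ι → ℂ} (hr : star r = r) {t : ℝ} (ht : 0 ≤ t) :
    (t : ℂ) * (r ⬝ᵥ (sqRes (B + (t : ℂ) • vecMulVec r r) w *ᵥ r))
      = 1 - (1 + (t : ℂ) * (r ⬝ᵥ (sqRes B w *ᵥ r)))⁻¹ := by
  have h0 := one_add_form_ne_zero hB hw hr ht
  rw [sqRes_rankOne_mulVec hB hw hr ht, dotProduct_smul, smul_eq_mul]
  field_simp
  ring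

theorem trace_sqRes_rankOne {B : Matrix ι ι ℂ} (hB : B.PosSemidef) {w : ℂ} (hw : 0 < w.im)
    (hs : Bᵀ = B) {r : ι → ℂ} (hr : star r = r) {t : ℝ} (ht : 0 ≤ t) :
    (sqRes (B + (t : ℂ) • vecMulVec r r) w).trace = (sqRes B w).trace
      - (t : ℂ) * (1 + (t : ℂ) * (r ⬝ᵥ (sqRes B w *ᵥ r)))⁻¹ *
        ((sqRes B w *ᵥ r) ⬝ᵥ (sqRes B w *ᵥ r)) := by
  set B' := B + (t : ℂ) • vecMulVec r r
  have hB' : B'.PosSemidef := posSemidef_add_rankOne hB hr ht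
  have h1 : sqRes B' w = sqRes B w - (t : ℂ) • (sqRes B' w * vecMulVec r r * sqRes B w) := by
    have h2 : sqRes B' w * (B' - w ^ 2 • (1 : Matrix ι ι ℂ)) * sqRes B w
        - sqRes B' w * ((B - w ^ 2 • (1 : Matrix ι ι ℂ)) * sqRes B w)
        = (t : ℂ) • (sqRes B' w * vecMulVec r r * sqRes B w) := by
      simp only [B', mul_assoc, ← mul_sub, ← sub_mul, add_sub_right_comm, sub_self, zero_add,
        smul_mul, Matrix.mul_smul]
    rw [sqRes_mul hB' hw, mul_sqRes hB hw, one_mul, mul_one] at h2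
    rw [← h2, sub_sub_cancel]
  have hG : r ᵥ* sqRes B w = sqRes B w *ᵥ r := by
    rw [← mulVec_transpose, sqRes_transpose hs]
  rw [h1, trace_sub, trace_smul, mul_vecMulVec, vecMulVec_mul, hG, trace_vecMulVec,
    sqRes_rankOne_mulVec hB hw hr ht, smul_dotProduct, smul_eq_mul, smul_eq_mul, mul_assoc]

/-- A rank-one perturbation moves the trace of the resolvent by at most the inverse of the distance
from `w²` to the spectrum, whatever the size of the perturbation. -/
theorem norm_trace_sqRes_rankOne_sub_le {B : Matrix ι ι ℂ} (hB : B.PosSemidef) {w : ℂ}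
    (hw : 0 < w.im) (hs : Bᵀ = B) {r : ι → ℂ} (hr : star r = r) {t : ℝ} (ht : 0 ≤ t) :
    w.im * ‖w‖ * ‖(sqRes B w).trace - (sqRes (B + (t : ℂ) • vecMulVec r r) w).trace‖ ≤ 1 := by
  rw [trace_sqRes_rankOne hB hw hs hr ht, sub_sub_cancel, norm_mul, norm_mul, norm_inv,
    Complex.norm_real, Real.norm_of_nonneg ht]
  have h1 := im_mul_smul_form_ge hB hw hr ht
  have h0 := one_add_form_ne_zero hB hw hr ht
  set x := (t : ℂ) * (r ⬝ᵥ (sqRes B w *ᵥ r))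
  set T := ∑ i, ‖(sqRes B w *ᵥ r) i‖ ^ 2
  have h2 := norm_dotProduct_self_le (sqRes B w *ᵥ r)
  have hwn : 0 < ‖w‖ := norm_pos_iff.mpr (by rintro rfl; simp at hw)
  have h3 : (w * (1 + x)).im ≤ ‖w‖ * ‖1 + x‖ := by
    rw [← norm_mul]; exact Complex.im_le_norm _
  rw [mul_add, mul_one, Complex.add_im] at h3
  have h4 : w.im * ‖w‖ * (t * T) ≤ ‖1 + x‖ := by
    refine le_of_mul_le_mul_left ?_ hwn
    linarith [hw.le]
  have h5 : 0 < ‖1 + x‖ := norm_pos_iff.mpr h0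
  calc w.im * ‖w‖ * (t * ‖1 + x‖⁻¹ * ‖(sqRes B w *ᵥ r) ⬝ᵥ (sqRes B w *ᵥ r)‖)
      ≤ w.im * ‖w‖ * (t * ‖1 + x‖⁻¹ * T) := by gcongr
    _ = (w.im * ‖w‖ * (t * T)) * ‖1 + x‖⁻¹ := by ring
    _ ≤ ‖1 + x‖ * ‖1 + x‖⁻¹ := by gcongr
    _ = 1 := mul_inv_cancel₀ h5.ne'

end Resolvent

/-! ### Sample covariance matrices -/

section Cov

variable {n N : ℕ}

/-- The `N × N` sample covariance matrix `(1/n) Aᵀ A`, with complex entries. -/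
noncomputable def cov (a : Matrix (Fin n) (Fin N) ℝ) : Matrix (Fin N) (Fin N) ℂ :=
  ((1 / (n : ℝ)) • (aᵀ * a)).map Complex.ofReal

/-- Row `k` of a real matrix as a complex vector. -/
def cRow (a : Matrix (Fin n) (Fin N) ℝ) (k : Fin n) : Fin N → ℂ := fun j => a k j

/-- The matrix obtained from `a` by replacing the rows outside `S` with zero. -/
def keepRows (S : Finset (Fin n)) (a : Matrix (Fin n) (Fin N) ℝ) : Matrix (Fin n) (Fin N) ℝ :=
  Matrix.of fun i j => if i ∈ S then a i j else 0

theorem star_cRow (a : Matrix (Fin n) (Fin N) ℝ) (k : Fin n) : star (cRow a k) = cRow a k := by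
  ext j; simp [cRow]

theorem cov_eq_sum (a : Matrix (Fin n) (Fin N) ℝ) :
    cov a = ∑ k, ((1 / (n : ℝ) : ℝ) : ℂ) • vecMulVec (cRow a k) (cRow a k) := by
  ext i j
  simp [cov, cRow, Matrix.mul_apply, Matrix.sum_apply, vecMulVec_apply, Finset.mul_sum]

theorem cov_posSemidef (a : Matrix (Fin n) (Fin N) ℝ) : (cov a).PosSemidef := by
  rw [cov_eq_sum]
  refine posSemidef_sum _ fun k _ => PosSemidef.smul ?_ (by
    rw [Complex.zero_le_real]; positivity)
  have := posSemidef_vecMulVec_self_star (cRow a k)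
  rwa [star_cRow] at this

theorem cov_transpose (a : Matrix (Fin n) (Fin N) ℝ) : (cov a)ᵀ = cov a := by
  ext i j
  simp [cov, Matrix.mul_apply, mul_comm]

theorem cov_keepRows (S : Finset (Fin n)) (a : Matrix (Fin n) (Fin N) ℝ) :
    cov (keepRows S a) = ∑ k ∈ S, ((1 / (n : ℝ) : ℝ) : ℂ) • vecMulVec (cRow a k) (cRow a k) := by
  rw [cov_eq_sum, ← Finset.sum_subset (Finset.subset_univ S)]
  · refine Finset.sum_congr rfl fun k hk => ?_
    have : cRow (keepRows S a) k = cRow a k := by ext j; simp [cRow, keepRows, hk]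
    rw [this]
  · intro k _ hk
    have : cRow (keepRows S a) k = 0 := by ext j; simp [cRow, keepRows, hk]
    rw [this]; simp

theorem cov_keepRows_insert {S : Finset (Fin n)} {k : Fin n} (hk : k ∉ S)
    (a : Matrix (Fin n) (Fin N) ℝ) :
    cov (keepRows (insert k S) a) = cov (keepRows S a)
      + ((1 / (n : ℝ) : ℝ) : ℂ) • vecMulVec (cRow a k) (cRow a k) := by
  rw [cov_keepRows, cov_keepRows, Finset.sum_insert hk, add_comm]

theorem keepRows_univ (a : Matrix (Fin n) (Fin N) ℝ) : keepRows Finset.univ a = a := by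
  ext; simp [keepRows]

theorem cov_eq_add_row (k : Fin n) (a : Matrix (Fin n) (Fin N) ℝ) :
    cov a = cov (keepRows {k}ᶜ a)
      + ((1 / (n : ℝ) : ℝ) : ℂ) • vecMulVec (cRow a k) (cRow a k) := by
  rw [← cov_keepRows_insert (by simp), ← Finset.compl_erase]
  simp [keepRows_univ]

/-- Removing the rows outside `S` moves the trace of the resolvent by at most `#Sᶜ` times the
inverse of the distance to the spectrum. -/
theorem norm_trace_sub_keepRows_le (a : Matrix (Fin n) (Fin N) ℝ) {w : ℂ} (hw : 0 < w.im)
    (S : Finset (Fin n)) :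
    w.im * ‖w‖ * ‖(sqRes (cov a) w).trace - (sqRes (cov (keepRows Sᶜ a)) w).trace‖ ≤ S.card := by
  induction S using Finset.induction_on with
  | empty => simp [keepRows_univ]
  | insert k S hk ih =>
    have h1 := norm_trace_sqRes_rankOne_sub_le (cov_posSemidef (keepRows (insert k S)ᶜ a)) hw
      (cov_transpose _) (star_cRow a k) (t := 1 / (n : ℝ)) (by positivity)
    rw [← cov_keepRows_insert (by simp)] at h1
    have h2 : insert k (insert k S)ᶜ = Sᶜ := by
      ext i; by_cases h : i = k
      · subst h; simp [hk]
      · simp [h]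
    rw [h2] at h1
    have hd : 0 ≤ w.im * ‖w‖ := by positivity
    rw [Finset.card_insert_of_notMem hk]
    push_cast
    have h3 := norm_sub_le_norm_sub_add_norm_sub (sqRes (cov a) w).trace
      (sqRes (cov (keepRows Sᶜ a)) w).trace (sqRes (cov (keepRows (insert k S)ᶜ a)) w).trace
    rw [norm_sub_rev (sqRes (cov (keepRows Sᶜ a)) w).trace] at h3
    nlinarith [mul_le_mul_of_nonneg_left h3 hd]

/-- The rescaled quadratic form `(1/n) r_kᵀ G_k r_k`, with `G_k` the resolvent of the sample
covariance matrix without row `k`. -/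
noncomputable def rowForm (a : Matrix (Fin n) (Fin N) ℝ) (w : ℂ) (k : Fin n) : ℂ :=
  ((1 / (n : ℝ) : ℝ) : ℂ) *
    (cRow a k ⬝ᵥ (sqRes (cov (keepRows {k}ᶜ a)) w *ᵥ cRow a k))

theorem im_mul_rowForm_nonneg (a : Matrix (Fin n) (Fin N) ℝ) {w : ℂ} (hw : 0 < w.im)
    (k : Fin n) : 0 ≤ (w * rowForm a w k).im := by
  refine le_trans ?_ (im_mul_smul_form_ge (cov_posSemidef _) hw (star_cRow a k) (by positivity))
  positivity

/-- The trace of the resolvent in terms of the quadratic forms `rowForm`. -/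
theorem card_add_trace_eq_sum (a : Matrix (Fin n) (Fin N) ℝ) {w : ℂ} (hw : 0 < w.im) :
    (N : ℂ) + w ^ 2 * (sqRes (cov a) w).trace = ∑ k, (1 - (1 + rowForm a w k)⁻¹) := by
  have h1 := mul_sqRes (cov_posSemidef a) hw
  have h2 : (cov a * sqRes (cov a) w).trace = (N : ℂ) + w ^ 2 * (sqRes (cov a) w).trace := by
    rw [sub_mul, smul_mul, one_mul, sub_eq_iff_eq_add] at h1
    rw [h1, trace_add, trace_one, trace_smul, Fintype.card_fin, smul_eq_mul]
  rw [← h2]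
  conv_lhs => enter [1, 1]; rw [cov_eq_sum]
  rw [Finset.sum_mul, trace_sum]
  refine Finset.sum_congr rfl fun k _ => ?_
  rw [rowForm, ← form_sqRes_rankOne (cov_posSemidef _) hw (star_cRow a k) (by positivity),
    ← cov_eq_add_row, smul_mul, trace_smul, vecMulVec_mul, trace_vecMulVec, smul_eq_mul,
    ← mulVec_transpose, sqRes_transpose (cov_transpose a)]

end Cov
end MarchenkoPastur

namespace MarchenkoPastur

/-! ### Quadratic forms of weakly correlated vectors -/

section QuadForm

variable {N : ℕ}

theorem sum_abs_row_le {H : Matrix (Fin N) (Fin N) ℝ} (hrow : ∀ i, ∑ j, H i j ^ 2 ≤ 1)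
    (i : Fin N) : ∑ j, |H i j| ≤ √N := by
  apply Real.le_sqrt_of_sq_le
  refine (sq_sum_le_card_mul_sum_sq (s := Finset.univ) (f := fun j => |H i j|)).trans ?_
  simp only [sq_abs, Finset.card_univ, Fintype.card_fin]
  exact (mul_le_mul_of_nonneg_left (hrow i) (Nat.cast_nonneg N)).trans (by simp)

theorem abs_apply_le_one {H : Matrix (Fin N) (Fin N) ℝ} (hrow : ∀ i, ∑ j, H i j ^ 2 ≤ 1)
    (i j : Fin N) : |H i j| ≤ 1 := by
  rw [← sq_le_one_iff_abs_le_one]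
  exact (Finset.single_le_sum (f := fun j => H i j ^ 2) (fun _ _ => sq_nonneg _)
    (Finset.mem_univ j)).trans (hrow i)

/-- The error bound for the conditional fourth moments: `p` when all indices are distinct, `s` when
some pair of indices coincides, and `τ` when the indices pair up completely. -/
def momentBound (p s : ℝ) (τ : Fin N → Fin N → ℝ) (i j l m : Fin N) : ℝ :=
  p + s * ((if i = j then 1 else 0) + (if l = m then 1 else 0) + (if i = l then 1 else 0)
    + (if i = m then 1 else 0) + (if j = l then 1 else 0) + (if j = m then 1 else 0))
  + (if i = j then 1 else 0) * (if l = m then 1 else 0) * τ i l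
  + (if i = l then 1 else 0) * (if j = m then 1 else 0) * (1 + τ i j)
  + (if i = m then 1 else 0) * (if j = l then 1 else 0) * (1 + τ i j)

theorem indicator_nonneg (p : Prop) [Decidable p] : (0 : ℝ) ≤ if p then 1 else 0 := by
  split_ifs <;> simp

theorem le_momentBound_of_eq {p s : ℝ} (hp : 0 ≤ p) (hs : 0 ≤ s) {τ : Fin N → Fin N → ℝ}
    (hτ : ∀ i j, 0 ≤ τ i j) {i j l m : Fin N}
    (h : i = j ∨ l = m ∨ i = l ∨ i = m ∨ j = l ∨ j = m) : s ≤ momentBound p s τ i j l m := by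
  unfold momentBound
  have h0 : (1 : ℝ) ≤ (if i = j then 1 else 0) + (if l = m then 1 else 0) + (if i = l then 1 else 0)
      + (if i = m then 1 else 0) + (if j = l then 1 else 0) + (if j = m then 1 else 0) := by
    have := indicator_nonneg (i = j)
    have := indicator_nonneg (l = m)
    have := indicator_nonneg (i = l)
    have := indicator_nonneg (i = m)
    have := indicator_nonneg (j = l)
    have := indicator_nonneg (j = m)
    rcases h with h | h | h | h | h | h <;> rw [if_pos h] at * <;> linarith
  have h1 := le_mul_of_one_le_right hs h0
  have h2 := mul_nonneg (mul_nonneg (indicator_nonneg (i = j)) (indicator_nonneg (l = m))) (hτ i l)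
  have h3 := mul_nonneg (mul_nonneg (indicator_nonneg (i = l)) (indicator_nonneg (j = m)))
    (add_nonneg zero_le_one (hτ i j))
  have h4 := mul_nonneg (mul_nonneg (indicator_nonneg (i = m)) (indicator_nonneg (j = l)))
    (add_nonneg zero_le_one (hτ i j))
  linarith

theorem le_momentBound_diag {p s : ℝ} (hp : 0 ≤ p) (hs : 0 ≤ s) {τ : Fin N → Fin N → ℝ}
    (hτ : ∀ i j, 0 ≤ τ i j) (i l : Fin N) : τ i l ≤ momentBound p s τ i i l l := by
  have h := mul_nonneg (indicator_nonneg (i = l)) (indicator_nonneg (i = l))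
  have h1 := mul_nonneg h (add_nonneg zero_le_one (hτ i i))
  have h2 := mul_nonneg hs (indicator_nonneg (i = l))
  simp only [momentBound, if_true]
  linarith

theorem le_momentBound_cross {p s : ℝ} (hp : 0 ≤ p) (hs : 0 ≤ s) {τ : Fin N → Fin N → ℝ}
    (hτ : ∀ i j, 0 ≤ τ i j) (i j : Fin N) :
    1 + τ i j ≤ momentBound p s τ i j i j ∧ 1 + τ i j ≤ momentBound p s τ i j j i := by
  have h := mul_nonneg (indicator_nonneg (i = j)) (indicator_nonneg (i = j))
  have h1 := mul_nonneg h (hτ i i)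
  have h1' := mul_nonneg h (hτ i j)
  have h2 := mul_nonneg hs (indicator_nonneg (i = j))
  have h3 := mul_nonneg h (add_nonneg zero_le_one (hτ i j))
  simp only [momentBound, if_true, eq_comm (a := j) (b := i)]
  constructor <;> linarith

/-- The sum of the error bounds against weights with `ℓ²`-bounded rows. A term without coincidences
costs `N³`, since the `ℓ¹` norm of a row is at most `√N`; a coincidence saves a factor `√N` or `N`,
and a complete pairing is paid for by the Hilbert–Schmidt norm. -/
theorem sum_momentBound_le {a : Fin N → Fin N → ℝ} {R : ℝ} (ha : ∀ i j, 0 ≤ a i j)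
    (ha1 : ∀ i j, a i j ≤ 1) (hsym : ∀ i j, a i j = a j i) (hrow : ∀ i, ∑ j, a i j ≤ R)
    (hsq : ∀ i, ∑ j, a i j ^ 2 ≤ 1) (hR : R ^ 2 = N) (hR0 : 0 ≤ R) {p s : ℝ} (hp : 0 ≤ p)
    (hs : 0 ≤ s) {τ : Fin N → Fin N → ℝ} (hτ : ∀ i j, 0 ≤ τ i j) :
    ∑ i, ∑ j, ∑ l, ∑ m, a i j * a l m * momentBound p s τ i j l m
      ≤ p * N ^ 3 + s * (2 * N ^ 2 * R + 4 * N ^ 2) + 3 * ∑ i, ∑ j, τ i j + 2 * N := by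
  have hcol : ∀ j, ∑ i, a i j ≤ R := fun j => by simpa only [hsym _ j] using hrow j
  have hcard : ∀ c : ℝ, ∑ _i : Fin N, c = N * c := fun c => by simp
  have htot : ∑ i, ∑ j, a i j ≤ N * R :=
    (Finset.sum_le_sum fun i _ => hrow i).trans (hcard R).le
  have htot0 : 0 ≤ ∑ i, ∑ j, a i j :=
    Finset.sum_nonneg fun i _ => Finset.sum_nonneg fun j _ => ha i j
  have hrow0 : ∀ i, 0 ≤ ∑ j, a i j := fun i => Finset.sum_nonneg fun j _ => ha i j
  have hcol0 : ∀ j, 0 ≤ ∑ i, a i j := fun j => Finset.sum_nonneg fun i _ => ha i j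
  have hdiag : ∑ i, a i i ≤ N := (Finset.sum_le_sum fun i _ => ha1 i i).trans (by simp)
  have hdiag0 : 0 ≤ ∑ i, a i i := Finset.sum_nonneg fun i _ => ha i i
  -- all indices free
  have e0 : ∑ i, ∑ j, ∑ l, ∑ m, a i j * a l m * p ≤ p * N ^ 3 := by
    have : ∑ i, ∑ j, ∑ l, ∑ m, a i j * a l m * p = (∑ i, ∑ j, a i j) * (∑ i, ∑ j, a i j) * p := by
      simp only [← Finset.sum_mul, ← Finset.mul_sum]
    rw [this]
    have h1 : (∑ i, ∑ j, a i j) * (∑ i, ∑ j, a i j) ≤ (N * R) * (N * R) := by gcongr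
    have h2 : (N * R) * (N * R) = (N : ℝ) ^ 3 := by rw [mul_mul_mul_comm, ← pow_two R, hR]; ring
    nlinarith
  -- one coincidence inside a pair
  have e1 : ∑ i, ∑ j, ∑ l, ∑ m, a i j * a l m * (s * (if i = j then 1 else 0))
      ≤ s * (N ^ 2 * R) := by
    have : ∑ i, ∑ j, ∑ l, ∑ m, a i j * a l m * (s * (if i = j then 1 else 0))
        = s * ((∑ i, a i i) * (∑ l, ∑ m, a l m)) := by
      simp only [mul_ite, mul_one, mul_zero, Finset.sum_ite_irrel, Finset.sum_const_zero,
        Finset.sum_ite_eq, Finset.mem_univ, if_true]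
      simp only [← Finset.sum_mul, ← Finset.mul_sum]
      ring
    rw [this]
    calc s * ((∑ i, a i i) * (∑ l, ∑ m, a l m)) ≤ s * (N * (N * R)) := by gcongr
      _ = _ := by ring
  have e2 : ∑ i, ∑ j, ∑ l, ∑ m, a i j * a l m * (s * (if l = m then 1 else 0))
      ≤ s * (N ^ 2 * R) := by
    have : ∑ i, ∑ j, ∑ l, ∑ m, a i j * a l m * (s * (if l = m then 1 else 0))
        = s * ((∑ i, ∑ j, a i j) * (∑ l, a l l)) := by
      simp only [mul_ite, mul_one, mul_zero,
        Finset.sum_ite_eq, Finset.mem_univ, if_true]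
      simp only [← Finset.sum_mul, ← Finset.mul_sum]
      ring
    rw [this]
    calc s * ((∑ i, ∑ j, a i j) * (∑ l, a l l)) ≤ s * ((N * R) * N) := by gcongr
      _ = _ := by ring
  have key : ∀ f g : Fin N → ℝ, (∀ i, 0 ≤ f i) → (∀ i, 0 ≤ g i) → (∀ i, f i ≤ R) →
      (∀ i, g i ≤ R) → s * ∑ i, f i * g i ≤ s * N ^ 2 := by
    intro f g hf hg hfR hgR
    have : ∑ i, f i * g i ≤ ∑ _i : Fin N, R * R :=
      Finset.sum_le_sum fun i _ => mul_le_mul (hfR i) (hgR i) (hg i) hR0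
    rw [hcard] at this
    have h2 : (N : ℝ) * (R * R) = N ^ 2 := by rw [← pow_two, hR]; ring
    rw [h2] at this
    gcongr
  have e3 : ∑ i, ∑ j, ∑ l, ∑ m, a i j * a l m * (s * (if i = l then 1 else 0)) ≤ s * N ^ 2 := by
    refine le_trans (le_of_eq ?_) (key (fun i => ∑ j, a i j) (fun i => ∑ j, a i j)
      hrow0 hrow0 hrow hrow)
    simp only [mul_ite, mul_one, mul_zero, Finset.sum_ite_irrel, Finset.sum_const_zero,
        Finset.sum_ite_eq, Finset.mem_univ, if_true]
    simp only [← Finset.sum_mul, ← Finset.mul_sum]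
    ring
  have e4 : ∑ i, ∑ j, ∑ l, ∑ m, a i j * a l m * (s * (if i = m then 1 else 0)) ≤ s * N ^ 2 := by
    refine le_trans (le_of_eq ?_) (key (fun i => ∑ j, a i j) (fun i => ∑ j, a j i)
      hrow0 hcol0 hrow hcol)
    simp only [mul_ite, mul_one, mul_zero,
        Finset.sum_ite_eq, Finset.mem_univ, if_true]
    simp only [← Finset.sum_mul, ← Finset.mul_sum]
    ring
  have e5 : ∑ i, ∑ j, ∑ l, ∑ m, a i j * a l m * (s * (if j = l then 1 else 0)) ≤ s * N ^ 2 := by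
    refine le_trans (le_of_eq ?_) (key (fun i => ∑ j, a j i) (fun i => ∑ j, a i j)
      hcol0 hrow0 hcol hrow)
    simp only [mul_ite, mul_one, mul_zero, Finset.sum_ite_irrel, Finset.sum_const_zero,
        Finset.sum_ite_eq, Finset.mem_univ, if_true]
    rw [Finset.sum_comm]
    simp only [← Finset.sum_mul, ← Finset.mul_sum]
    ring
  have e6 : ∑ i, ∑ j, ∑ l, ∑ m, a i j * a l m * (s * (if j = m then 1 else 0)) ≤ s * N ^ 2 := by
    refine le_trans (le_of_eq ?_) (key (fun i => ∑ j, a j i) (fun i => ∑ j, a j i)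
      hcol0 hcol0 hcol hcol)
    simp only [mul_ite, mul_one, mul_zero,
        Finset.sum_ite_eq, Finset.mem_univ, if_true]
    rw [Finset.sum_comm]
    simp only [← Finset.sum_mul, ← Finset.mul_sum]
    ring
  -- complete pairings
  have hle1 : ∀ i j i' j', a i j * a i' j' ≤ 1 := fun i j i' j' =>
    mul_le_one₀ (ha1 i j) (ha i' j') (ha1 i' j')
  have e7 : ∑ i, ∑ j, ∑ l, ∑ m, a i j * a l m *
      ((if i = j then 1 else 0) * (if l = m then 1 else 0) * τ i l) ≤ ∑ i, ∑ j, τ i j := by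
    simp only [ite_mul, zero_mul, one_mul, mul_ite, mul_zero, Finset.sum_ite_irrel,
      Finset.sum_const_zero, Finset.sum_ite_eq, Finset.mem_univ, if_true]
    exact Finset.sum_le_sum fun i _ => Finset.sum_le_sum fun j _ =>
      mul_le_of_le_one_left (hτ i j) (hle1 i i j j)
  have hpair : ∑ i, ∑ j, a i j * a i j * (1 + τ i j) ≤ N + ∑ i, ∑ j, τ i j := by
    have h1 : ∀ i j, a i j * a i j * (1 + τ i j) ≤ a i j ^ 2 + τ i j := fun i j => by
      have := mul_le_of_le_one_left (hτ i j) (hle1 i j i j)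
      nlinarith
    calc ∑ i, ∑ j, a i j * a i j * (1 + τ i j) ≤ ∑ i, (∑ j, a i j ^ 2 + ∑ j, τ i j) := by
          simp only [← Finset.sum_add_distrib]
          exact Finset.sum_le_sum fun i _ => Finset.sum_le_sum fun j _ => h1 i j
      _ ≤ ∑ i, (1 + ∑ j, τ i j) := Finset.sum_le_sum fun i _ => by linarith [hsq i]
      _ = _ := by rw [Finset.sum_add_distrib]; simp
  have e8 : ∑ i, ∑ j, ∑ l, ∑ m, a i j * a l m *
      ((if i = l then 1 else 0) * (if j = m then 1 else 0) * (1 + τ i j))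
      ≤ N + ∑ i, ∑ j, τ i j := by
    refine le_trans (le_of_eq ?_) hpair
    simp only [ite_mul, zero_mul, one_mul, mul_ite, mul_zero,
      Finset.sum_ite_eq, Finset.mem_univ, if_true]
  have e9 : ∑ i, ∑ j, ∑ l, ∑ m, a i j * a l m *
      ((if i = m then 1 else 0) * (if j = l then 1 else 0) * (1 + τ i j))
      ≤ N + ∑ i, ∑ j, τ i j := by
    refine le_trans (le_of_eq ?_) hpair
    simp only [ite_mul, zero_mul, one_mul, mul_ite, mul_zero, Finset.sum_ite_irrel,
      Finset.sum_const_zero, Finset.sum_ite_eq, Finset.mem_univ, if_true]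
    refine Finset.sum_congr rfl fun i _ => Finset.sum_congr rfl fun j _ => by rw [hsym j i]
  simp only [momentBound, mul_add, Finset.sum_add_distrib]
  simp only [mul_add, Finset.sum_add_distrib] at e7 e8 e9
  linarith

/-- The second moment of `ζᵀ H ζ - tr H`, expanded into mixed moments `T i j l m` of order four and
`S i j` of order two, is small if these are close to the values `δ_ij δ_lm` and `δ_ij`, for which
the three terms on the left cancel. -/
theorem quadForm_le {H : Matrix (Fin N) (Fin N) ℝ} (hsym : ∀ i j, H i j = H j i)
    (hrow : ∀ i, ∑ j, H i j ^ 2 ≤ 1) {p s : ℝ} (hp : 0 ≤ p) (hs : 0 ≤ s)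
    {τ : Fin N → Fin N → ℝ} (hτ : ∀ i j, 0 ≤ τ i j) {σ : Fin N → ℝ} (hσ : ∀ i, 0 ≤ σ i)
    {T : Fin N → Fin N → Fin N → Fin N → ℝ} {S : Fin N → Fin N → ℝ}
    (hT : ∀ i j l m, |T i j l m - (if i = j then 1 else 0) * (if l = m then 1 else 0)|
      ≤ momentBound p s τ i j l m)
    (hS : ∀ i j, |S i j - if i = j then 1 else 0| ≤ s + (if i = j then 1 else 0) * σ i) :
    (∑ i, ∑ j, ∑ l, ∑ m, H i j * H l m * T i j l m) - 2 * (∑ i, ∑ j, ∑ l, H l l * H i j * S i j)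
        + ∑ i, ∑ l, H i i * H l l
      ≤ p * N ^ 3 + s * (2 * N ^ 2 * √N + 4 * N ^ 2) + 3 * ∑ i, ∑ j, τ i j + 2 * N
        + 2 * N * (s * (N * √N) + ∑ i, σ i) := by
  -- each of the three terms is `(tr H)²` up to an error, and the coefficients `1 - 2 + 1` cancel
  set D := ∑ i, H i i with hD
  have hcard : ∀ c : ℝ, ∑ _i : Fin N, c = N * c := fun c => by simp
  have hDabs : |D| ≤ N := (Finset.abs_sum_le_sum_abs _ _).trans
    ((Finset.sum_le_sum fun i _ => abs_apply_le_one hrow i i).trans (by simp))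
  have t1 : ∑ i, ∑ j, ∑ l, ∑ m, H i j * H l m * T i j l m
      = (∑ i, ∑ j, ∑ l, ∑ m, H i j * H l m *
          (T i j l m - (if i = j then 1 else 0) * (if l = m then 1 else 0))) + D * D := by
    have : ∑ i, ∑ j, ∑ l, ∑ m, H i j * H l m * ((if i = j then 1 else 0) * (if l = m then 1 else 0))
        = D * D := by
      simp only [mul_ite, mul_zero, mul_one, Finset.sum_ite_irrel,
        Finset.sum_const_zero, Finset.sum_ite_eq, Finset.mem_univ, if_true]
      simp only [← Finset.sum_mul, ← Finset.mul_sum, hD]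
    rw [← this]
    simp only [← Finset.sum_add_distrib, ← mul_add, sub_add_cancel]
  have t2 : ∑ i, ∑ j, ∑ l, H l l * H i j * S i j
      = D * (∑ i, ∑ j, H i j * (S i j - if i = j then 1 else 0)) + D * D := by
    have h1 : ∑ i, ∑ j, H i j * (if i = j then 1 else 0) = D := by
      simp only [mul_ite, mul_zero, mul_one, Finset.sum_ite_eq, Finset.mem_univ, if_true, hD]
    have h2 : ∑ i, ∑ j, ∑ l, H l l * H i j * S i j = D * ∑ i, ∑ j, H i j * S i j := by
      simp only [← Finset.sum_mul, mul_assoc, ← Finset.mul_sum, hD]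
    simp only [mul_sub, Finset.sum_sub_distrib, h1, h2]
    ring
  have t3 : ∑ i, ∑ l, H i i * H l l = D * D := by
    simp only [← Finset.sum_mul, ← Finset.mul_sum, hD]
  have b1 : ∑ i, ∑ j, ∑ l, ∑ m, H i j * H l m *
          (T i j l m - (if i = j then 1 else 0) * (if l = m then 1 else 0))
      ≤ p * N ^ 3 + s * (2 * N ^ 2 * √N + 4 * N ^ 2) + 3 * ∑ i, ∑ j, τ i j + 2 * N := by
    refine le_trans ?_ (sum_momentBound_le (a := fun i j => |H i j|) (fun _ _ => abs_nonneg _)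
      (abs_apply_le_one hrow) (fun i j => by rw [hsym]) (sum_abs_row_le hrow)
      (fun i => by simpa only [sq_abs] using hrow i) (Real.sq_sqrt (Nat.cast_nonneg N))
      (Real.sqrt_nonneg _) hp hs hτ)
    refine Finset.sum_le_sum fun i _ => Finset.sum_le_sum fun j _ => Finset.sum_le_sum fun l _ =>
      Finset.sum_le_sum fun m _ => ?_
    refine (le_abs_self _).trans ?_
    rw [abs_mul, abs_mul]
    exact mul_le_mul_of_nonneg_left (hT i j l m) (by positivity)
  have b2 : |∑ i, ∑ j, H i j * (S i j - if i = j then 1 else 0)| ≤ s * (N * √N) + ∑ i, σ i := by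
    calc |∑ i, ∑ j, H i j * (S i j - if i = j then 1 else 0)|
        ≤ ∑ i, ∑ j, |H i j| * (s + (if i = j then 1 else 0) * σ i) := by
          refine (Finset.abs_sum_le_sum_abs _ _).trans (Finset.sum_le_sum fun i _ => ?_)
          refine (Finset.abs_sum_le_sum_abs _ _).trans (Finset.sum_le_sum fun j _ => ?_)
          rw [abs_mul]
          exact mul_le_mul_of_nonneg_left (hS i j) (abs_nonneg _)
      _ = ∑ i, ((∑ j, |H i j|) * s + |H i i| * σ i) := by
          refine Finset.sum_congr rfl fun i _ => ?_
          simp only [mul_add, Finset.sum_add_distrib, Finset.sum_mul, ite_mul, zero_mul, one_mul,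
            mul_ite, mul_zero, Finset.sum_ite_eq, Finset.mem_univ, if_true]
      _ ≤ ∑ i, (√N * s + σ i) := Finset.sum_le_sum fun i _ =>
          add_le_add (mul_le_mul_of_nonneg_right (sum_abs_row_le hrow i) hs)
            (mul_le_of_le_one_left (hσ i) (abs_apply_le_one hrow i i))
      _ = _ := by rw [Finset.sum_add_distrib, hcard]; ring
  have b3 : -(D * ∑ i, ∑ j, H i j * (S i j - if i = j then 1 else 0))
      ≤ N * (s * (N * √N) + ∑ i, σ i) := by
    refine (neg_le_abs _).trans ?_
    rw [abs_mul]
    exact mul_le_mul hDabs b2 (abs_nonneg _) (Nat.cast_nonneg N)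
  rw [t1, t2, t3]
  linarith

end QuadForm

section CondQuadForm

variable {Ω : Type*} {m m0 : MeasurableSpace Ω} {P : Measure Ω}

theorem integral_bdd_mul_condExp [IsProbabilityMeasure P] (hm : m ≤ m0) {f g : Ω → ℝ}
    (hf : StronglyMeasurable[m] f) {c : ℝ} (hfc : ∀ᵐ ω ∂P, |f ω| ≤ c) (hg : Integrable g P) :
    ∫ ω, f ω * g ω ∂P = ∫ ω, f ω * (P[g | m]) ω ∂P := by
  rw [← integral_condExp hm (f := fun ω => f ω * g ω)]
  exact integral_congr_ae
    (condExp_stronglyMeasurable_mul_of_bound hm hf hg c hfc)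

theorem integral_sub_two_mul_add {f g h : Ω → ℝ} (hf : Integrable f P) (hg : Integrable g P)
    (hh : Integrable h P) :
    ∫ ω, (f ω - 2 * g ω + h ω) ∂P = ∫ ω, f ω ∂P - 2 * ∫ ω, g ω ∂P + ∫ ω, h ω ∂P := by
  rw [integral_add (f := fun ω => f ω - 2 * g ω) (hf.sub (hg.const_mul 2)) hh,
    integral_sub hf (hg.const_mul 2), integral_const_mul]

theorem integral_const_add_mul_add [IsProbabilityMeasure P] {f g : Ω → ℝ} (hf : Integrable f P)
    (hg : Integrable g P) (a b c : ℝ) :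
    ∫ ω, (a + b * f ω + c * g ω) ∂P = a + b * ∫ ω, f ω ∂P + c * ∫ ω, g ω ∂P := by
  rw [integral_add (f := fun ω => a + b * f ω) ((integrable_const a).add (hf.const_mul b))
    (hg.const_mul c), integral_add (integrable_const a) (hf.const_mul b), integral_const_mul,
    integral_const_mul]
  simp

variable {N : ℕ} {ζ : Fin N → Ω → ℝ}

theorem abs_mul_four_le (a b c d : ℝ) :
    |a * b * c * d| ≤ |a| ^ 4 + |b| ^ 4 + |c| ^ 4 + |d| ^ 4 := by
  have h : ∀ x y : ℝ, |x * y| ≤ (x ^ 2 + y ^ 2) / 2 := fun x y => by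
    rw [abs_le]; constructor <;> nlinarith [sq_nonneg (x + y), sq_nonneg (x - y)]
  have h1 := h (a * b) (c * d)
  have h2 := h (a ^ 2) (b ^ 2)
  have h3 := h (c ^ 2) (d ^ 2)
  have e : ∀ x : ℝ, |x| ^ 4 = x ^ 4 := fun x => by
    rw [← abs_pow, abs_of_nonneg (by positivity)]
  rw [abs_of_nonneg (by positivity)] at h2 h3
  simp only [e]
  rw [mul_assoc (a * b)]
  nlinarith [sq_nonneg (a ^ 2), sq_nonneg (b ^ 2), sq_nonneg (c ^ 2), sq_nonneg (d ^ 2)]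

theorem integrable_mul_four (hζ : ∀ i, Measurable (ζ i))
    (h4 : ∀ i, Integrable (fun ω => |ζ i ω| ^ 4) P) (i j l k : Fin N) :
    Integrable (fun ω => ζ i ω * ζ j ω * ζ l ω * ζ k ω) P := by
  refine Integrable.mono' (((h4 i).add (h4 j)).add ((h4 l).add (h4 k)))
    ((((hζ i).mul (hζ j)).mul (hζ l)).mul (hζ k)).aestronglyMeasurable
    (Eventually.of_forall fun ω => ?_)
  refine (abs_mul_four_le _ _ _ _).trans (le_of_eq ?_)
  simp only [Pi.add_apply]
  ring

theorem integrable_mul_two [IsProbabilityMeasure P] (hζ : ∀ i, Measurable (ζ i))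
    (h4 : ∀ i, Integrable (fun ω => |ζ i ω| ^ 4) P) (i j : Fin N) :
    Integrable (fun ω => ζ i ω * ζ j ω) P := by
  refine Integrable.mono' (((h4 i).add (h4 j)).add (integrable_const 2))
    ((hζ i).mul (hζ j)).aestronglyMeasurable (Eventually.of_forall fun ω => ?_)
  have := abs_mul_four_le (ζ i ω) (ζ j ω) 1 1
  simp only [mul_one, abs_one, one_pow] at this
  refine this.trans (le_of_eq ?_)
  simp only [Pi.add_apply]
  ring

/-- The quadratic form `ζᵀ H ζ` of a weakly correlated vector is close in `L²` to the trace of `H`,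
when `H` is measurable with respect to the conditioning σ-algebra. -/
theorem integral_sq_quadForm_sub_trace_le [IsProbabilityMeasure P] (hm : m ≤ m0)
    (hζ : ∀ i, Measurable (ζ i)) (h4 : ∀ i, Integrable (fun ω => |ζ i ω| ^ 4) P)
    {H : Ω → Matrix (Fin N) (Fin N) ℝ} (hH : ∀ i j, Measurable[m] fun ω => H ω i j)
    (hsym : ∀ ω i j, H ω i j = H ω j i) (hrow : ∀ ω i, ∑ j, H ω i j ^ 2 ≤ 1)
    {p s q ρ : ℝ} (hp : 0 ≤ p) (hs : 0 ≤ s)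
    (hc2 : ∀ᵐ ω ∂P, ∀ i j, i ≠ j → |(P[fun ω => ζ i ω * ζ j ω | m]) ω| ≤ s)
    (hc3 : ∀ᵐ ω ∂P, ∀ i j l, j ≠ l → |(P[fun ω => ζ i ω ^ 2 * ζ j ω * ζ l ω | m]) ω| ≤ s)
    (hc4 : ∀ᵐ ω ∂P, ∀ i j l k, i ≠ j → i ≠ l → i ≠ k → j ≠ l → j ≠ k → l ≠ k →
      |(P[fun ω => ζ i ω * ζ j ω * ζ l ω * ζ k ω | m]) ω| ≤ p)
    (hq : ∑ i, ∫ ω, |(P[fun ω => ζ i ω ^ 2 | m]) ω - 1| ∂P ≤ q)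
    (hρ : ∑ i, ∑ j, ∫ ω, |(P[fun ω => ζ i ω ^ 2 * ζ j ω ^ 2 | m]) ω - 1| ∂P ≤ ρ) :
    Integrable (fun ω => (∑ i, ∑ j, H ω i j * (ζ i ω * ζ j ω) - ∑ i, H ω i i) ^ 2) P ∧
    ∫ ω, (∑ i, ∑ j, H ω i j * (ζ i ω * ζ j ω) - ∑ i, H ω i i) ^ 2 ∂P
      ≤ p * N ^ 3 + s * (2 * N ^ 2 * √N + 4 * N ^ 2) + 3 * ρ + 2 * N
        + 2 * N * (s * (N * √N) + q) := by
  have hH1 : ∀ ω i j, |H ω i j| ≤ 1 := fun ω => abs_apply_le_one (hrow ω)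
  have hHm : ∀ i j k l, StronglyMeasurable[m] fun ω => H ω i j * H ω k l := fun i j k l =>
    ((hH i j).mul (hH k l)).stronglyMeasurable
  have hHb : ∀ i j k l ω, |H ω i j * H ω k l| ≤ 1 := fun i j k l ω => by
    rw [abs_mul]; exact mul_le_one₀ (hH1 ω i j) (abs_nonneg _) (hH1 ω k l)
  have hbdd : ∀ i j k l {g : Ω → ℝ}, Integrable g P →
      Integrable (fun ω => H ω i j * H ω k l * g ω) P := fun i j k l g hg =>
    hg.bdd_mul ((hHm i j k l).mono hm).aestronglyMeasurable (Eventually.of_forall (hHb i j k l))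
  have i4 := integrable_mul_four hζ h4
  have i2 := integrable_mul_two hζ h4
  set T : Fin N → Fin N → Fin N → Fin N → Ω → ℝ := fun i j l k =>
    P[fun ω => ζ i ω * ζ j ω * ζ l ω * ζ k ω | m] with hT
  set S : Fin N → Fin N → Ω → ℝ := fun i j => P[fun ω => ζ i ω * ζ j ω | m] with hS
  have iT : ∀ i j l k, Integrable (T i j l k) P := fun i j l k => integrable_condExp
  have iS : ∀ i j, Integrable (S i j) P := fun i j => integrable_condExp
  have eS : ∀ i, S i i = P[fun ω => ζ i ω ^ 2 | m] := fun i => by simp only [hS, pow_two]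
  have eT : ∀ i j, T i i j j = P[fun ω => ζ i ω ^ 2 * ζ j ω ^ 2 | m] := fun i j => by
    simp only [hT, pow_two, mul_assoc]
  -- expand the square
  have hexp : (fun ω => (∑ i, ∑ j, H ω i j * (ζ i ω * ζ j ω) - ∑ i, H ω i i) ^ 2)
      = fun ω => (∑ i, ∑ j, ∑ l, ∑ k, H ω i j * H ω l k * (ζ i ω * ζ j ω * ζ l ω * ζ k ω))
        - 2 * (∑ i, ∑ j, ∑ l, H ω l l * H ω i j * (ζ i ω * ζ j ω))
        + ∑ i, ∑ l, H ω i i * H ω l l := by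
    funext ω
    have e1 : ∑ i, ∑ j, ∑ l, ∑ k, H ω i j * H ω l k * (ζ i ω * ζ j ω * ζ l ω * ζ k ω)
        = (∑ i, ∑ j, H ω i j * (ζ i ω * ζ j ω)) * (∑ i, ∑ j, H ω i j * (ζ i ω * ζ j ω)) := by
      have : ∀ i j l k, H ω i j * H ω l k * (ζ i ω * ζ j ω * ζ l ω * ζ k ω)
          = (H ω i j * (ζ i ω * ζ j ω)) * (H ω l k * (ζ l ω * ζ k ω)) := fun _ _ _ _ => by ring
      simp only [this, ← Finset.mul_sum, ← Finset.sum_mul]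
    have e2 : ∑ i, ∑ j, ∑ l, H ω l l * H ω i j * (ζ i ω * ζ j ω)
        = (∑ i, H ω i i) * (∑ i, ∑ j, H ω i j * (ζ i ω * ζ j ω)) := by
      simp only [← Finset.sum_mul, mul_assoc, ← Finset.mul_sum]
    have e3 : ∑ i, ∑ l, H ω i i * H ω l l = (∑ i, H ω i i) * (∑ i, H ω i i) := by
      simp only [← Finset.sum_mul, ← Finset.mul_sum]
    rw [e1, e2, e3]; ring
  have iH : ∀ i j k l, Integrable (fun ω => H ω i j * H ω k l) P := fun i j k l => by
    simpa using hbdd i j k l (integrable_const (1 : ℝ))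
  have A0 := fun i j l k => hbdd i j l k (i4 i j l k)
  have A1 := fun i j l => integrable_finsetSum Finset.univ fun k _ => A0 i j l k
  have A2 := fun i j => integrable_finsetSum Finset.univ fun l _ => A1 i j l
  have A3 := fun i => integrable_finsetSum Finset.univ fun j _ => A2 i j
  have I1 := integrable_finsetSum Finset.univ fun i _ => A3 i
  have A0' := fun i j l k => hbdd i j l k (iT i j l k)
  have A1' := fun i j l => integrable_finsetSum Finset.univ fun k _ => A0' i j l k
  have A2' := fun i j => integrable_finsetSum Finset.univ fun l _ => A1' i j l
  have A3' := fun i => integrable_finsetSum Finset.univ fun j _ => A2' i j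
  have J1 := integrable_finsetSum Finset.univ fun i _ => A3' i
  have B0 := fun i j l => hbdd l l i j (i2 i j)
  have B1 := fun i j => integrable_finsetSum Finset.univ fun l _ => B0 i j l
  have B2 := fun i => integrable_finsetSum Finset.univ fun j _ => B1 i j
  have I2 := integrable_finsetSum Finset.univ fun i _ => B2 i
  have B0' := fun i j l => hbdd l l i j (iS i j)
  have B1' := fun i j => integrable_finsetSum Finset.univ fun l _ => B0' i j l
  have B2' := fun i => integrable_finsetSum Finset.univ fun j _ => B1' i j
  have J2 := integrable_finsetSum Finset.univ fun i _ => B2' i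
  have I3 : Integrable (fun ω => ∑ i, ∑ l, H ω i i * H ω l l) P :=
    integrable_finsetSum _ fun i _ => integrable_finsetSum _ fun l _ => iH _ _ _ _
  refine ⟨by rw [hexp]; exact (I1.sub (I2.const_mul 2)).add I3, ?_⟩
  have heq : ∫ ω, (∑ i, ∑ j, H ω i j * (ζ i ω * ζ j ω) - ∑ i, H ω i i) ^ 2 ∂P
      = ∫ ω, ((∑ i, ∑ j, ∑ l, ∑ k, H ω i j * H ω l k * T i j l k ω)
        - 2 * (∑ i, ∑ j, ∑ l, H ω l l * H ω i j * S i j ω)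
        + ∑ i, ∑ l, H ω i i * H ω l l) ∂P := by
    rw [hexp, integral_sub_two_mul_add I1 I2 I3, integral_sub_two_mul_add J1 J2 I3,
      integral_finsetSum _ fun i _ => A3 i, integral_finsetSum _ fun i _ => A3' i,
      integral_finsetSum _ fun i _ => B2 i, integral_finsetSum _ fun i _ => B2' i]
    simp only [integral_finsetSum Finset.univ fun j _ => A2 _ j,
      integral_finsetSum Finset.univ fun j _ => A2' _ j,
      integral_finsetSum Finset.univ fun l _ => A1 _ _ l,
      integral_finsetSum Finset.univ fun l _ => A1' _ _ l,
      integral_finsetSum Finset.univ fun k _ => A0 _ _ _ k,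
      integral_finsetSum Finset.univ fun k _ => A0' _ _ _ k,
      integral_finsetSum Finset.univ fun j _ => B1 _ j,
      integral_finsetSum Finset.univ fun j _ => B1' _ j,
      integral_finsetSum Finset.univ fun l _ => B0 _ _ l,
      integral_finsetSum Finset.univ fun l _ => B0' _ _ l]
    have hA : ∀ i j l k, ∫ ω, H ω i j * H ω l k * (ζ i ω * ζ j ω * ζ l ω * ζ k ω) ∂P
        = ∫ ω, H ω i j * H ω l k * T i j l k ω ∂P := fun i j l k =>
      integral_bdd_mul_condExp hm (hHm i j l k) (Eventually.of_forall (hHb i j l k)) (i4 i j l k)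
    have hB : ∀ i j l, ∫ ω, H ω l l * H ω i j * (ζ i ω * ζ j ω) ∂P
        = ∫ ω, H ω l l * H ω i j * S i j ω ∂P := fun i j l =>
      integral_bdd_mul_condExp hm (hHm l l i j) (Eventually.of_forall (hHb l l i j)) (i2 i j)
    simp only [hA, hB]
  rw [heq]
  set τ : Ω → Fin N → Fin N → ℝ := fun ω i j => |T i i j j ω - 1|
  set σ : Ω → Fin N → ℝ := fun ω i => |S i i ω - 1|
  have iτ : ∀ i j, Integrable (fun ω => τ ω i j) P := fun i j =>
    ((iT i i j j).sub (integrable_const 1)).abs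
  have iσ : ∀ i, Integrable (fun ω => σ ω i) P := fun i =>
    ((iS i i).sub (integrable_const 1)).abs
  have iτ1 := fun i => integrable_finsetSum Finset.univ fun j _ => iτ i j
  have iτs := integrable_finsetSum Finset.univ fun i _ => iτ1 i
  have iσs := integrable_finsetSum Finset.univ fun i _ => iσ i
  calc _ ≤ ∫ ω, ((p * N ^ 3 + s * (2 * N ^ 2 * √N + 4 * N ^ 2) + 2 * N
          + 2 * N * (s * (N * √N))) + 3 * (∑ i, ∑ j, τ ω i j) + 2 * N * ∑ i, σ ω i) ∂P := by
        refine integral_mono_ae ((J1.sub (J2.const_mul 2)).add I3)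
          (((integrable_const _).add (iτs.const_mul 3)).add (iσs.const_mul _)) ?_
        filter_upwards [hc2, hc3, hc4] with ω w2 w3 w4
        refine (quadForm_le (hsym ω) (hrow ω) hp hs (τ := τ ω) (σ := σ ω)
          (T := fun i j l k => T i j l k ω) (S := fun i j => S i j ω)
          (fun _ _ => abs_nonneg _) (fun _ => abs_nonneg _) ?_ ?_).trans (le_of_eq (by ring))
        · have sw3 : ∀ i j l k, (∃ x y z, y ≠ z ∧ ∀ ω, ζ i ω * ζ j ω * ζ l ω * ζ k ω
              = ζ x ω ^ 2 * ζ y ω * ζ z ω) → |T i j l k ω| ≤ s := by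
            rintro i j l k ⟨x, y, z, hyz, h⟩
            have : T i j l k = P[fun ω => ζ x ω ^ 2 * ζ y ω * ζ z ω | m] := by
              simp only [hT, h]
            rw [this]
            exact w3 x y z hyz
          have sw2 : ∀ i j x y, T i j x y = T i i j j → |T i j x y ω| ≤ 1 + τ ω i j := by
            intro i j x y h
            rw [h]
            have := abs_sub_abs_le_abs_sub (T i i j j ω) 1
            rw [abs_one] at this
            simp only [τ]
            linarith
          intro i j l k
          have hτ0 : ∀ i j, 0 ≤ τ ω i j := fun _ _ => abs_nonneg _
          have hsg := le_momentBound_of_eq (i := i) (j := j) (l := l) (m := k) hp hs hτ0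
          by_cases hij : i = j <;> by_cases hlk : l = k
          · subst hij hlk
            refine le_trans ?_ (le_momentBound_diag hp hs hτ0 i l)
            simp [τ]
          · subst hij
            refine le_trans ?_ (hsg (by simp))
            simpa [hlk] using sw3 i i l k ⟨i, l, k, hlk, fun ω => by ring⟩
          · subst hlk
            refine le_trans ?_ (hsg (by simp))
            simpa [hij] using sw3 i j l l ⟨l, i, j, hij, fun ω => by ring⟩
          simp only [hij, hlk, if_false, zero_mul, sub_zero]
          by_cases hil : i = l
          · subst hil
            by_cases hjk : j = k
            · subst hjk
              refine le_trans (sw2 i j i j ?_) (le_momentBound_cross hp hs hτ0 i j).1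
              simp only [hT]; congr 1; funext ω; ring
            · exact (sw3 i j i k ⟨i, j, k, hjk, fun ω => by ring⟩).trans (hsg (by simp))
          by_cases hik : i = k
          · subst hik
            by_cases hjl : j = l
            · subst hjl
              refine le_trans (sw2 i j j i ?_) (le_momentBound_cross hp hs hτ0 i j).2
              simp only [hT]; congr 1; funext ω; ring
            · exact (sw3 i j l i ⟨i, j, l, hjl, fun ω => by ring⟩).trans (hsg (by simp))
          by_cases hjl : j = l
          · subst hjl
            exact (sw3 i j j k ⟨j, i, k, hik, fun ω => by ring⟩).trans (hsg (by simp))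
          by_cases hjk : j = k
          · subst hjk
            exact (sw3 i j l j ⟨j, i, l, hil, fun ω => by ring⟩).trans (hsg (by simp))
          refine (w4 i j l k hij hil hik hjl hjk hlk).trans ?_
          simp [momentBound, hij, hil, hik, hjl, hjk, hlk]
        · intro i j
          by_cases h : i = j
          · subst h; simp [σ, hs]
          · simpa [h] using w2 i j h
    _ ≤ _ := by
        rw [integral_const_add_mul_add iτs iσs, integral_finsetSum _ fun i _ => iσ i,
          integral_finsetSum _ fun i _ => iτ1 i]
        simp only [integral_finsetSum Finset.univ fun j _ => iτ _ j]
        simp only [τ, σ, eS, eT]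
        have := mul_le_mul_of_nonneg_left hq (by positivity : 0 ≤ 2 * (N : ℝ))
        linarith

end CondQuadForm

/-! ### Variance bounds for matrices with banded dependence -/

section Martingale

variable {Ω : Type*} {m0 : MeasurableSpace Ω} {P : Measure Ω}

/-- Freezing lemma: conditioning a function of two independent variables on the first one amounts to
integrating out the second one. -/
theorem condExp_comap_of_indepFun [IsProbabilityMeasure P] {α β : Type*} [mα : MeasurableSpace α]
    [MeasurableSpace β] [StandardBorelSpace β] [Nonempty β] {X : Ω → α} {Y : Ω → β}
    (hX : Measurable X) (hY : Measurable Y) (h : IndepFun X Y P) {f : α × β → ℝ}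
    (hf : Measurable f) (hint : Integrable (fun ω => f (X ω, Y ω)) P) :
    P[fun ω => f (X ω, Y ω) | mα.comap X] =ᵐ[P] fun ω => ∫ y, f (X ω, y) ∂(P.map Y) := by
  have h1 := condExp_prod_ae_eq_integral_condDistrib hX hY.aemeasurable hf.stronglyMeasurable hint
  have : IsProbabilityMeasure (P.map Y) := Measure.isProbabilityMeasure_map hY.aemeasurable
  have h2 : condDistrib Y X P =ᵐ[P.map X] Kernel.const α (P.map Y) := by
    rw [condDistrib_ae_eq_iff_measure_eq_compProd X hY.aemeasurable, Measure.compProd_const]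
    exact (indepFun_iff_map_prod_eq_prod_map_map hX.aemeasurable hY.aemeasurable).mp h
  filter_upwards [h1, ae_of_ae_map hX.aemeasurable h2] with ω w1 w2
  rw [w1, w2, Kernel.const_apply]

/-- A bounded random variable has small variance if, for every step of a filtration, it is uniformly
close to a variable on which that step reveals no information. -/
theorem integral_sq_sub_mean_le [IsProbabilityMeasure P] {F : ℕ → MeasurableSpace Ω}
    (hF : ∀ k, F k ≤ m0) (hmono : ∀ k, F k ≤ F (k + 1)) (hbot : F 0 = ⊥) {n : ℕ} {X : Ω → ℝ}
    (hX : Measurable[F n] X) {C : ℝ} (hXC : ∀ ω, |X ω| ≤ C) {Y : ℕ → Ω → ℝ} {L : ℝ}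
    (hYi : ∀ k, Integrable (Y k) P) (hXY : ∀ k ω, |X ω - Y k ω| ≤ L)
    (hY : ∀ k, P[Y k | F (k + 1)] =ᵐ[P] P[Y k | F k]) :
    ∫ ω, (X ω - ∫ ω', X ω' ∂P) ^ 2 ∂P ≤ 4 * n * L ^ 2 := by
  have hXm : Measurable X := hX.mono (hF n) le_rfl
  have hXi : Integrable X P := Integrable.of_bound hXm.aestronglyMeasurable C
    (Eventually.of_forall hXC)
  set c := ∫ ω', X ω' ∂P with hc
  set M : ℕ → Ω → ℝ := fun k => P[X | F k] with hM
  have hMi : ∀ k, Integrable (M k) P := fun k => integrable_condExp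
  have hMb : ∀ k, ∀ᵐ ω ∂P, |M k ω| ≤ C := fun k =>
    ae_bdd_abs_condExp_of_ae_bdd_abs (Eventually.of_forall hXC)
  have hinc : ∀ k, ∀ᵐ ω ∂P, |M (k + 1) ω - M k ω| ≤ 2 * L := by
    intro k
    have b : ∀ j, ∀ᵐ ω ∂P, |(P[X - Y k | F j]) ω| ≤ L := fun j =>
      ae_bdd_abs_condExp_of_ae_bdd_abs (Eventually.of_forall (hXY k))
    filter_upwards [b k, b (k + 1), condExp_sub hXi (hYi k) (F k),
      condExp_sub hXi (hYi k) (F (k + 1)), hY k] with ω w1 w2 w3 w4 w5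
    rw [w3] at w1
    rw [w4] at w2
    simp only [Pi.sub_apply] at w1 w2
    rw [w5] at w2
    simp only [hM]
    rw [abs_le] at *
    constructor <;> linarith
  have hstep : ∀ k, ∫ ω, (M k ω - c) ^ 2 ∂P ≤ 4 * k * L ^ 2 := by
    intro k
    induction k with
    | zero =>
      have : M 0 = fun _ => c := by simp only [hM, hbot, condExp_bot, hc]
      simp [this]
    | succ k ih =>
      have hms : StronglyMeasurable[F k] fun ω => M k ω - c :=
        stronglyMeasurable_condExp.sub stronglyMeasurable_const
      have hb1 : ∀ᵐ ω ∂P, |M k ω - c| ≤ C + |c| := by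
        filter_upwards [hMb k] with ω w
        exact (abs_sub _ _).trans (by linarith)
      have hae := (hms.mono (hF k)).aestronglyMeasurable (μ := P)
      have hcross : ∫ ω, (M k ω - c) * M (k + 1) ω ∂P = ∫ ω, (M k ω - c) * M k ω ∂P := by
        rw [integral_bdd_mul_condExp (hF k) hms hb1 (hMi (k + 1))]
        refine integral_congr_ae ?_
        filter_upwards [condExp_condExp_of_le (μ := P) (f := X) (hmono k) (hF (k + 1))] with ω w
        simp only [hM] at w ⊢
        rw [w]
      have i1 : Integrable (fun ω => (M k ω - c) ^ 2) P := by
        simp only [pow_two]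
        exact ((hMi k).sub (integrable_const c)).bdd_mul hae hb1
      have i2 : Integrable (fun ω => (M k ω - c) * M (k + 1) ω) P := (hMi _).bdd_mul hae hb1
      have i3 : Integrable (fun ω => (M k ω - c) * M k ω) P := (hMi _).bdd_mul hae hb1
      have hinc0 : Integrable (fun ω => M (k + 1) ω - M k ω) P := (hMi _).sub (hMi _)
      have i4 : Integrable (fun ω => (M (k + 1) ω - M k ω) ^ 2) P := by
        simp only [pow_two]
        exact hinc0.bdd_mul hinc0.aestronglyMeasurable (hinc k)
      have e : ∀ ω, (M (k + 1) ω - c) ^ 2 = (M k ω - c) ^ 2 + (M (k + 1) ω - M k ω) ^ 2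
          + 2 * ((M k ω - c) * M (k + 1) ω - (M k ω - c) * M k ω) := fun ω => by ring
      simp only [e]
      rw [integral_add (f := fun ω => (M k ω - c) ^ 2 + (M (k + 1) ω - M k ω) ^ 2) (i1.add i4)
        (g := fun ω => 2 * ((M k ω - c) * M (k + 1) ω - (M k ω - c) * M k ω))
        ((i2.sub i3).const_mul 2), integral_add i1 i4, integral_const_mul, integral_sub i2 i3,
        hcross, sub_self, mul_zero, add_zero]
      have h4 : ∫ ω, (M (k + 1) ω - M k ω) ^ 2 ∂P ≤ ∫ _ω, (2 * L) ^ 2 ∂P := by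
        refine integral_mono_ae i4 (integrable_const _) ?_
        filter_upwards [hinc k] with ω w
        exact sq_le_sq' (neg_le_of_abs_le w) (le_of_abs_le w)
      rw [integral_const, probReal_univ, one_smul] at h4
      push_cast
      linarith
  have := hstep n
  have e : M n = X := condExp_of_stronglyMeasurable (hF n) hX.stronglyMeasurable hXi
  rwa [e] at this

end Martingale

section BandedRows

variable {Ω : Type*} {m0 : MeasurableSpace Ω} {P : Measure Ω} {n N : ℕ}

theorem measurable_rows {A : Ω → Matrix (Fin n) (Fin N) ℝ} (S : Set (Fin n)) {i : Fin n}
    (hi : i ∈ S) (j : Fin N) : Measurable[rowsSigma A S] fun ω => A ω i j := by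
  have h : MeasurableSpace.comap (fun (ω : Ω) (j : Fin N) => A ω i j) inferInstance
      ≤ rowsSigma A S := le_iSup₂_of_le i hi le_rfl
  have h2 : Measurable[rowsSigma A S] fun (ω : Ω) (j : Fin N) => A ω i j :=
    Measurable.mono (comap_measurable _) h le_rfl
  exact (measurable_pi_apply j).comp h2

theorem rowsSigma_le {A : Ω → Matrix (Fin n) (Fin N) ℝ}
    (hA : ∀ i j, Measurable fun ω => A ω i j) (S : Set (Fin n)) : rowsSigma A S ≤ m0 :=
  iSup₂_le fun i _ => (measurable_pi_lambda _ fun j => hA i j).comap_le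

theorem measurable_keepRows {m : MeasurableSpace Ω} {A : Ω → Fin n → Fin N → ℝ}
    (S : Finset (Fin n)) (hA : ∀ i ∈ S, ∀ j, Measurable fun ω => A ω i j) :
    Measurable fun ω i j => keepRows S (Matrix.of (A ω)) i j := by
  refine measurable_pi_lambda _ fun i => measurable_pi_lambda _ fun j => ?_
  by_cases h : i ∈ S
  · simpa [keepRows, h] using hA i h j
  · simp [keepRows, h]

/-- Variance bound for a function of a matrix whose rows are independent at distance more than
`b`, when the function changes by at most `L` if `b + 1` consecutive rows are erased. -/
theorem integral_sq_sub_mean_le_of_banded [IsProbabilityMeasure P]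
    {A : Ω → Matrix (Fin n) (Fin N) ℝ} (hA : ∀ i j, Measurable fun ω => A ω i j) {b : ℕ}
    (hind : ∀ S T : Set (Fin n),
      (∀ i ∈ S, ∀ j ∈ T, (b : ℤ) < |((i : ℕ) : ℤ) - ((j : ℕ) : ℤ)|) →
      Indep (rowsSigma A S) (rowsSigma A T) P)
    {φ : Matrix (Fin n) (Fin N) ℝ → ℝ}
    (hφ : Measurable fun a : Fin n → Fin N → ℝ => φ (Matrix.of a)) {C L : ℝ}
    (hφC : ∀ a, |φ a| ≤ C)
    (hφL : ∀ a, ∀ k : ℕ, |φ a - φ (keepRows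
      (Finset.univ.filter fun i : Fin n => k ≤ (i : ℕ) ∧ (i : ℕ) ≤ k + b)ᶜ a)| ≤ L) :
    ∫ ω, (φ (A ω) - ∫ ω', φ (A ω') ∂P) ^ 2 ∂P ≤ 4 * n * L ^ 2 := by
  -- `U k` keeps the rows before `k` and generates the filtration; `V k` keeps the rows after
  -- `k + b` and is independent of `U (k + 1)`, so that row `k` says nothing about `U k + V k`
  set lo : ℕ → Finset (Fin n) := fun k => Finset.univ.filter fun i : Fin n => (i : ℕ) < k with hlo
  set hi : ℕ → Finset (Fin n) := fun k => Finset.univ.filter fun i : Fin n => k + b < (i : ℕ)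
    with hhi
  set U : ℕ → Ω → (Fin n → Fin N → ℝ) := fun k ω i j => keepRows (lo k) (A ω) i j with hU
  set V : ℕ → Ω → (Fin n → Fin N → ℝ) := fun k ω i j => keepRows (hi k) (A ω) i j with hV
  have hUm : ∀ k, Measurable (U k) := fun k =>
    measurable_keepRows (A := fun ω i j => A ω i j) (lo k) fun i _ j => hA i j
  have hVm : ∀ k, Measurable (V k) := fun k =>
    measurable_keepRows (A := fun ω i j => A ω i j) (hi k) fun i _ j => hA i j
  have hUU : ∀ k l, k ≤ l → ∀ ω,
      (fun i j => keepRows (lo k) (Matrix.of (U l ω)) i j) = U k ω := by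
    intro k l hkl ω
    funext i j
    simp only [hU, hlo, keepRows, Matrix.of_apply, Finset.mem_filter, Finset.mem_univ, true_and]
    split_ifs <;> first | omega | rfl
  have hkm : ∀ k, Measurable fun (a : Fin n → Fin N → ℝ) i j =>
      keepRows (lo k) (Matrix.of a) i j := fun k =>
    measurable_keepRows (A := fun a : Fin n → Fin N → ℝ => a) (lo k) fun i _ j =>
      (measurable_pi_apply j).comp (measurable_pi_apply i)
  have hrest : ∀ k ω, φ (keepRows
      (Finset.univ.filter fun i : Fin n => k ≤ (i : ℕ) ∧ (i : ℕ) ≤ k + b)ᶜ (A ω))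
      = φ (Matrix.of (U k ω + V k ω)) := by
    intro k ω
    congr 1
    ext i j
    simp only [hU, hV, keepRows, hlo, hhi, Matrix.of_apply, Pi.add_apply, Finset.mem_compl,
      Finset.mem_filter, Finset.mem_univ, true_and]
    split_ifs <;> first | omega | simp
  have hindUV : ∀ k l, l ≤ k + 1 → IndepFun (U l) (V k) P := by
    intro k l hl
    have h := hind {i | (i : ℕ) < l} {i | k + b < (i : ℕ)} (by
      intro i hi j hj
      simp only [Set.mem_ofPred_eq] at hi hj
      rw [lt_abs]; right; omega)
    refine indep_of_indep_of_le_left (indep_of_indep_of_le_right h ?_) ?_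
    · refine Measurable.comap_le (measurable_keepRows (A := fun ω i j => A ω i j) (hi k) fun i hi j => ?_)
      exact measurable_rows _ (by simpa [hhi] using hi) j
    · refine Measurable.comap_le (measurable_keepRows (A := fun ω i j => A ω i j) (lo l) fun i hi j => ?_)
      exact measurable_rows _ (by simpa [hlo] using hi) j
  have hYm : ∀ k, Measurable fun ω => φ (Matrix.of (U k ω + V k ω)) := fun k =>
    hφ.comp ((hUm k).add (hVm k))
  have hYi : ∀ k, Integrable (fun ω => φ (Matrix.of (U k ω + V k ω))) P := fun k =>
    Integrable.of_bound (hYm k).aestronglyMeasurable C (Eventually.of_forall fun ω => hφC _)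
  have hfreeze : ∀ k l, k ≤ l → l ≤ k + 1 →
      P[fun ω => φ (Matrix.of (U k ω + V k ω)) | MeasurableSpace.comap (U l) inferInstance]
        =ᵐ[P] fun ω => ∫ y, φ (Matrix.of (U k ω + y)) ∂(P.map (V k)) := by
    intro k l hkl hlk
    have := condExp_comap_of_indepFun (hUm l) (hVm k) (hindUV k l hlk)
      (f := fun p => φ (Matrix.of ((fun i j => keepRows (lo k) (Matrix.of p.1) i j) + p.2)))
      (hφ.comp (((hkm k).comp measurable_fst).add measurable_snd))
      (by simpa only [hUU k l hkl] using hYi k)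
    simpa only [hUU k l hkl] using this
  refine integral_sq_sub_mean_le (F := fun k => MeasurableSpace.comap (U k) inferInstance)
    (fun k => (hUm k).comap_le) (fun k => ?_) ?_ (n := n) ?_ (fun ω => hφC (A ω)) hYi
    (fun k ω => by rw [← hrest]; exact hφL (A ω) k)
    (fun k => (hfreeze k (k + 1) (by omega) le_rfl).trans
      (hfreeze k k le_rfl (by omega)).symm)
  · have : U k = (fun a i j => keepRows (lo k) (Matrix.of a) i j) ∘ U (k + 1) :=
      funext fun ω => (hUU k (k + 1) (by omega) ω).symm
    rw [this, ← MeasurableSpace.comap_comp]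
    exact MeasurableSpace.comap_mono (hkm k).comap_le
  · have : U 0 = fun _ => 0 := by
      funext ω; ext i j; simp [hU, hlo, keepRows]
    simp only [this, MeasurableSpace.comap_const]
  · have : U n = A := by
      funext ω; ext i j; simp [hU, hlo, keepRows]
    have h2 : (fun ω => φ (A ω)) = (fun a : Fin n → Fin N → ℝ => φ (Matrix.of a)) ∘ U n := by
      rw [this]; rfl
    rw [h2]
    exact hφ.comp (comap_measurable _)

end BandedRows

/-! ### Concentration of the resolvent -/

section Measurability

variable {n N : ℕ}

theorem measurable_sqRes_apply {α : Type*} [MeasurableSpace α]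
    {a : α → Matrix (Fin n) (Fin N) ℝ} (ha : ∀ i j, Measurable fun x => a x i j) {w : α → ℂ}
    (hw : Measurable w) (i j : Fin N) : Measurable fun x => sqRes (cov (a x)) (w x) i j := by
  have h1 : Continuous fun p : (Fin n → Fin N → ℝ) × ℂ =>
      cov (Matrix.of p.1) - p.2 ^ 2 • (1 : Matrix (Fin N) (Fin N) ℂ) := by
    refine continuous_matrix fun i j => ?_
    simp only [cov, Matrix.sub_apply, Matrix.map_apply, Matrix.smul_apply, Matrix.mul_apply,
      Matrix.transpose_apply, Matrix.of_apply]
    fun_prop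
  have h2 : Measurable fun p : (Fin n → Fin N → ℝ) × ℂ =>
      sqRes (cov (Matrix.of p.1)) p.2 i j := by
    simp only [sqRes, Matrix.inv_def, Ring.inverse_eq_inv', Matrix.smul_apply, smul_eq_mul]
    exact (h1.matrix_det.measurable.inv).mul ((h1.matrix_adjugate.matrix_elem i j).measurable)
  have h3 : Measurable fun x => ((fun i j => a x i j : Fin n → Fin N → ℝ), w x) :=
    (measurable_pi_lambda _ fun i => measurable_pi_lambda _ fun j => ha i j).prodMk hw
  have h4 := h2.comp h3
  have e : ∀ x, Matrix.of (fun i j => a x i j) = a x := fun x => rfl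
  simpa only [Function.comp_def, e] using h4

theorem measurable_trace_sqRes {α : Type*} [MeasurableSpace α]
    {a : α → Matrix (Fin n) (Fin N) ℝ} (ha : ∀ i j, Measurable fun x => a x i j) {w : α → ℂ}
    (hw : Measurable w) : Measurable fun x => (sqRes (cov (a x)) (w x)).trace := by
  simp only [Matrix.trace, Matrix.diag]
  exact Finset.measurable_sum _ fun i _ => measurable_sqRes_apply ha hw i i

end Measurability

section Integrals

variable {Ω : Type*} {m0 : MeasurableSpace Ω} {P : Measure Ω}

theorem integral_le_sqrt_integral_sq [IsProbabilityMeasure P] {f : Ω → ℝ} (hf : Measurable f)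
    (hf2 : Integrable (fun ω => f ω ^ 2) P) :
    Integrable f P ∧ ∫ ω, f ω ∂P ≤ √(∫ ω, f ω ^ 2 ∂P) := by
  have hfi : Integrable f P := by
    refine Integrable.mono' ((integrable_const (1 : ℝ)).add hf2) hf.aestronglyMeasurable
      (Eventually.of_forall fun ω => ?_)
    simp only [Pi.add_apply, Real.norm_eq_abs]
    rw [abs_le]
    constructor <;> nlinarith [sq_nonneg (f ω + 1), sq_nonneg (f ω - 1)]
  refine ⟨hfi, Real.le_sqrt_of_sq_le ?_⟩
  set c := ∫ ω, f ω ∂P with hc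
  have h0 : 0 ≤ ∫ ω, (f ω - c) ^ 2 ∂P := integral_nonneg fun ω => sq_nonneg _
  have e : ∀ ω, (f ω - c) ^ 2 = c ^ 2 + (-2 * c) * f ω + 1 * f ω ^ 2 := fun ω => by ring
  simp only [e] at h0
  rw [integral_const_add_mul_add hfi hf2, ← hc] at h0
  linarith

end Integrals

section Trace

variable {n N : ℕ}

theorem norm_trace_sqRes_le (a : Matrix (Fin n) (Fin N) ℝ) {w : ℂ} (hw : 0 < w.im) :
    w.im * ‖w‖ * ‖(sqRes (cov a) w).trace‖ ≤ N := by
  have hd : 0 ≤ w.im * ‖w‖ := by positivity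
  calc w.im * ‖w‖ * ‖(sqRes (cov a) w).trace‖
      ≤ w.im * ‖w‖ * ∑ i, ‖sqRes (cov a) w i i‖ :=
        mul_le_mul_of_nonneg_left (norm_sum_le _ _) hd
    _ = ∑ i, w.im * ‖w‖ * ‖sqRes (cov a) w i i‖ := Finset.mul_sum _ _ _
    _ ≤ ∑ _i : Fin N, (1 : ℝ) :=
        Finset.sum_le_sum fun i _ => norm_sqRes_apply_le (cov_posSemidef a) hw i i
    _ = N := by simp

end Trace

section Concentration

variable {Ω : Type*} {m0 : MeasurableSpace Ω} {P : Measure Ω} {n N : ℕ}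
  {A : Ω → Matrix (Fin n) (Fin N) ℝ}

theorem integrable_trace_sqRes [IsProbabilityMeasure P] (hA : ∀ i j, Measurable fun ω => A ω i j)
    {w : ℂ} (hw : 0 < w.im) : Integrable (fun ω => (sqRes (cov (A ω)) w).trace) P := by
  have hd : 0 < w.im * ‖w‖ := mul_pos hw (norm_pos_iff.mpr (by rintro rfl; simp at hw))
  refine Integrable.of_bound (measurable_trace_sqRes hA measurable_const).aestronglyMeasurable
    (N / (w.im * ‖w‖)) (Eventually.of_forall fun ω => ?_)
  rw [le_div_iff₀ hd, mul_comm]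
  exact norm_trace_sqRes_le (A ω) hw

/-- Concentration of the trace of the resolvent for rows with dependence range `b`. -/
theorem integral_norm_trace_sub_mean_le [IsProbabilityMeasure P]
    (hA : ∀ i j, Measurable fun ω => A ω i j) {b : ℕ}
    (hind : ∀ S T : Set (Fin n),
      (∀ i ∈ S, ∀ j ∈ T, (b : ℤ) < |((i : ℕ) : ℤ) - ((j : ℕ) : ℤ)|) →
      Indep (rowsSigma A S) (rowsSigma A T) P) {w : ℂ} (hw : 0 < w.im) :
    w.im * ‖w‖ * ∫ ω, ‖(sqRes (cov (A ω)) w).trace - ∫ ω', (sqRes (cov (A ω')) w).trace ∂P‖ ∂P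
      ≤ √(8 * n * (b + 1) ^ 2) := by
  have hd : 0 < w.im * ‖w‖ := mul_pos hw (norm_pos_iff.mpr (by rintro rfl; simp at hw))
  set d := w.im * ‖w‖ with hd_def
  have hti := integrable_trace_sqRes (P := P) hA hw
  have hblock : ∀ (a : Matrix (Fin n) (Fin N) ℝ) (k : ℕ), d * ‖(sqRes (cov a) w).trace -
      (sqRes (cov (keepRows (Finset.univ.filter fun i : Fin n =>
        k ≤ (i : ℕ) ∧ (i : ℕ) ≤ k + b)ᶜ a)) w).trace‖ ≤ b + 1 := by
    intro a k
    refine (norm_trace_sub_keepRows_le a hw _).trans ?_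
    have h1 : (Finset.univ.filter fun i : Fin n => k ≤ (i : ℕ) ∧ (i : ℕ) ≤ k + b).card
        ≤ (Finset.Icc k (k + b)).card := by
      refine Finset.card_le_card_of_injOn (fun i => (i : ℕ)) ?_ (fun i _ j _ h => Fin.ext h)
      intro i hi
      simpa using hi
    rw [Nat.card_Icc] at h1
    exact_mod_cast h1.trans (by omega)
  have hvar : ∀ ψ : ℂ → ℝ, Measurable ψ → (∀ z, |ψ z| ≤ ‖z‖) →
      (∀ z z', ψ (z - z') = ψ z - ψ z') →
      ∫ ω, (ψ (sqRes (cov (A ω)) w).trace - ∫ ω', ψ (sqRes (cov (A ω')) w).trace ∂P) ^ 2 ∂P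
        ≤ 4 * n * ((b + 1) / d) ^ 2 := by
    intro ψ hψ hψn hψs
    refine integral_sq_sub_mean_le_of_banded hA hind
      (φ := fun a => ψ (sqRes (cov a) w).trace) (C := N / d) ?_ ?_ ?_
    · exact hψ.comp (measurable_trace_sqRes (a := fun a : Fin n → Fin N → ℝ => Matrix.of a)
        (fun i j => (measurable_pi_apply j).comp (measurable_pi_apply i)) measurable_const)
    · intro a
      refine (hψn _).trans ?_
      rw [le_div_iff₀ hd, mul_comm]
      exact norm_trace_sqRes_le a hw
    · intro a k
      rw [← hψs]
      refine (hψn _).trans ?_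
      rw [le_div_iff₀ hd, mul_comm]
      exact hblock a k
  have hre := hvar Complex.re Complex.measurable_re Complex.abs_re_le_norm Complex.sub_re
  have him := hvar Complex.im Complex.measurable_im Complex.abs_im_le_norm Complex.sub_im
  set m := ∫ ω', (sqRes (cov (A ω')) w).trace ∂P with hm
  have hm_re : ∫ ω', (sqRes (cov (A ω')) w).trace.re ∂P = m.re := integral_re hti
  have hm_im : ∫ ω', (sqRes (cov (A ω')) w).trace.im ∂P = m.im := integral_im hti
  rw [hm_re] at hre
  rw [hm_im] at him
  have hmeas : Measurable fun ω => (sqRes (cov (A ω)) w).trace - m :=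
    (measurable_trace_sqRes hA measurable_const).sub_const m
  have hbd : ∀ ω, ‖(sqRes (cov (A ω)) w).trace - m‖ ≤ N / d + ‖m‖ := fun ω => by
    refine (norm_sub_le _ _).trans (add_le_add_left ?_ _)
    rw [le_div_iff₀ hd, mul_comm]
    exact norm_trace_sqRes_le (A ω) hw
  have hsq : ∀ ψ : ℂ → ℝ, Measurable ψ → (∀ z, |ψ z| ≤ ‖z‖) →
      Integrable (fun ω => (ψ ((sqRes (cov (A ω)) w).trace - m)) ^ 2) P := by
    intro ψ hψ hψn
    refine Integrable.of_bound ((hψ.comp hmeas).pow_const 2).aestronglyMeasurable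
      ((N / d + ‖m‖) ^ 2) (Eventually.of_forall fun ω => ?_)
    rw [Real.norm_eq_abs, abs_pow]
    exact pow_le_pow_left₀ (abs_nonneg _) ((hψn _).trans (hbd ω)) 2
  have ire := hsq _ Complex.measurable_re Complex.abs_re_le_norm
  have iim := hsq _ Complex.measurable_im Complex.abs_im_le_norm
  have e : ∀ z : ℂ, ‖z‖ ^ 2 = z.re ^ 2 + z.im ^ 2 := fun z => by
    rw [Complex.sq_norm, Complex.normSq_apply]; ring
  have i2 : Integrable (fun ω => ‖(sqRes (cov (A ω)) w).trace - m‖ ^ 2) P := by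
    simp only [e]; exact ire.add iim
  have h1 := (integral_le_sqrt_integral_sq hmeas.norm i2).2
  have h2 : ∫ ω, ‖(sqRes (cov (A ω)) w).trace - m‖ ^ 2 ∂P ≤ 8 * n * (b + 1) ^ 2 / d ^ 2 := by
    simp only [e]
    rw [integral_add ire iim]
    simp only [Complex.sub_re, Complex.sub_im]
    rw [div_pow] at hre him
    calc _ ≤ 4 * n * ((b + 1) ^ 2 / d ^ 2) + 4 * n * ((b + 1) ^ 2 / d ^ 2) := add_le_add hre him
      _ = _ := by ring
  calc d * ∫ ω, ‖(sqRes (cov (A ω)) w).trace - m‖ ∂P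
      ≤ d * √(8 * n * (b + 1) ^ 2 / d ^ 2) := by
        refine mul_le_mul_of_nonneg_left (h1.trans (Real.sqrt_le_sqrt h2)) hd.le
    _ = √(8 * n * (b + 1) ^ 2) := by
        rw [Real.sqrt_div' _ (sq_nonneg d), Real.sqrt_sq hd.le]
        field_simp

/-- The quadratic forms `rowForm` are close to the normalized trace of the resolvent. -/
theorem integral_norm_rowForm_sub_trace_le [IsProbabilityMeasure P] (hn : 0 < n)
    (hA : ∀ i j, Measurable fun ω => A ω i j)
    (h4 : ∀ i j, Integrable (fun ω => |A ω i j| ^ 4) P) {w : ℂ} (hw : 0 < w.im)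
    {k : Fin n} {p s q ρ : ℝ} (hp : 0 ≤ p) (hs : 0 ≤ s)
    (hc2 : ∀ᵐ ω ∂P, ∀ i j, i ≠ j → |condRow P A k (fun ω => A ω k i * A ω k j) ω| ≤ s)
    (hc3 : ∀ᵐ ω ∂P, ∀ i j l, j ≠ l →
      |condRow P A k (fun ω => A ω k i ^ 2 * A ω k j * A ω k l) ω| ≤ s)
    (hc4 : ∀ᵐ ω ∂P, ∀ i j l m, i ≠ j → i ≠ l → i ≠ m → j ≠ l → j ≠ m → l ≠ m →
      |condRow P A k (fun ω => A ω k i * A ω k j * A ω k l * A ω k m) ω| ≤ p)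
    (hq : ∑ i, ∫ ω, |condRow P A k (fun ω => A ω k i ^ 2) ω - 1| ∂P ≤ q)
    (hρ : ∑ i, ∑ j, ∫ ω, |condRow P A k (fun ω => A ω k i ^ 2 * A ω k j ^ 2) ω - 1| ∂P ≤ ρ) :
    Integrable (fun ω => ‖n * rowForm (A ω) w k
      - (sqRes (cov (keepRows {k}ᶜ (A ω))) w).trace‖) P ∧
    w.im * ‖w‖ * ∫ ω, ‖n * rowForm (A ω) w k
        - (sqRes (cov (keepRows {k}ᶜ (A ω))) w).trace‖ ∂P
      ≤ √(2 * (p * N ^ 3 + s * (2 * N ^ 2 * √N + 4 * N ^ 2) + 3 * ρ + 2 * N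
        + 2 * N * (s * (N * √N) + q))) := by
  have hd : 0 < w.im * ‖w‖ := mul_pos hw (norm_pos_iff.mpr (by rintro rfl; simp at hw))
  set d := w.im * ‖w‖ with hd_def
  set G : Ω → Matrix (Fin N) (Fin N) ℂ := fun ω => sqRes (cov (keepRows {k}ᶜ (A ω))) w with hG
  set B := p * N ^ 3 + s * (2 * N ^ 2 * √N + 4 * N ^ 2) + 3 * ρ + 2 * N
        + 2 * N * (s * (N * √N) + q) with hB
  have hGm : ∀ i j, Measurable[rowsSigma A {k}ᶜ] fun ω => G ω i j := fun i j =>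
    @measurable_sqRes_apply n N Ω (rowsSigma A {k}ᶜ) _ (fun i' j' => by
      by_cases h : i' = k
      · simp [keepRows, h]
      · simpa [keepRows, h] using measurable_rows (A := A) {k}ᶜ (i := i') (by simpa using h) j')
      _ measurable_const i j
  have hGsym : ∀ ω i j, G ω i j = G ω j i := fun ω i j =>
    congrFun (congrFun (sqRes_transpose (cov_transpose (keepRows {k}ᶜ (A ω))) w) j) i
  have hGrow : ∀ ω i, d ^ 2 * ∑ j, ‖G ω i j‖ ^ 2 ≤ 1 := fun ω i => by
    simp only [hGsym ω i]
    exact sum_sq_norm_sqRes_col_le (cov_posSemidef _) hw i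
  have key : ∀ ψ : ℂ → ℝ, Measurable ψ → (∀ z, |ψ z| ≤ ‖z‖) →
      Integrable (fun ω => (∑ i, ∑ j, d * ψ (G ω i j) * (A ω k i * A ω k j)
        - ∑ i, d * ψ (G ω i i)) ^ 2) P ∧
      ∫ ω, (∑ i, ∑ j, d * ψ (G ω i j) * (A ω k i * A ω k j)
        - ∑ i, d * ψ (G ω i i)) ^ 2 ∂P ≤ B := by
    intro ψ hψ hψn
    refine integral_sq_quadForm_sub_trace_le (rowsSigma_le hA {k}ᶜ) (hA k) (h4 k)
      (H := fun ω => Matrix.of fun i j => d * ψ (G ω i j)) (fun i j => ?_) (fun ω i j => ?_)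
      (fun ω i => ?_) hp hs hc2 hc3 hc4 hq hρ
    · exact (hψ.comp (hGm i j)).const_mul d
    · simp only [Matrix.of_apply, hGsym ω i j]
    · refine le_trans ?_ (hGrow ω i)
      rw [Finset.mul_sum]
      refine Finset.sum_le_sum fun j _ => ?_
      simp only [Matrix.of_apply, mul_pow]
      refine mul_le_mul_of_nonneg_left ?_ (sq_nonneg d)
      rw [← sq_abs]
      exact pow_le_pow_left₀ (abs_nonneg _) (hψn _) 2
  obtain ⟨ire, hre⟩ := key Complex.re Complex.measurable_re Complex.abs_re_le_norm
  obtain ⟨iim, him⟩ := key Complex.im Complex.measurable_im Complex.abs_im_le_norm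
  have hform : ∀ ω, n * rowForm (A ω) w k = ∑ i, ∑ j, G ω i j * ((A ω k i * A ω k j : ℝ) : ℂ) := by
    intro ω
    have : (n : ℂ) ≠ 0 := by exact_mod_cast hn.ne'
    simp only [rowForm, cRow, Matrix.mulVec, dotProduct, Finset.mul_sum]
    push_cast
    refine Finset.sum_congr rfl fun i _ => Finset.sum_congr rfl fun j _ => ?_
    simp only [hG]
    field_simp
  have e : ∀ ω, d ^ 2 * ‖n * rowForm (A ω) w k - (G ω).trace‖ ^ 2
      = (∑ i, ∑ j, d * (G ω i j).re * (A ω k i * A ω k j) - ∑ i, d * (G ω i i).re) ^ 2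
      + (∑ i, ∑ j, d * (G ω i j).im * (A ω k i * A ω k j) - ∑ i, d * (G ω i i).im) ^ 2 := by
    intro ω
    rw [Complex.sq_norm, Complex.normSq_apply, hform, Complex.sub_re, Complex.sub_im, Matrix.trace]
    simp only [Complex.re_sum, Complex.im_sum, Complex.re_mul_ofReal, Complex.im_mul_ofReal,
      Matrix.diag_apply, mul_assoc, ← Finset.mul_sum]
    ring
  have hmeas : Measurable fun ω => n * rowForm (A ω) w k - (G ω).trace := by
    have hGm' : ∀ i j, Measurable fun ω => G ω i j := fun i j =>
      (hGm i j).mono (rowsSigma_le hA _) le_rfl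
    simp only [hform, Matrix.trace, Matrix.diag_apply]
    refine Measurable.sub ?_ (Finset.measurable_sum _ fun i _ => hGm' i i)
    exact Finset.measurable_sum _ fun i _ => Finset.measurable_sum _ fun j _ =>
      (hGm' i j).mul (Complex.measurable_ofReal.comp ((hA k i).mul (hA k j)))
  have i2' : Integrable (fun ω => d ^ 2 * ‖n * rowForm (A ω) w k - (G ω).trace‖ ^ 2) P := by
    simp only [e]; exact ire.add iim
  have i2 : Integrable (fun ω => ‖n * rowForm (A ω) w k - (G ω).trace‖ ^ 2) P := by
    rwa [integrable_const_mul_iff (IsUnit.mk0 _ (by positivity))] at i2'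
  obtain ⟨i1, h1⟩ := integral_le_sqrt_integral_sq hmeas.norm i2
  refine ⟨i1, ?_⟩
  have h2 : d ^ 2 * ∫ ω, ‖n * rowForm (A ω) w k - (G ω).trace‖ ^ 2 ∂P ≤ 2 * B := by
    rw [← integral_const_mul]
    simp only [e]
    rw [integral_add ire iim]
    linarith
  calc d * ∫ ω, ‖n * rowForm (A ω) w k - (G ω).trace‖ ∂P
      ≤ d * √(∫ ω, ‖n * rowForm (A ω) w k - (G ω).trace‖ ^ 2 ∂P) :=
        mul_le_mul_of_nonneg_left h1 hd.le
    _ = √(d ^ 2 * ∫ ω, ‖n * rowForm (A ω) w k - (G ω).trace‖ ^ 2 ∂P) := by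
        rw [Real.sqrt_mul (sq_nonneg d), Real.sqrt_sq hd.le]
    _ ≤ √(2 * B) := Real.sqrt_le_sqrt h2

end Concentration

/-! ### The approximate self-consistent equation -/

section SelfConsistent

/-- The constant in the `L²` bound for quadratic forms, when `N ≤ K n` and the conditional mixed
moments have implied constant `C`. -/
noncomputable def quadConst (K C : ℝ) : ℝ :=
  C * K ^ 3 + C * (2 * K ^ 2 * √K + 4 * K ^ 2) + 3 + 2 * K + 2 * K * (C * (K * √K) + 1)

theorem quadBound_le {n N K C γ ε q ρ : ℝ} (hn : 1 ≤ n) (hN : 0 ≤ N) (hNK : N ≤ K * n)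
    (hC : 0 ≤ C) (hγ : 0 ≤ γ) (hγε : γ ≤ ε) (hq : q ≤ n * ε) (hρ : ρ ≤ n ^ 2 * ε)
    (hnε : 1 ≤ n * ε) :
    C * (n⁻¹ * γ) * N ^ 3 + C * (n ^ (-(1 / 2) : ℝ) * γ) * (2 * N ^ 2 * √N + 4 * N ^ 2) + 3 * ρ
      + 2 * N + 2 * N * (C * (n ^ (-(1 / 2) : ℝ) * γ) * (N * √N) + q)
      ≤ quadConst K C * (n ^ 2 * ε) := by
  have hn0 : 0 < n := by linarith
  have hK : 0 ≤ K := by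
    by_contra h
    push Not at h
    nlinarith
  have hε : 0 ≤ ε := hγ.trans hγε
  have hsn : 1 ≤ √n := Real.one_le_sqrt.mpr hn
  have hsn2 : √n * √n = n := Real.mul_self_sqrt hn0.le
  have hr : n ^ (-(1 / 2) : ℝ) = (√n)⁻¹ := by
    rw [Real.rpow_neg hn0.le, Real.sqrt_eq_rpow]
  have hsN : √N ≤ √K * √n := by
    rw [← Real.sqrt_mul hK]; exact Real.sqrt_le_sqrt hNK
  rw [hr]
  have a1 : C * (n⁻¹ * γ) * N ^ 3 ≤ C * K ^ 3 * (n ^ 2 * ε) := by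
    calc C * (n⁻¹ * γ) * N ^ 3 ≤ C * (n⁻¹ * ε) * (K * n) ^ 3 := by gcongr
      _ = _ := by field_simp
  have a2 : C * ((√n)⁻¹ * γ) * (2 * N ^ 2 * √N + 4 * N ^ 2)
      ≤ C * (2 * K ^ 2 * √K + 4 * K ^ 2) * (n ^ 2 * ε) := by
    calc C * ((√n)⁻¹ * γ) * (2 * N ^ 2 * √N + 4 * N ^ 2)
        ≤ C * ((√n)⁻¹ * ε) * (2 * (K * n) ^ 2 * (√K * √n) + 4 * (K * n) ^ 2 * √n) := by
          have h4 : 4 * N ^ 2 ≤ 4 * (K * n) ^ 2 * √n :=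
            calc 4 * N ^ 2 ≤ 4 * (K * n) ^ 2 * 1 := by rw [mul_one]; gcongr
              _ ≤ _ := by gcongr
          gcongr
      _ = _ := by field_simp
  have a3 : C * ((√n)⁻¹ * γ) * (N * √N) ≤ C * (K * √K) * (n * ε) := by
    calc C * ((√n)⁻¹ * γ) * (N * √N) ≤ C * ((√n)⁻¹ * ε) * ((K * n) * (√K * √n)) := by gcongr
      _ = _ := by field_simp
  have a4 : 2 * N ≤ 2 * K * (n ^ 2 * ε) := by
    calc 2 * N ≤ 2 * (K * n) * (n * ε) := by
          nlinarith [mul_nonneg hK hn0.le]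
      _ = _ := by ring
  have a5 : 2 * N * (C * ((√n)⁻¹ * γ) * (N * √N) + q)
      ≤ 2 * K * (C * (K * √K) + 1) * (n ^ 2 * ε) := by
    calc 2 * N * (C * ((√n)⁻¹ * γ) * (N * √N) + q)
        ≤ 2 * N * (C * (K * √K) * (n * ε) + n * ε) := by gcongr
      _ ≤ 2 * (K * n) * (C * (K * √K) * (n * ε) + n * ε) := by gcongr
      _ = _ := by ring
  unfold quadConst
  linarith

variable {Ω : Type*} {m0 : MeasurableSpace Ω} {P : Measure Ω} {n N : ℕ}
  {A : Ω → Matrix (Fin n) (Fin N) ℝ}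

theorem sum_integral_le_qCoef (k : Fin n) :
    ∑ i : Fin N, ∫ ω, |condRow P A k (fun ω => A ω k i ^ 2) ω - 1| ∂P ≤ n * qCoef P A := by
  have hn : (0 : ℝ) < n := by exact_mod_cast k.pos
  have h := le_ciSup (Set.finite_range fun k : Fin n => (1 / (n : ℝ)) *
    ∑ i : Fin N, ∫ ω, |condRow P A k (fun ω => A ω k i ^ 2) ω - 1| ∂P).bddAbove k
  calc _ = n * ((1 / (n : ℝ)) *
        ∑ i : Fin N, ∫ ω, |condRow P A k (fun ω => A ω k i ^ 2) ω - 1| ∂P) := by field_simp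
    _ ≤ _ := mul_le_mul_of_nonneg_left h hn.le

theorem sum_integral_le_rhoCoef (k : Fin n) :
    ∑ i : Fin N, ∑ j : Fin N,
      ∫ ω, |condRow P A k (fun ω => A ω k i ^ 2 * A ω k j ^ 2) ω - 1| ∂P
      ≤ n ^ 2 * rhoCoef P A := by
  have hn : (0 : ℝ) < n := by exact_mod_cast k.pos
  have h := le_ciSup (Set.finite_range fun k : Fin n => (1 / (n : ℝ) ^ 2) *
    ∑ i : Fin N, ∑ j : Fin N,
      ∫ ω, |condRow P A k (fun ω => A ω k i ^ 2 * A ω k j ^ 2) ω - 1| ∂P).bddAbove k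
  calc _ = n ^ 2 * ((1 / (n : ℝ) ^ 2) * ∑ i : Fin N, ∑ j : Fin N,
      ∫ ω, |condRow P A k (fun ω => A ω k i ^ 2 * A ω k j ^ 2) ω - 1| ∂P) := by field_simp
    _ ≤ _ := mul_le_mul_of_nonneg_left h (by positivity)

/-- The expected trace `(1/n) 𝔼 tr (AᵀA/n - w²)⁻¹`. -/
noncomputable def meanTrace {m0 : MeasurableSpace Ω} (P : Measure Ω)
    (A : Ω → Matrix (Fin n) (Fin N) ℝ) (w : ℂ) : ℂ :=
  (∫ ω, (sqRes (cov (A ω)) w).trace ∂P) / n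

theorem im_mul_meanTrace_nonneg [IsProbabilityMeasure P]
    (hA : ∀ i j, Measurable fun ω => A ω i j) {w : ℂ} (hw : 0 < w.im) :
    0 ≤ (w * meanTrace P A w).im := by
  have h1 : w * meanTrace P A w = (∫ ω, w * (sqRes (cov (A ω)) w).trace ∂P) / (n : ℂ) := by
    rw [meanTrace, integral_const_mul, mul_div_assoc]
  have h2 : (∫ ω, w * (sqRes (cov (A ω)) w).trace ∂P).im
      = ∫ ω, (w * (sqRes (cov (A ω)) w).trace).im ∂P :=
    (integral_im ((integrable_trace_sqRes hA hw).const_mul w)).symm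
  rw [h1, Complex.div_natCast_im, h2]
  exact div_nonneg (integral_nonneg fun ω => im_mul_trace_nonneg (cov_posSemidef _) hw)
    (Nat.cast_nonneg n)

theorem norm_meanTrace_le [IsProbabilityMeasure P] (hn : 0 < n) {w : ℂ} (hw : 0 < w.im) :
    w.im * ‖w‖ * ‖meanTrace P A w‖ ≤ N / n := by
  have hd : 0 < w.im * ‖w‖ := mul_pos hw (norm_pos_iff.mpr (by rintro rfl; simp at hw))
  have hn' : (0 : ℝ) < n := by exact_mod_cast hn
  have h : ‖∫ ω, (sqRes (cov (A ω)) w).trace ∂P‖ ≤ N / (w.im * ‖w‖) := by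
    refine (norm_integral_le_of_norm_le_const (Eventually.of_forall fun ω => ?_)).trans_eq
      (by rw [probReal_univ, mul_one])
    rw [le_div_iff₀ hd, mul_comm]
    exact norm_trace_sqRes_le (A ω) hw
  rw [meanTrace, norm_div, Complex.norm_natCast, ← mul_div_assoc]
  rw [le_div_iff₀ hd, mul_comm] at h
  gcongr

theorem norm_inv_one_add_sub_le {w x y : ℂ} (hw : 0 < w.im) (hx : 0 ≤ (w * x).im)
    (hy : 0 ≤ (w * y).im) :
    ‖(1 + x)⁻¹ - (1 + y)⁻¹‖ ≤ (‖w‖ / w.im) ^ 2 * ‖x - y‖ := by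
  have hwn : 0 < ‖w‖ := norm_pos_iff.mpr (by rintro rfl; simp at hw)
  have h1 := im_le_norm_mul_norm_one_add hx
  have h2 := im_le_norm_mul_norm_one_add hy
  have p1 : 0 < ‖1 + x‖ := pos_of_mul_pos_right (hw.trans_le h1) hwn.le
  have p2 : 0 < ‖1 + y‖ := pos_of_mul_pos_right (hw.trans_le h2) hwn.le
  have b1 : ‖1 + x‖⁻¹ ≤ ‖w‖ / w.im := by
    rw [inv_le_comm₀ p1 (by positivity), inv_div, div_le_iff₀ hwn, mul_comm]; exact h1
  have b2 : ‖1 + y‖⁻¹ ≤ ‖w‖ / w.im := by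
    rw [inv_le_comm₀ p2 (by positivity), inv_div, div_le_iff₀ hwn, mul_comm]; exact h2
  rw [inv_sub_inv (norm_pos_iff.mp p1) (norm_pos_iff.mp p2), norm_div, norm_mul,
    add_sub_add_left_eq_sub, norm_sub_rev, div_eq_mul_inv, mul_inv, mul_comm, pow_two]
  gcongr

/-- The approximate self-consistent equation for the expected trace of the resolvent. -/
theorem norm_selfConsistent_le [IsProbabilityMeasure P] (hn : 0 < n)
    (hA : ∀ i j, Measurable fun ω => A ω i j)
    (h4 : ∀ i j, Integrable (fun ω => |A ω i j| ^ 4) P) {b : ℕ}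
    (hind : ∀ S T : Set (Fin n),
      (∀ i ∈ S, ∀ j ∈ T, (b : ℤ) < |((i : ℕ) : ℤ) - ((j : ℕ) : ℤ)|) →
      Indep (rowsSigma A S) (rowsSigma A T) P) {K C γ ε : ℝ} (hNK : (N : ℝ) ≤ K * n)
    (hC : 0 ≤ C) (hγ : 0 ≤ γ)
    (hc2 : ∀ᵐ ω ∂P, ∀ k : Fin n,
      (∀ i j, i ≠ j → |condRow P A k (fun ω => A ω k i * A ω k j) ω|
        ≤ C * ((n : ℝ) ^ (-(1 / 2) : ℝ) * γ)) ∧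
      (∀ i j l, j ≠ l → |condRow P A k (fun ω => A ω k i ^ 2 * A ω k j * A ω k l) ω|
        ≤ C * ((n : ℝ) ^ (-(1 / 2) : ℝ) * γ)))
    (hc4 : ∀ᵐ ω ∂P, ∀ k : Fin n, ∀ i j l m, i ≠ j → i ≠ l → i ≠ m → j ≠ l → j ≠ m → l ≠ m →
      |condRow P A k (fun ω => A ω k i * A ω k j * A ω k l * A ω k m) ω| ≤ C * ((n : ℝ)⁻¹ * γ))
    (hγε : γ ≤ ε) (hq : qCoef P A ≤ ε) (hρ : rhoCoef P A ≤ ε) (hb : ((b : ℝ) + 1) ^ 2 / n ≤ ε)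
    {w : ℂ} (hw : 0 < w.im) :
    ‖(N : ℂ) / n + w ^ 2 * meanTrace P A w - 1 + (1 + meanTrace P A w)⁻¹‖
      ≤ (√(2 * quadConst K C) + 1 + √8) * √ε * ‖w‖ / w.im ^ 3 := by
  have hwn : 0 < ‖w‖ := norm_pos_iff.mpr (by rintro rfl; simp at hw)
  have hd : 0 < w.im * ‖w‖ := mul_pos hw hwn
  have hn' : (0 : ℝ) < n := by exact_mod_cast hn
  have hn1 : (1 : ℝ) ≤ n := by exact_mod_cast hn
  have hnC : (n : ℂ) ≠ 0 := by exact_mod_cast hn.ne'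
  set d := w.im * ‖w‖ with hd_def
  set m := meanTrace P A w with hm
  have hε : 0 ≤ ε := hγ.trans hγε
  have hb' : ((b : ℝ) + 1) ^ 2 ≤ n * ε := by rwa [div_le_iff₀ hn', mul_comm] at hb
  have hnε : 1 ≤ n * ε := le_trans (by nlinarith [Nat.cast_nonneg (α := ℝ) b]) hb'
  have hsε : 1 ≤ n * √ε := by
    rw [← abs_of_pos hn', ← Real.sqrt_sq_eq_abs, ← Real.sqrt_mul (sq_nonneg _)]
    exact Real.one_le_sqrt.mpr (by nlinarith)
  set R := (√(2 * quadConst K C) + 1 + √8) * (n * √ε) with hR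
  -- the error for one row
  have hrow : ∀ k : Fin n,
      Integrable (fun ω => ‖n * rowForm (A ω) w k
        - (sqRes (cov (keepRows {k}ᶜ (A ω))) w).trace‖) P ∧
      d * ∫ ω, ‖n * rowForm (A ω) w k
        - (sqRes (cov (keepRows {k}ᶜ (A ω))) w).trace‖ ∂P ≤ √(2 * quadConst K C) * (n * √ε) := by
    intro k
    have h := integral_norm_rowForm_sub_trace_le (P := P) hn hA h4 hw (k := k)
      (p := C * ((n : ℝ)⁻¹ * γ)) (s := C * ((n : ℝ) ^ (-(1 / 2) : ℝ) * γ)) (by positivity)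
      (by positivity) (hc2.mono fun ω h => (h k).1) (hc2.mono fun ω h => (h k).2)
      (hc4.mono fun ω h => h k) (sum_integral_le_qCoef k) (sum_integral_le_rhoCoef k)
    refine ⟨h.1, h.2.trans ?_⟩
    have h2 := quadBound_le hn1 (Nat.cast_nonneg N) hNK hC hγ hγε
      (mul_le_mul_of_nonneg_left hq hn'.le) (mul_le_mul_of_nonneg_left hρ (sq_nonneg (n : ℝ))) hnε
    calc _ ≤ √(2 * quadConst K C * (n ^ 2 * ε)) := Real.sqrt_le_sqrt (by linarith)
      _ = _ := by
        rw [Real.sqrt_mul' _ (by positivity), Real.sqrt_mul (sq_nonneg _), Real.sqrt_sq hn'.le]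
  have hconc : d * ∫ ω, ‖(sqRes (cov (A ω)) w).trace
      - ∫ ω', (sqRes (cov (A ω')) w).trace ∂P‖ ∂P ≤ √8 * (n * √ε) := by
    refine (integral_norm_trace_sub_mean_le hA hind hw).trans ?_
    calc √(8 * n * (b + 1) ^ 2) ≤ √(8 * (n ^ 2 * ε)) := Real.sqrt_le_sqrt (by nlinarith)
      _ = _ := by
        rw [Real.sqrt_mul (by norm_num), Real.sqrt_mul (sq_nonneg _), Real.sqrt_sq hn'.le]
  have hti := integrable_trace_sqRes (P := P) hA hw
  have hnm : ∫ ω', (sqRes (cov (A ω')) w).trace ∂P = n * m := by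
    rw [hm, meanTrace]; field_simp
  rw [hnm] at hconc
  have hmim := im_mul_meanTrace_nonneg (P := P) hA hw
  rw [← hm] at hmim
  -- a pointwise bound for the deviation in the exact equation
  set g : Fin n → Ω → ℝ := fun k ω =>
    ‖n * rowForm (A ω) w k - (sqRes (cov (keepRows {k}ᶜ (A ω))) w).trace‖ + d⁻¹
      + ‖(sqRes (cov (A ω)) w).trace - n * m‖ with hg
  have ic : Integrable (fun ω => ‖(sqRes (cov (A ω)) w).trace - n * m‖) P :=
    (hti.sub (integrable_const _)).norm
  have hgi : ∀ k, Integrable (g k) P := fun k =>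
    ((hrow k).1.add (integrable_const _)).add ic
  have hgR : ∀ k, d * ∫ ω, g k ω ∂P ≤ R := by
    intro k
    have : ∫ ω, g k ω ∂P = ∫ ω, ‖n * rowForm (A ω) w k
        - (sqRes (cov (keepRows {k}ᶜ (A ω))) w).trace‖ ∂P + d⁻¹
        + ∫ ω, ‖(sqRes (cov (A ω)) w).trace - n * m‖ ∂P := by
      rw [hg, integral_add (f := fun ω => ‖n * rowForm (A ω) w k
        - (sqRes (cov (keepRows {k}ᶜ (A ω))) w).trace‖ + d⁻¹)
        ((hrow k).1.add (integrable_const _)) ic,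
        integral_add (hrow k).1 (integrable_const _)]
      simp
    rw [this, mul_add, mul_add, mul_inv_cancel₀ hd.ne', hR]
    have := (hrow k).2
    linarith
  have hpt : ∀ ω, ‖(N : ℂ) + w ^ 2 * (sqRes (cov (A ω)) w).trace - n + n * (1 + m)⁻¹‖
      ≤ ∑ k, (‖w‖ / w.im) ^ 2 * ((n : ℝ)⁻¹ * g k ω) := by
    intro ω
    have e : (N : ℂ) + w ^ 2 * (sqRes (cov (A ω)) w).trace - n + n * (1 + m)⁻¹
        = -∑ k, ((1 + rowForm (A ω) w k)⁻¹ - (1 + m)⁻¹) := by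
      rw [card_add_trace_eq_sum (A ω) hw]
      simp only [Finset.sum_sub_distrib, Finset.sum_const, Finset.card_univ, Fintype.card_fin,
        nsmul_eq_mul]
      ring
    rw [e, norm_neg]
    refine (norm_sum_le _ _).trans (Finset.sum_le_sum fun k _ => ?_)
    refine (norm_inv_one_add_sub_le hw (im_mul_rowForm_nonneg (A ω) hw k) hmim).trans ?_
    refine mul_le_mul_of_nonneg_left ?_ (by positivity)
    rw [le_inv_mul_iff₀ hn']
    have h1 : (n : ℝ) * ‖rowForm (A ω) w k - m‖ = ‖n * rowForm (A ω) w k - n * m‖ := by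
      rw [← mul_sub, norm_mul, Complex.norm_natCast]
    rw [h1, hg]
    have h2 := norm_trace_sub_keepRows_le (A ω) hw {k}
    rw [Finset.card_singleton, Nat.cast_one, ← hd_def, mul_comm, ← le_div_iff₀ hd, one_div,
      norm_sub_rev] at h2
    have h3 : n * rowForm (A ω) w k - n * m
        = (n * rowForm (A ω) w k - (sqRes (cov (keepRows {k}ᶜ (A ω))) w).trace)
        + ((sqRes (cov (keepRows {k}ᶜ (A ω))) w).trace - (sqRes (cov (A ω)) w).trace)
        + ((sqRes (cov (A ω)) w).trace - n * m) := by ring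
    rw [h3]
    exact norm_add₃_le.trans (add_le_add (add_le_add le_rfl h2) le_rfl)
  have hE : ∫ ω, ((N : ℂ) + w ^ 2 * (sqRes (cov (A ω)) w).trace - n + n * (1 + m)⁻¹) ∂P
      = n * ((N : ℂ) / n + w ^ 2 * m - 1 + (1 + m)⁻¹) := by
    have : ∀ ω, (N : ℂ) + w ^ 2 * (sqRes (cov (A ω)) w).trace - n + n * (1 + m)⁻¹
        = ((N : ℂ) - n + n * (1 + m)⁻¹) + w ^ 2 * (sqRes (cov (A ω)) w).trace := fun ω => by ring
    simp only [this]
    rw [integral_add (integrable_const _) (hti.const_mul _), integral_const_mul, hnm]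
    simp only [integral_const, probReal_univ, one_smul]
    field_simp
    ring
  have hfin : (n : ℝ) * ‖(N : ℂ) / n + w ^ 2 * m - 1 + (1 + m)⁻¹‖
      ≤ n * ((‖w‖ / w.im) ^ 2 * ((n : ℝ)⁻¹ * (R / d))) := by
    rw [← Complex.norm_natCast n, ← norm_mul, ← hE, Complex.norm_natCast]
    refine (norm_integral_le_integral_norm _).trans ?_
    refine (integral_mono_of_nonneg (Eventually.of_forall fun ω => norm_nonneg _)
      (integrable_finsetSum _ fun k _ => ((hgi k).const_mul _).const_mul _)
      (Eventually.of_forall hpt)).trans ?_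
    rw [integral_finsetSum _ fun k _ => ((hgi k).const_mul _).const_mul _]
    calc _ ≤ ∑ _k : Fin n, (‖w‖ / w.im) ^ 2 * ((n : ℝ)⁻¹ * (R / d)) := by
          refine Finset.sum_le_sum fun k _ => ?_
          rw [integral_const_mul, integral_const_mul]
          have := hgR k
          rw [mul_comm, ← le_div_iff₀ hd] at this
          gcongr
      _ = _ := by simp
  refine (le_of_mul_le_mul_left hfin hn').trans (le_of_eq ?_)
  rw [hR, hd_def]
  field_simp

end SelfConsistent

/-! ### Stability of the self-consistent equation -/

section Stability

/-- `(x - a) (b - x)` with `a, b = (1 ∓ √(κ + 1))²`, as a polynomial in `κ`. -/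
def mpDisc (κ x : ℝ) : ℝ := 2 * (κ + 2) * x - x ^ 2 - κ ^ 2

theorem abs_sub_le_sqrt_abs_sq_sub {x y : ℝ} (hx : 0 ≤ x) (hy : 0 ≤ y) :
    |x - y| ≤ √|x ^ 2 - y ^ 2| := by
  apply Real.le_sqrt_of_sq_le
  rw [show x ^ 2 - y ^ 2 = (x - y) * (x + y) by ring, abs_mul, pow_two, abs_of_nonneg (add_nonneg hx hy)]
  refine mul_le_mul_of_nonneg_left ?_ (abs_nonneg _)
  rw [abs_le]
  constructor <;> linarith

/-- The imaginary part of a square root, compared with the one of a real number. No choice of a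
branch is needed, since `(Im W)² = (|W²| - Re W²) / 2` is Lipschitz in `W²`. -/
theorem abs_im_sub_sqrt_le {W : ℂ} (hW : 0 ≤ W.im) (D : ℝ) :
    |W.im - √D| ≤ √‖W ^ 2 + D‖ := by
  refine (abs_sub_le_sqrt_abs_sq_sub hW (Real.sqrt_nonneg D)).trans (Real.sqrt_le_sqrt ?_)
  have h1 : W.im ^ 2 = (‖W ^ 2‖ - (W ^ 2).re) / 2 := by
    rw [norm_pow, Complex.sq_norm, Complex.normSq_apply, pow_two, pow_two, Complex.mul_re]
    ring
  have h2 : √D ^ 2 = (|D| + D) / 2 := by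
    rcases le_total 0 D with h | h
    · rw [Real.sq_sqrt h, abs_of_nonneg h]; ring
    · rw [Real.sqrt_eq_zero_of_nonpos h, abs_of_nonpos h]; ring
  have h3 : |(‖W ^ 2‖) - (|D|)| ≤ ‖W ^ 2 + D‖ := by
    have := abs_norm_sub_norm_le (W ^ 2) (-(D : ℂ))
    rwa [norm_neg, Complex.norm_real, Real.norm_eq_abs, sub_neg_eq_add] at this
  have h4 : |(W ^ 2).re + D| ≤ ‖W ^ 2 + D‖ := by
    have := Complex.abs_re_le_norm (W ^ 2 + D)
    rwa [Complex.add_re, Complex.ofReal_re] at this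
  rw [h1, h2]
  rw [abs_le] at *
  constructor <;> linarith

/-- Solutions of the perturbed equation in the upper half-plane are bounded. -/
theorem norm_le_two_of_approx {w h : ℂ} {κ : ℝ} (hw : 0 < w.im) (hκ : 0 ≤ κ) (hh : 0 ≤ h.im)
    (he : ‖h ^ 2 + (w - κ / w) * h + 1‖ ≤ w.im) : ‖h‖ ≤ 2 := by
  by_contra hlt
  push Not at hlt
  have h0 : h ≠ 0 := by rintro rfl; norm_num at hlt
  have hw0 : w ≠ 0 := by rintro rfl; simp at hw
  set e := h ^ 2 + (w - κ / w) * h + 1 with he_def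
  have h1 : h + w - κ / w = e / h - h⁻¹ := by
    rw [he_def]; field_simp; ring
  have h2 := congrArg Complex.im h1
  have h3 : ((κ : ℂ) / w).im ≤ 0 := by
    rw [Complex.div_im]
    simp only [Complex.ofReal_im, Complex.ofReal_re, zero_mul, zero_div, zero_sub]
    have := div_nonneg (mul_nonneg hκ hw.le) (Complex.normSq_nonneg w)
    linarith
  have h4 : (e / h).im ≤ w.im / 2 := by
    refine (Complex.im_le_norm _).trans ?_
    rw [norm_div]
    gcongr
  have h5 : -(h⁻¹).im ≤ h.im / 4 := by
    rw [Complex.inv_im, neg_div, neg_neg, Complex.normSq_eq_norm_sq]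
    refine div_le_div_of_nonneg_left hh (by norm_num) ?_
    nlinarith
  simp only [Complex.add_im, Complex.sub_im] at h2
  linarith

/-- The constant in the stability estimate on `0 < u ≤ T`, for `κ ≤ K`. -/
noncomputable def stabConst (K T : ℝ) : ℝ :=
  √(2 * (6 * (T + 1) ^ 2 + 6 * K + 12 + 4 * (T + 1))) / 2 + T + 2 + (4 + K)

/-- Stability: a solution of the perturbed equation at height `V` above the real axis is close to
the Marchenko–Pastur density in the variable `u = √x`. -/
theorem abs_im_sub_density_le {u V κ K T : ℝ} (hV : 0 < V) (hV1 : V ≤ 1) (hu : 0 < u) (huT : u ≤ T)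
    (hκ : 0 ≤ κ) (hκK : κ ≤ K) {w h : ℂ} (hwre : w.re = u) (hwim : w.im = V) (hh : 0 ≤ h.im)
    (hwh : 0 ≤ (w * h).im) (he : ‖h ^ 2 + (w - κ / w) * h + 1‖ ≤ V) :
    |h.im - √(mpDisc κ (u ^ 2)) / (2 * u)| ≤ stabConst K T * √(V / u) := by
  have hh2 : ‖h‖ ≤ 2 := norm_le_two_of_approx (hwim ▸ hV) hκ hh (hwim ▸ he)
  have hT : 0 < T := hu.trans_le huT
  have hK : 0 ≤ K := hκ.trans hκK
  have hc1 : 0 ≤ √(2 * (6 * (T + 1) ^ 2 + 6 * K + 12 + 4 * (T + 1))) := Real.sqrt_nonneg _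
  rcases lt_or_ge u V with huV | huV
  · -- near the origin both terms are bounded
    have h1 : 1 ≤ √(V / u) := Real.one_le_sqrt.mpr ((one_le_div hu).mpr huV.le)
    have h2 : h.im ≤ 2 := (Complex.im_le_norm h).trans hh2
    have h3 : √(mpDisc κ (u ^ 2)) / (2 * u) ≤ K + 2 := by
      rw [div_le_iff₀ (by positivity)]
      refine Real.sqrt_le_iff.mpr ⟨by positivity, ?_⟩
      unfold mpDisc
      nlinarith [sq_nonneg (u ^ 2), sq_nonneg κ, mul_nonneg (sq_nonneg u) hK, sq_nonneg (K * u),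
        mul_le_mul_of_nonneg_right hκK (sq_nonneg u)]
    have h4 : 0 ≤ √(mpDisc κ (u ^ 2)) / (2 * u) := by positivity
    have h5 : 4 + K ≤ stabConst K T := by unfold stabConst; linarith
    calc |h.im - √(mpDisc κ (u ^ 2)) / (2 * u)| ≤ 4 + K := by
          rw [abs_le]; constructor <;> linarith
      _ ≤ stabConst K T * 1 := by rw [mul_one]; exact h5
      _ ≤ _ := mul_le_mul_of_nonneg_left h1 (by linarith)
  · have hw0 : w ≠ 0 := by rintro rfl; simp at hwre; linarith
    have hwn : ‖w‖ ≤ 2 * u := by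
      refine (Complex.norm_le_abs_re_add_abs_im w).trans ?_
      rw [hwre, hwim, abs_of_pos hu, abs_of_pos hV]
      linarith
    have hwT : ‖w‖ ≤ T + 1 := by
      refine (Complex.norm_le_abs_re_add_abs_im w).trans ?_
      rw [hwre, hwim, abs_of_pos hu, abs_of_pos hV]
      linarith
    set e := h ^ 2 + (w - κ / w) * h + 1 with he_def
    set W := 2 * (w * h) + w ^ 2 - κ with hW
    have hW2 : W ^ 2 + (mpDisc κ (u ^ 2) : ℝ)
        = (w ^ 2 - (u : ℂ) ^ 2) * (w ^ 2 + (u : ℂ) ^ 2 - 2 * (κ + 2)) + 4 * w ^ 2 * e := by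
      rw [hW, he_def, mpDisc]
      push_cast
      field_simp
      ring
    have hwu : ‖w ^ 2 - (u : ℂ) ^ 2‖ ≤ 3 * V * ‖w‖ := by
      have hwuV : w - u = V * Complex.I := by
        apply Complex.ext <;> simp [hwre, hwim]
      have huw : u ≤ ‖w‖ := by
        rw [← hwre]; exact Complex.re_le_norm w
      rw [sq_sub_sq, norm_mul, hwuV, norm_mul, Complex.norm_I, mul_one, Complex.norm_real,
        Real.norm_of_nonneg hV.le]
      have : ‖w + u‖ ≤ ‖w‖ + u := by
        refine (norm_add_le _ _).trans (le_of_eq ?_)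
        rw [Complex.norm_real, Real.norm_of_nonneg hu.le]
      nlinarith
    have hQ : ‖W ^ 2 + (mpDisc κ (u ^ 2) : ℝ)‖
        ≤ 2 * (6 * (T + 1) ^ 2 + 6 * K + 12 + 4 * (T + 1)) * (V * u) := by
      have h1 : ‖w ^ 2 + (u : ℂ) ^ 2 - 2 * (κ + 2)‖ ≤ 2 * (T + 1) ^ 2 + 2 * (K + 2) := by
        have e1 : ‖w ^ 2‖ ≤ (T + 1) ^ 2 := by
          rw [norm_pow]; exact pow_le_pow_left₀ (norm_nonneg _) hwT 2
        have e2 : ‖(u : ℂ) ^ 2‖ ≤ (T + 1) ^ 2 := by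
          rw [norm_pow, Complex.norm_real, Real.norm_of_nonneg hu.le]
          exact pow_le_pow_left₀ hu.le (by linarith) 2
        have e3 : ‖(2 * (κ + 2) : ℂ)‖ ≤ 2 * (K + 2) := by
          have : (2 * (κ + 2) : ℂ) = ((2 * (κ + 2) : ℝ) : ℂ) := by push_cast; ring
          rw [this, Complex.norm_real, Real.norm_of_nonneg (by positivity)]
          linarith
        refine (norm_sub_le _ _).trans ?_
        have := norm_add_le (w ^ 2) ((u : ℂ) ^ 2)
        linarith
      have h2 : ‖4 * w ^ 2 * e‖ ≤ 4 * (T + 1) * V * ‖w‖ := by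
        rw [norm_mul, norm_mul, norm_pow, Complex.norm_ofNat]
        calc 4 * ‖w‖ ^ 2 * ‖e‖ = 4 * ‖w‖ * ‖e‖ * ‖w‖ := by ring
          _ ≤ 4 * (T + 1) * V * ‖w‖ := by gcongr
      rw [hW2]
      refine (norm_add_le _ _).trans ?_
      rw [norm_mul]
      calc ‖w ^ 2 - (u : ℂ) ^ 2‖ * ‖w ^ 2 + (u : ℂ) ^ 2 - 2 * (κ + 2)‖ + ‖4 * w ^ 2 * e‖
          ≤ 3 * V * ‖w‖ * (2 * (T + 1) ^ 2 + 2 * (K + 2)) + 4 * (T + 1) * V * ‖w‖ := by gcongr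
        _ = (6 * (T + 1) ^ 2 + 6 * K + 12 + 4 * (T + 1)) * (V * ‖w‖) := by ring
        _ ≤ (6 * (T + 1) ^ 2 + 6 * K + 12 + 4 * (T + 1)) * (V * (2 * u)) := by gcongr
        _ = _ := by ring
    have hWim : W.im = 2 * (w * h).im + 2 * u * V := by
      have : (w ^ 2).im = 2 * u * V := by
        rw [pow_two, Complex.mul_im, hwre, hwim]; ring
      rw [hW, Complex.sub_im, Complex.add_im, this, Complex.ofReal_im, sub_zero,
        show (2 : ℂ) * (w * h) = ((2 : ℝ) : ℂ) * (w * h) by norm_num, Complex.im_ofReal_mul]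
    have hW0 : 0 ≤ W.im := by rw [hWim]; positivity
    have hmain := (abs_im_sub_sqrt_le hW0 (mpDisc κ (u ^ 2))).trans (Real.sqrt_le_sqrt hQ)
    have huh : u * h.im = W.im / 2 - u * V - V * h.re := by
      rw [hWim, Complex.mul_im, hwre, hwim]; ring
    have hre : |h.re| ≤ 2 := (Complex.abs_re_le_norm h).trans hh2
    have hVu : V / u ≤ √(V / u) := by
      have h0 : 0 ≤ V / u := by positivity
      apply Real.le_sqrt_of_sq_le
      have : V / u ≤ 1 := (div_le_one hu).mpr huV
      nlinarith
    set R := √(V / u) with hR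
    have hsq : √(V * u) = u * R := by
      rw [hR, show V * u = u ^ 2 * (V / u) by field_simp, Real.sqrt_mul (sq_nonneg u),
        Real.sqrt_sq hu.le]
    rw [Real.sqrt_mul (by positivity), hsq] at hmain
    have hV' : V ≤ u * R := by rw [div_le_iff₀ hu] at hVu; linarith
    have hfin : |u * h.im - √(mpDisc κ (u ^ 2)) / 2| ≤ u * (stabConst K T * R) := by
      rw [huh]
      have t1 : u * V ≤ T * (u * R) := by
        calc u * V ≤ T * V := by gcongr
          _ ≤ _ := by gcongr
      have t2 : |V * h.re| ≤ 2 * (u * R) := by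
        rw [abs_mul, abs_of_pos hV, mul_comm]
        exact mul_le_mul hre hV' hV.le (by norm_num)
      have t3 : 0 ≤ (4 + K) * (u * R) := by positivity
      have t4 : u * (stabConst K T * R)
          = √(2 * (6 * (T + 1) ^ 2 + 6 * K + 12 + 4 * (T + 1))) * (u * R) / 2
            + T * (u * R) + 2 * (u * R) + (4 + K) * (u * R) := by
        unfold stabConst; ring
      have t5 : 0 ≤ u * V := by positivity
      rw [t4]
      rw [abs_le] at *
      constructor <;> linarith
    have e1 : h.im - √(mpDisc κ (u ^ 2)) / (2 * u)
        = (u * h.im - √(mpDisc κ (u ^ 2)) / 2) / u := by field_simp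
    rw [e1, abs_div, abs_of_pos hu, div_le_iff₀ hu, mul_comm _ u]
    exact hfin

end Stability

/-! ### The Marchenko–Pastur distribution function -/

section Law

theorem mpDisc_eq {c : ℝ} (hc : 0 ≤ c) (x : ℝ) :
    mpDisc (c - 1) x = (x - (1 - √c) ^ 2) * ((1 + √c) ^ 2 - x) := by
  have h := Real.sq_sqrt hc
  unfold mpDisc
  linear_combination (√c ^ 2 + c - 2 - 2 * x) * h

theorem mpDensity_eq {c : ℝ} (hc : 0 ≤ c) (x : ℝ) :
    mpDensity c x = √(mpDisc (c - 1) x) / (2 * Real.pi * x) := by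
  unfold mpDensity
  split_ifs with h
  · rw [mpDisc_eq hc]
  · have hab : (1 - √c) ^ 2 ≤ (1 + √c) ^ 2 := by nlinarith [Real.sqrt_nonneg c]
    rw [mpDisc_eq hc, Real.sqrt_eq_zero_of_nonpos, zero_div]
    by_cases h1 : (1 - √c) ^ 2 ≤ x
    · have : (1 + √c) ^ 2 < x := by
        by_contra h2; exact h ⟨h1, not_lt.mp h2⟩
      exact mul_nonpos_of_nonneg_of_nonpos (by linarith) (by linarith)
    · push Not at h1
      exact mul_nonpos_of_nonpos_of_nonneg (by linarith) (by linarith)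

theorem mpDensity_nonneg (c x : ℝ) : 0 ≤ mpDensity c x := by
  unfold mpDensity
  split_ifs with h
  · have : 0 ≤ x := (sq_nonneg _).trans h.1
    positivity
  · exact le_rfl

theorem mpDensity_of_nonpos (c : ℝ) {x : ℝ} (hx : x ≤ 0) : mpDensity c x = 0 := by
  unfold mpDensity
  split_ifs with h
  · have : x = 0 := le_antisymm hx ((sq_nonneg _).trans h.1)
    simp [this]
  · rfl

theorem measurable_mpDensity (c : ℝ) : Measurable (mpDensity c) := by
  unfold mpDensity
  refine Measurable.ite ?_ (by fun_prop) measurable_const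
  exact measurableSet_Icc

theorem mpLaw_real_eq {c : ℝ} (hc : 1 ≤ c) {s : Set ℝ} (hs : MeasurableSet s) :
    (mpLaw c).real s = ∫ x in s, mpDensity c x := by
  have h0 : ENNReal.ofReal (1 - c) = 0 := ENNReal.ofReal_of_nonpos (by linarith)
  rw [integral_eq_lintegral_of_nonneg_ae (Eventually.of_forall (mpDensity_nonneg c))
    (measurable_mpDensity c).aestronglyMeasurable]
  simp [mpLaw, Measure.real, h0, withDensity_apply _ hs]

theorem mpCDF_of_nonpos {c : ℝ} (hc : 1 ≤ c) {x : ℝ} (hx : x ≤ 0) : mpCDF c x = 0 := by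
  rw [mpCDF, mpLaw_real_eq hc measurableSet_Iic]
  refine setIntegral_eq_zero_of_forall_eq_zero fun y hy => mpDensity_of_nonpos c (le_trans hy hx)

/-- The distribution function in the variable `u = √x`, in which the density is bounded. -/
theorem mpCDF_sq {c : ℝ} (hc : 1 ≤ c) {x : ℝ} (hx : 0 ≤ x) :
    mpCDF c (x ^ 2) = ∫ u in (0 : ℝ)..x, 2 / Real.pi * (√(mpDisc (c - 1) (u ^ 2)) / (2 * u)) := by
  have hc0 : 0 ≤ c := by linarith
  have h1 : mpCDF c (x ^ 2) = ∫ y in Set.Ioc 0 (x ^ 2), mpDensity c y := by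
    rw [mpCDF, mpLaw_real_eq hc measurableSet_Iic]
    refine setIntegral_eq_of_subset_of_forall_sdiff_eq_zero measurableSet_Iic
      (fun y hy => hy.2) fun y hy => mpDensity_of_nonpos c ?_
    by_contra h
    exact hy.2 ⟨not_le.mp h, hy.1⟩
  have h2 : (fun u : ℝ => u ^ 2) '' Set.Ioc 0 x = Set.Ioc 0 (x ^ 2) := by
    ext y
    constructor
    · rintro ⟨u, ⟨h0, h1⟩, rfl⟩
      exact ⟨by positivity, pow_le_pow_left₀ h0.le h1 2⟩
    · rintro ⟨h0, h1⟩
      exact ⟨√y, ⟨Real.sqrt_pos.mpr h0, Real.sqrt_le_iff.mpr ⟨hx, h1⟩⟩, Real.sq_sqrt h0.le⟩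
  have h3 := integral_image_eq_integral_abs_deriv_smul (s := Set.Ioc 0 x)
    (f := fun u : ℝ => u ^ 2) (f' := fun u => 2 * u) measurableSet_Ioc
    (fun u _ => by simpa using (hasDerivAt_pow 2 u).hasDerivWithinAt)
    (fun u hu v hv h => (pow_left_inj₀ hu.1.le hv.1.le two_ne_zero).mp h) (mpDensity c)
  rw [h1, ← h2, h3, intervalIntegral.integral_of_le hx]
  refine setIntegral_congr_fun measurableSet_Ioc fun u hu => ?_
  have hu0 := hu.1
  simp only [smul_eq_mul]
  rw [mpDensity_eq hc0, abs_of_pos (by positivity)]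
  field_simp

/-- The function `κ arcsin ((s x - κ²) / (r x))`, one of the three terms of the antiderivative of
the density; for `κ = 0` it vanishes. -/
theorem exists_antideriv_inv_mul_sqrt {κ s r : ℝ} (hκ : 0 ≤ κ) (hr : 0 < r) (hrs : r ≤ s)
    (hsr : s ^ 2 - r ^ 2 = κ ^ 2) :
    ∃ F : ℝ → ℝ, ContinuousOn F (Set.Icc (s - r) (s + r)) ∧
      (∀ x ∈ Set.Ioo (s - r) (s + r),
        HasDerivAt F (κ ^ 2 / (x * √(2 * s * x - x ^ 2 - κ ^ 2))) x) ∧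
      F (s + r) - F (s - r) = κ * Real.pi := by
  rcases hκ.eq_or_lt with h0 | h0
  · subst h0
    exact ⟨fun _ => 0, continuousOn_const, fun x _ => by simpa using hasDerivAt_const x (0 : ℝ),
      by simp⟩
  have ha : 0 < s - r := by
    have : 0 < (s - r) * (s + r) := by nlinarith
    exact pos_of_mul_pos_left this (by linarith)
  refine ⟨fun x => κ * Real.arcsin ((s * x - κ ^ 2) / (r * x)), ?_, ?_, ?_⟩
  · refine continuousOn_const.mul (Real.continuous_arcsin.comp_continuousOn ?_)
    refine ContinuousOn.div (by fun_prop) (by fun_prop) fun x hx => ?_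
    have : 0 < x := ha.trans_le hx.1
    positivity
  · intro x hx
    have hx0 : 0 < x := ha.trans hx.1
    set D := 2 * s * x - x ^ 2 - κ ^ 2 with hD
    have hDpos : 0 < D := by
      have : D = (x - (s - r)) * (s + r - x) := by rw [hD, ← hsr]; ring
      rw [this]; exact mul_pos (by linarith [hx.1]) (by linarith [hx.2])
    set y := (s * x - κ ^ 2) / (r * x) with hy
    have h1 : 1 - y ^ 2 = (κ * √D / (r * x)) ^ 2 := by
      rw [hy, div_pow, div_pow, mul_pow κ, Real.sq_sqrt hDpos.le, hD]
      field_simp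
      linear_combination -x ^ 2 * hsr
    have hpos : 0 < κ * √D / (r * x) := by
      have := Real.sqrt_pos.mpr hDpos; positivity
    have hy1 : y ≠ 1 := by intro h; rw [h] at h1; nlinarith [pow_pos hpos 2]
    have hy2 : y ≠ -1 := by intro h; rw [h] at h1; nlinarith [pow_pos hpos 2]
    have hinner : HasDerivAt (fun x => (s * x - κ ^ 2) / (r * x)) (κ ^ 2 / (r * x ^ 2)) x := by
      have := (((hasDerivAt_id x).const_mul s).sub_const (κ ^ 2)).div
        ((hasDerivAt_id x).const_mul r) (by simp only [id]; positivity)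
      refine this.congr_deriv ?_
      simp only [id]
      field_simp
      ring
    have := ((Real.hasDerivAt_arcsin hy2 hy1).comp x hinner).const_mul κ
    refine this.congr_deriv ?_
    rw [h1, Real.sqrt_sq hpos.le]
    have := Real.sqrt_pos.mpr hDpos
    field_simp
  · have hb : 0 < s + r := by linarith
    have e1 : (s * (s + r) - κ ^ 2) / (r * (s + r)) = 1 := by
      rw [div_eq_one_iff_eq (by positivity), ← hsr]; ring
    have e2 : (s * (s - r) - κ ^ 2) / (r * (s - r)) = -1 := by
      rw [div_eq_iff (by positivity), ← hsr]; ring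
    simp only [e1, e2, Real.arcsin_one, Real.arcsin_neg_one]
    ring

/-- The Marchenko–Pastur density has total mass one, up to the factor `2π`. -/
theorem integral_sqrt_mpDisc_div {c : ℝ} (hc : 1 ≤ c) :
    ∫ x in (1 - √c) ^ 2..(1 + √c) ^ 2, √(mpDisc (c - 1) x) / x = 2 * Real.pi := by
  have hc0 : 0 ≤ c := by linarith
  have hsq := Real.sq_sqrt hc0
  have hs1 : 1 ≤ √c := Real.one_le_sqrt.mpr hc
  set s := 1 + c with hs
  set r := 2 * √c with hr
  have hr0 : 0 < r := by positivity
  have hsr : s ^ 2 - r ^ 2 = (c - 1) ^ 2 := by rw [hs, hr, mul_pow, hsq]; ring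
  have hrs : r ≤ s := by rw [hs, hr]; nlinarith [sq_nonneg (√c - 1)]
  have ea : (1 - √c) ^ 2 = s - r := by rw [hs, hr]; linear_combination hsq
  have eb : (1 + √c) ^ 2 = s + r := by rw [hs, hr]; linear_combination hsq
  obtain ⟨F, hFc, hFd, hFv⟩ := exists_antideriv_inv_mul_sqrt (by linarith : 0 ≤ c - 1) hr0 hrs hsr
  have eD : ∀ x, mpDisc (c - 1) x = 2 * s * x - x ^ 2 - (c - 1) ^ 2 := fun x => by
    unfold mpDisc; rw [hs]; ring
  have eD2 : ∀ x, 2 * s * x - x ^ 2 - (c - 1) ^ 2 = r ^ 2 - (x - s) ^ 2 := fun x => by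
    rw [← hsr]; ring
  rw [ea, eb]
  simp only [eD]
  set D : ℝ → ℝ := fun x => 2 * s * x - x ^ 2 - (c - 1) ^ 2 with hD
  set G : ℝ → ℝ := fun x => √(D x) + s * Real.arcsin ((x - s) / r) - F x with hG
  have hGc : ContinuousOn G (Set.Icc (s - r) (s + r)) := by
    refine ContinuousOn.sub (Continuous.continuousOn ?_) hFc
    have : Continuous D := by rw [hD]; fun_prop
    exact this.sqrt.add (continuous_const.mul (Real.continuous_arcsin.comp (by fun_prop)))
  have hGd : ∀ x ∈ Set.Ioo (s - r) (s + r), HasDerivAt G (√(D x) / x) x := by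
    intro x hx
    have hx0 : 0 < x := lt_of_le_of_lt (by linarith) hx.1
    have hDpos : 0 < D x := by
      have : D x = (x - (s - r)) * (s + r - x) := by simp only [hD]; rw [eD2]; ring
      rw [this]; exact mul_pos (by linarith [hx.1]) (by linarith [hx.2])
    have hsD := Real.sqrt_pos.mpr hDpos
    have h1 : 1 - ((x - s) / r) ^ 2 = (√(D x) / r) ^ 2 := by
      rw [div_pow, div_pow, Real.sq_sqrt hDpos.le]
      simp only [hD]
      rw [eD2]
      field_simp
    have hpos : 0 < √(D x) / r := by positivity
    have hy1 : (x - s) / r ≠ 1 := by intro h; rw [h] at h1; nlinarith [pow_pos hpos 2]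
    have hy2 : (x - s) / r ≠ -1 := by intro h; rw [h] at h1; nlinarith [pow_pos hpos 2]
    have d1 : HasDerivAt D (2 * s - 2 * x) x := by
      have := (((hasDerivAt_id x).const_mul (2 * s)).sub (hasDerivAt_pow 2 x)).sub_const
        ((c - 1) ^ 2)
      refine this.congr_deriv ?_
      simp
    have d2 := d1.sqrt hDpos.ne'
    have d3 := ((Real.hasDerivAt_arcsin hy2 hy1).comp x
      (((hasDerivAt_id x).sub_const s).div_const r)).const_mul s
    have := (d2.add d3).sub (hFd x hx)
    refine this.congr_deriv ?_
    rw [h1, Real.sqrt_sq hpos.le]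
    have e := Real.sq_sqrt hDpos.le
    have e' : √(D x) ^ 2 = 2 * s * x - x ^ 2 - (c - 1) ^ 2 := e
    change (2 * s - 2 * x) / (2 * √(D x)) + s * (1 / (√(D x) / r) * (1 / r)) -
      (c - 1) ^ 2 / (x * √(D x)) = √(D x) / x
    field_simp
    rw [e']
    ring
  have hint : IntervalIntegrable (fun x => √(D x) / x) volume (s - r) (s + r) := by
    refine intervalIntegral.intervalIntegrable_deriv_of_nonneg (g := G) ?_ ?_ ?_
    · rwa [Set.uIcc_of_le (by linarith)]
    · rwa [min_eq_left (by linarith), max_eq_right (by linarith)]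
    · rw [min_eq_left (by linarith), max_eq_right (by linarith)]
      intro x hx
      have hx0 : 0 < x := lt_of_le_of_lt (by linarith) hx.1
      positivity
  rw [intervalIntegral.integral_eq_sub_of_hasDerivAt_of_le (by linarith) hGc hGd hint]
  have z1 : D (s + r) = 0 := by simp only [hD]; rw [eD2]; ring
  have z2 : D (s - r) = 0 := by simp only [hD]; rw [eD2]; ring
  simp only [hG, z1, z2, Real.sqrt_zero, add_sub_cancel_left, div_self hr0.ne', Real.arcsin_one]
  have e2 : (s - r - s) / r = -1 := by field_simp; ring
  rw [e2, Real.arcsin_neg_one]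
  rw [hs]
  linear_combination -hFv

theorem mpLaw_real_univ {c : ℝ} (hc : 1 ≤ c) : (mpLaw c).real Set.univ = 1 := by
  have hc0 : 0 ≤ c := by linarith
  have hab : (1 - √c) ^ 2 ≤ (1 + √c) ^ 2 := by nlinarith [Real.sqrt_nonneg c]
  have h1 : ∫ x in Set.univ, mpDensity c x
      = ∫ x in Set.Icc ((1 - √c) ^ 2) ((1 + √c) ^ 2), mpDensity c x := by
    refine setIntegral_eq_of_subset_of_forall_sdiff_eq_zero MeasurableSet.univ
      (Set.subset_univ _) fun y hy => ?_
    rw [mpDensity, if_neg]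
    exact hy.2
  rw [mpLaw_real_eq hc MeasurableSet.univ, h1, integral_Icc_eq_integral_Ioc,
    ← intervalIntegral.integral_of_le hab]
  have : ∀ x, mpDensity c x = (2 * Real.pi)⁻¹ * (√(mpDisc (c - 1) x) / x) := fun x => by
    rw [mpDensity_eq hc0, div_mul_eq_div_div_swap, div_eq_inv_mul]
  simp only [this]
  rw [intervalIntegral.integral_const_mul, integral_sqrt_mpDisc_div hc,
    inv_mul_cancel₀ (by positivity)]

theorem mpCDF_of_ge {c : ℝ} (hc : 1 ≤ c) {x : ℝ} (hx : (1 + √c) ^ 2 ≤ x) : mpCDF c x = 1 := by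
  rw [← mpLaw_real_univ hc, mpCDF, mpLaw_real_eq hc measurableSet_Iic,
    mpLaw_real_eq hc MeasurableSet.univ]
  symm
  refine setIntegral_eq_of_subset_of_forall_sdiff_eq_zero MeasurableSet.univ
    (Set.subset_univ _) fun y hy => ?_
  rw [mpDensity, if_neg]
  intro h
  exact hy.2 (h.2.trans hx)

theorem sqrt_mpDisc_div_le {κ u : ℝ} (hκ : 0 ≤ κ) (hu : 0 < u) :
    √(mpDisc κ (u ^ 2)) / (2 * u) ≤ κ + 2 := by
  rw [div_le_iff₀ (by positivity)]
  refine Real.sqrt_le_iff.mpr ⟨by positivity, ?_⟩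
  unfold mpDisc
  nlinarith [sq_nonneg (u ^ 2), sq_nonneg κ, mul_nonneg (sq_nonneg u) hκ, sq_nonneg (κ * u)]

theorem intervalIntegrable_sqrt_mpDisc {κ x y : ℝ} (hκ : 0 ≤ κ) (hx : 0 ≤ x) (hy : 0 ≤ y) :
    IntervalIntegrable (fun u => √(mpDisc κ (u ^ 2)) / (2 * u)) volume x y := by
  rw [intervalIntegrable_iff]
  refine Measure.integrableOn_of_bounded (M := κ + 2) (by simp) ?_ ?_
  · refine Measurable.aestronglyMeasurable ?_
    unfold mpDisc
    fun_prop
  · refine (ae_restrict_iff' measurableSet_uIoc).mpr (Eventually.of_forall fun u hu => ?_)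
    have hu0 : 0 < u := lt_of_le_of_lt (le_min hx hy) hu.1
    rw [Real.norm_of_nonneg (by positivity)]
    exact sqrt_mpDisc_div_le hκ hu0

theorem mpCDF_sq_sub_le {c x y : ℝ} (hc : 1 ≤ c) (hx : 0 ≤ x) (hxy : x ≤ y) :
    mpCDF c (y ^ 2) - mpCDF c (x ^ 2) ≤ (c + 1) * (y - x) := by
  have hκ : 0 ≤ c - 1 := by linarith
  have hi : ∀ a b : ℝ, 0 ≤ a → 0 ≤ b → IntervalIntegrable
      (fun u => 2 / Real.pi * (√(mpDisc (c - 1) (u ^ 2)) / (2 * u))) volume a b := fun a b ha hb =>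
    (intervalIntegrable_sqrt_mpDisc hκ ha hb).const_mul _
  rw [mpCDF_sq hc hx, mpCDF_sq hc (hx.trans hxy),
    intervalIntegral.integral_interval_sub_left (hi 0 y le_rfl (hx.trans hxy)) (hi 0 x le_rfl hx)]
  have h2 : 2 / Real.pi ≤ 1 := by
    rw [div_le_one Real.pi_pos]; exact Real.two_le_pi
  have h3 : 0 ≤ 2 / Real.pi := by positivity
  calc _ ≤ ∫ _u in x..y, (c + 1) := by
        refine intervalIntegral.integral_mono_on_of_le_Ioo hxy (hi x y hx (hx.trans hxy))
          (by simp) fun u hu => ?_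
        have hu0 : 0 < u := hx.trans_lt hu.1
        have := sqrt_mpDisc_div_le hκ hu0
        have h4 : 0 ≤ √(mpDisc (c - 1) (u ^ 2)) / (2 * u) := by positivity
        nlinarith
    _ = _ := by rw [intervalIntegral.integral_const, smul_eq_mul, mul_comm]

end Law

/-! ### The Stieltjes transform and the empirical spectral distribution -/

section Spectral

open Matrix Complex

variable {n N : ℕ}

theorem gram_eigenvalues_nonneg (a : Matrix (Fin n) (Fin N) ℝ) (i : Fin n) :
    0 ≤ (gram_isHermitian a).eigenvalues i := by
  have h := (posSemidef_self_mul_conjTranspose a).smul (by positivity : (0 : ℝ) ≤ 1 / (n : ℝ))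
  rw [conjTranspose_eq_transpose_of_trivial] at h
  exact PosSemidef.eigenvalues_nonneg h i

/-- The normalized traces of the resolvents of `AᵀA/n` and `AAᵀ/n` differ by an explicit term, as
the two matrices share their nonzero eigenvalues; the latter trace is a sum over eigenvalues. -/
theorem trace_sqRes_cov_eq_sum (hn : 0 < n) (a : Matrix (Fin n) (Fin N) ℝ) {w : ℂ}
    (hw : 0 < w.im) :
    w ^ 2 * (sqRes (cov a) w).trace
      = n - N + w ^ 2 * ∑ i, (((gram_isHermitian a).eigenvalues i : ℂ) - w ^ 2)⁻¹ := by
  have hw0 : w ≠ 0 := by rintro rfl; simp at hw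
  have hn' : (n : ℂ) ≠ 0 := by exact_mod_cast hn.ne'
  set H := gram_isHermitian a
  set U : Matrix (Fin n) (Fin n) ℂ :=
    (H.eigenvectorUnitary : Matrix (Fin n) (Fin n) ℝ).map Complex.ofRealHom with hU
  set U' : Matrix (Fin n) (Fin n) ℂ :=
    (star (H.eigenvectorUnitary : Matrix (Fin n) (Fin n) ℝ)).map Complex.ofRealHom with hU'
  have hUU : U * U' = 1 := by
    rw [hU, hU', ← Matrix.map_mul, ← Unitary.coe_star, Unitary.coe_mul_star_self]
    simp
  have hUU' : U' * U = 1 := by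
    rw [hU, hU', ← Matrix.map_mul, Unitary.coe_star_mul_self]
    simp
  have hspec : (gram a).map Complex.ofRealHom
      = U * diagonal (fun i => (H.eigenvalues i : ℂ)) * U' := by
    conv_lhs => rw [H.spectral_theorem, Unitary.conjStarAlgAut_apply]
    rw [Matrix.map_mul, Matrix.map_mul, Matrix.diagonal_map (by simp)]
    rfl
  have hne : ∀ i, (H.eigenvalues i : ℂ) - w ^ 2 ≠ 0 := by
    intro i h
    have := norm_sub_sq_mul_ge w hw.le (gram_eigenvalues_nonneg a i) (t := 1)
    rw [Complex.ofReal_one, mul_one, mul_one, h, norm_zero] at this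
    have hwn : 0 < ‖w‖ := norm_pos_iff.mpr hw0
    nlinarith [mul_pos hw hwn]
  set aC := a.map Complex.ofRealHom with haC
  set t : ℂ := 1 / n with ht
  set R := U * diagonal (fun i => ((H.eigenvalues i : ℂ) - w ^ 2)⁻¹) * U' with hR
  have hgram : (gram a).map Complex.ofRealHom = t • (aC * aCᵀ) := by
    ext i j
    simp [gram, haC, ht, Matrix.mul_apply]
  have hcov : cov a = t • (aCᵀ * aC) := by
    ext i j
    simp [cov, haC, ht, Matrix.mul_apply]
  have hMR : (t • (aC * aCᵀ)) * R = 1 + w ^ 2 • R := by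
    have e1 : diagonal (fun i => (H.eigenvalues i : ℂ))
        * diagonal (fun i => ((H.eigenvalues i : ℂ) - w ^ 2)⁻¹)
        = 1 + w ^ 2 • diagonal (fun i => ((H.eigenvalues i : ℂ) - w ^ 2)⁻¹) := by
      rw [diagonal_mul_diagonal, ← diagonal_one, ← diagonal_smul, diagonal_add]
      congr 1
      funext i
      have := hne i
      simp only [Pi.smul_apply, smul_eq_mul]
      field_simp
      ring
    rw [← hgram, hspec, hR]
    calc _ = U * diagonal (fun i => (H.eigenvalues i : ℂ)) * (U' * U)
          * diagonal (fun i => ((H.eigenvalues i : ℂ) - w ^ 2)⁻¹) * U' := by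
            simp only [Matrix.mul_assoc]
      _ = U * (diagonal (fun i => (H.eigenvalues i : ℂ))
          * diagonal (fun i => ((H.eigenvalues i : ℂ) - w ^ 2)⁻¹)) * U' := by
            rw [hUU', Matrix.mul_one]; simp only [Matrix.mul_assoc]
      _ = _ := by
            rw [e1, Matrix.mul_add, Matrix.add_mul, Matrix.mul_one, hUU, Matrix.mul_smul,
              Matrix.smul_mul]
  have htrR : R.trace = ∑ i, ((H.eigenvalues i : ℂ) - w ^ 2)⁻¹ := by
    rw [hR, Matrix.trace_mul_comm, ← Matrix.mul_assoc, hUU', Matrix.one_mul, trace_diagonal]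
  set S : Matrix (Fin N) (Fin N) ℂ := t • (aCᵀ * R * aC) - 1 with hS
  have hG : (cov a - w ^ 2 • 1) * S = w ^ 2 • 1 := by
    have e2 : (t • (aCᵀ * aC)) * (t • (aCᵀ * R * aC)) = t • (aCᵀ * (1 + w ^ 2 • R) * aC) := by
      rw [← hMR]
      simp only [Matrix.smul_mul, Matrix.mul_smul, Matrix.mul_assoc]
    rw [hcov, hS, Matrix.mul_sub, Matrix.mul_one, Matrix.sub_mul, e2, Matrix.smul_mul,
      Matrix.one_mul, Matrix.mul_add, Matrix.add_mul, Matrix.mul_one, Matrix.mul_smul,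
      Matrix.smul_mul, smul_add, smul_comm t]
    abel
  have hS2 : w ^ 2 • sqRes (cov a) w = S := by
    have := congrArg (sqRes (cov a) w * ·) hG
    simp only [← Matrix.mul_assoc, sqRes_mul (cov_posSemidef a) hw, Matrix.one_mul,
      Matrix.mul_smul, Matrix.mul_one] at this
    exact this.symm
  have htr : (t • (aCᵀ * R * aC)).trace = n + w ^ 2 * R.trace := by
    have e3 : (t • (aCᵀ * R * aC)).trace = ((t • (aC * aCᵀ)) * R).trace := by
      rw [Matrix.mul_assoc, trace_smul, Matrix.trace_mul_comm, smul_mul, trace_smul,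
        Matrix.mul_assoc, Matrix.trace_mul_comm]
    rw [e3, hMR, trace_add, trace_one, trace_smul, Fintype.card_fin, smul_eq_mul]
  have := congrArg Matrix.trace hS2
  rw [trace_smul, smul_eq_mul, hS, trace_sub, htr, trace_one, Fintype.card_fin] at this
  rw [this, htrR]
  ring

/-- The two Poisson kernels produced by the substitution `z = w²`. -/
theorem im_mul_inv_sq_sub (y u : ℝ) {V : ℝ} (hV : 0 < V) :
    (((u : ℂ) + V * I) * ((y : ℂ) ^ 2 - ((u : ℂ) + V * I) ^ 2)⁻¹).im
      = (V / (V ^ 2 + (u - y) ^ 2) + V / (V ^ 2 + (u + y) ^ 2)) / 2 := by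
  have key : ∀ s : ℝ, ((s : ℂ) - V * I)⁻¹.im = V / (V ^ 2 + s ^ 2) := by
    intro s
    rw [Complex.inv_im, Complex.normSq_apply]
    simp
    ring
  have key2 : ∀ s : ℝ, ((s : ℂ) + V * I)⁻¹.im = - (V / (V ^ 2 + s ^ 2)) := by
    intro s
    rw [Complex.inv_im, Complex.normSq_apply]
    simp
    ring
  set w : ℂ := (u : ℂ) + V * I with hw
  have h1 : (y : ℂ) - w ≠ 0 := by
    intro h; have := congrArg Complex.im h; simp [hw] at this; exact hV.ne' this
  have h2 : (y : ℂ) + w ≠ 0 := by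
    intro h; have := congrArg Complex.im h; simp [hw] at this; exact hV.ne' this
  have h3 : (y : ℂ) ^ 2 - w ^ 2 ≠ 0 := by
    rw [sq_sub_sq]; exact mul_ne_zero h2 h1
  have e : w * ((y : ℂ) ^ 2 - w ^ 2)⁻¹
      = ((((1 / 2 : ℝ) : ℂ))) * (((y - u : ℝ) - V * I : ℂ)⁻¹ - ((y + u : ℝ) + V * I : ℂ)⁻¹) := by
    have e1 : ((y - u : ℝ) - V * I : ℂ) = y - w := by rw [hw]; push_cast; ring
    have e2 : ((y + u : ℝ) + V * I : ℂ) = y + w := by rw [hw]; push_cast; ring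
    rw [e1, e2]
    push_cast
    field_simp
    ring
  rw [e, Complex.im_ofReal_mul, Complex.sub_im, key, key2]
  rw [show (y - u) ^ 2 = (u - y) ^ 2 by ring, show (y + u) ^ 2 = (u + y) ^ 2 by ring]
  ring

end Spectral

section Kernel

/-- The integral over `[0, x]` of the symmetrized Poisson kernel of width `V` at `y`. It smooths
the indicator function of `y ≤ x`. -/
noncomputable def cauchyStep (V x y : ℝ) : ℝ :=
  (Real.arctan ((x - y) / V) + Real.arctan ((x + y) / V)) / Real.pi

theorem integral_poisson {V : ℝ} (hV : 0 < V) (x y : ℝ) :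
    ∫ u in (0 : ℝ)..x, (V / (V ^ 2 + (u - y) ^ 2) + V / (V ^ 2 + (u + y) ^ 2)) / 2
      = Real.pi / 2 * cauchyStep V x y := by
  have hd : ∀ u ∈ Set.uIcc 0 x, HasDerivAt
      (fun u => (Real.arctan ((u - y) / V) + Real.arctan ((u + y) / V)) / 2)
      ((V / (V ^ 2 + (u - y) ^ 2) + V / (V ^ 2 + (u + y) ^ 2)) / 2) u := by
    intro u _
    have h1 := (((hasDerivAt_id u).sub_const y).div_const V).arctan
    have h2 := (((hasDerivAt_id u).add_const y).div_const V).arctan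
    refine ((h1.add h2).div_const 2).congr_deriv ?_
    simp only [id]
    field_simp
  rw [intervalIntegral.integral_eq_sub_of_hasDerivAt hd]
  · have : (0 - y) / V = - ((0 + y) / V) := by ring
    rw [this, Real.arctan_neg, cauchyStep]
    field_simp
    ring
  · apply Continuous.intervalIntegrable
    have h1 : ∀ u : ℝ, V ^ 2 + (u - y) ^ 2 ≠ 0 := fun u => by positivity
    have h2 : ∀ u : ℝ, V ^ 2 + (u + y) ^ 2 ≠ 0 := fun u => by positivity
    fun_prop (disch := first | exact h1 _ | exact h2 _)

theorem pi_div_two_sub_le_arctan {t : ℝ} (ht : 0 < t) : Real.pi / 2 - t⁻¹ ≤ Real.arctan t := by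
  have h1 := Real.arctan_inv_of_pos ht
  have h2 : Real.arctan t⁻¹ ≤ t⁻¹ := by
    have h0 : 0 ≤ Real.arctan t⁻¹ := Real.arctan_nonneg.mpr (by positivity)
    have := Real.le_tan h0 (Real.arctan_lt_pi_div_two _)
    rwa [Real.tan_arctan] at this
  linarith

theorem cauchyStep_nonneg {V x y : ℝ} (hV : 0 < V) (hx : 0 ≤ x) : 0 ≤ cauchyStep V x y := by
  refine div_nonneg ?_ Real.pi_pos.le
  have h : Real.arctan (-((x - y) / V)) ≤ Real.arctan ((x + y) / V) := by
    apply Real.arctan_le_arctan_iff.mpr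
    rw [← neg_div]
    gcongr
    linarith
  rw [Real.arctan_neg] at h
  linarith

theorem cauchyStep_le_one (V x y : ℝ) : cauchyStep V x y ≤ 1 := by
  rw [cauchyStep, div_le_one Real.pi_pos]
  have h1 := Real.arctan_lt_pi_div_two ((x - y) / V)
  have h2 := Real.arctan_lt_pi_div_two ((x + y) / V)
  linarith

theorem cauchyStep_le {V L x y : ℝ} (hV : 0 < V) (hL : 0 < L) (hxy : x + L ≤ y) :
    cauchyStep V x y ≤ V / L := by
  have h1 := Real.arctan_lt_pi_div_two ((x + y) / V)
  have h2 : Real.pi / 2 - V / L ≤ Real.arctan ((y - x) / V) := by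
    refine le_trans ?_ (Real.arctan_le_arctan_iff.mpr
      (show L / V ≤ (y - x) / V by gcongr; linarith))
    have := pi_div_two_sub_le_arctan (div_pos hL hV)
    rwa [inv_div] at this
  have h3 : Real.arctan ((x - y) / V) = - Real.arctan ((y - x) / V) := by
    rw [← Real.arctan_neg]; congr 1; ring
  rw [cauchyStep, h3, div_le_iff₀ Real.pi_pos]
  have h4 : 0 < V / L := by positivity
  nlinarith [Real.pi_gt_three]

theorem le_cauchyStep {V L x y : ℝ} (hV : 0 < V) (hL : 0 < L) (hy : 0 ≤ y) (hxy : y + L ≤ x) :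
    1 - V / L ≤ cauchyStep V x y := by
  have key : ∀ s, L ≤ s → Real.pi / 2 - V / L ≤ Real.arctan (s / V) := fun s hs => by
    refine le_trans ?_ (Real.arctan_le_arctan_iff.mpr (show L / V ≤ s / V by gcongr))
    have := pi_div_two_sub_le_arctan (div_pos hL hV)
    rwa [inv_div] at this
  have h1 := key (x - y) (by linarith)
  have h2 := key (x + y) (by linarith)
  rw [cauchyStep, le_div_iff₀ Real.pi_pos]
  have h4 : 0 < V / L := by positivity
  nlinarith [Real.pi_gt_three]

end Kernel

section Smoothing

variable {n N : ℕ}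

/-- The imaginary part of `w s(w²)`, at `w = u + V i`, for the Stieltjes transform `s` of the
spectral distribution of `AAᵀ/n`, written in terms of the resolvent of `AᵀA/n`. -/
noncomputable def stieltjesIm (V : ℝ) (a : Matrix (Fin n) (Fin N) ℝ) (u : ℝ) : ℝ :=
  (((u : ℂ) + V * Complex.I) * ((sqRes (cov a) (u + V * Complex.I)).trace / n)
    + (((N : ℝ) / n - 1 : ℝ) : ℂ) / (u + V * Complex.I)).im

/-- The spectral distribution of `AAᵀ/n` in the variable `√λ`, smoothed at scale `V`. -/
noncomputable def smoothESD (V : ℝ) (a : Matrix (Fin n) (Fin N) ℝ) (x : ℝ) : ℝ :=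
  (∑ i, cauchyStep V x (√((gram_isHermitian a).eigenvalues i))) / n

theorem stieltjes_eq_sum (hn : 0 < n) (a : Matrix (Fin n) (Fin N) ℝ) {w : ℂ} (hw : 0 < w.im) :
    w * ((sqRes (cov a) w).trace / n) + (((N : ℝ) / n - 1 : ℝ) : ℂ) / w
      = ((1 / n : ℝ) : ℂ) * ∑ i, w * (((√((gram_isHermitian a).eigenvalues i) : ℝ) : ℂ) ^ 2
          - w ^ 2)⁻¹ := by
  have hw0 : w ≠ 0 := by rintro rfl; simp at hw
  have hn' : (n : ℂ) ≠ 0 := by exact_mod_cast hn.ne'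
  have h := trace_sqRes_cov_eq_sum hn a hw
  have e : ∀ i, ((√((gram_isHermitian a).eigenvalues i) : ℝ) : ℂ) ^ 2
      = ((gram_isHermitian a).eigenvalues i : ℂ) := fun i => by
    rw [← Complex.ofReal_pow, Real.sq_sqrt (gram_eigenvalues_nonneg a i)]
  simp only [e]
  rw [← Finset.mul_sum]
  push_cast
  have e2 : w * (w * ((sqRes (cov a) w).trace / n) + ((N : ℂ) / n - 1) / w)
      = w * (1 / n * (w * ∑ i, (((gram_isHermitian a).eigenvalues i : ℂ) - w ^ 2)⁻¹)) := by
    have e3 : w * (w * ((sqRes (cov a) w).trace / n) + ((N : ℂ) / n - 1) / w)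
        = (w ^ 2 * (sqRes (cov a) w).trace + N - n) / n := by
      field_simp
      ring
    rw [e3, h]
    ring
  exact mul_left_cancel₀ hw0 e2

theorem stieltjesIm_eq_sum (hn : 0 < n) (a : Matrix (Fin n) (Fin N) ℝ) {V : ℝ} (hV : 0 < V)
    (u : ℝ) : stieltjesIm V a u = (1 / n : ℝ) *
      ∑ i, (V / (V ^ 2 + (u - √((gram_isHermitian a).eigenvalues i)) ^ 2)
        + V / (V ^ 2 + (u + √((gram_isHermitian a).eigenvalues i)) ^ 2)) / 2 := by
  rw [stieltjesIm, stieltjes_eq_sum hn a (by simpa using hV), Complex.im_ofReal_mul,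
    Complex.im_sum]
  congr 1
  exact Finset.sum_congr rfl fun i _ => im_mul_inv_sq_sub _ u hV

theorem stieltjesIm_nonneg (hn : 0 < n) (a : Matrix (Fin n) (Fin N) ℝ) {V : ℝ} (hV : 0 < V)
    (u : ℝ) : 0 ≤ stieltjesIm V a u := by
  rw [stieltjesIm_eq_sum hn a hV]
  positivity

theorem integral_stieltjesIm (hn : 0 < n) (a : Matrix (Fin n) (Fin N) ℝ) {V : ℝ} (hV : 0 < V)
    (x : ℝ) : ∫ u in (0 : ℝ)..x, stieltjesIm V a u = Real.pi / 2 * smoothESD V a x := by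
  simp only [stieltjesIm_eq_sum hn a hV]
  rw [intervalIntegral.integral_const_mul, intervalIntegral.integral_finsetSum]
  · simp only [integral_poisson hV]
    rw [← Finset.mul_sum, smoothESD]
    ring
  · intro i _
    apply Continuous.intervalIntegrable
    set y := √((gram_isHermitian a).eigenvalues i)
    have h1 : ∀ u : ℝ, V ^ 2 + (u - y) ^ 2 ≠ 0 := fun u => by positivity
    have h2 : ∀ u : ℝ, V ^ 2 + (u + y) ^ 2 ≠ 0 := fun u => by positivity
    fun_prop (disch := first | exact h1 _ | exact h2 _)

theorem abs_stieltjesIm_le (hn : 0 < n) (a : Matrix (Fin n) (Fin N) ℝ) {V : ℝ} (hV : 0 < V)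
    (u : ℝ) : |stieltjesIm V a u| ≤ 1 / V := by
  have hn' : (0 : ℝ) < n := by exact_mod_cast hn
  rw [abs_of_nonneg (stieltjesIm_nonneg hn a hV u), stieltjesIm_eq_sum hn a hV]
  have key : ∀ s : ℝ, V / (V ^ 2 + s ^ 2) ≤ 1 / V := fun s => by
    rw [div_le_div_iff₀ (by positivity) hV]; nlinarith [sq_nonneg s]
  calc _ ≤ (1 / n : ℝ) * ∑ _i : Fin n, 1 / V := by
        refine mul_le_mul_of_nonneg_left (Finset.sum_le_sum fun i _ => ?_) (by positivity)
        have h1 := key (u - √((gram_isHermitian a).eigenvalues i))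
        have h2 := key (u + √((gram_isHermitian a).eigenvalues i))
        linarith
    _ = 1 / V := by
        rw [Finset.sum_const, Finset.card_univ, Fintype.card_fin, nsmul_eq_mul]
        field_simp

theorem smoothESD_nonneg (a : Matrix (Fin n) (Fin N) ℝ) {V x : ℝ} (hV : 0 < V) (hx : 0 ≤ x) :
    0 ≤ smoothESD V a x :=
  div_nonneg (Finset.sum_nonneg fun _ _ => cauchyStep_nonneg hV hx) (Nat.cast_nonneg n)

theorem esd_sq_eq (a : Matrix (Fin n) (Fin N) ℝ) {t : ℝ} (ht : 0 ≤ t) :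
    esd (gram_isHermitian a) (t ^ 2)
      = (∑ i, if √((gram_isHermitian a).eigenvalues i) ≤ t then (1 : ℝ) else 0) / n := by
  rw [esd, Finset.sum_boole]
  congr 3
  ext i
  rw [Finset.mem_filter, Finset.mem_filter, Real.sqrt_le_left ht]

theorem esd_nonneg (a : Matrix (Fin n) (Fin N) ℝ) (x : ℝ) : 0 ≤ esd (gram_isHermitian a) x := by
  unfold esd; positivity

theorem esd_le_one (a : Matrix (Fin n) (Fin N) ℝ) (x : ℝ) : esd (gram_isHermitian a) x ≤ 1 := by
  unfold esd
  refine div_le_one_of_le₀ ?_ (Nat.cast_nonneg n)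
  have := Finset.card_filter_le (Finset.univ : Finset (Fin n))
    fun i => (gram_isHermitian a).eigenvalues i ≤ x
  rw [Finset.card_univ, Fintype.card_fin] at this
  exact_mod_cast this

theorem esd_of_neg (a : Matrix (Fin n) (Fin N) ℝ) {x : ℝ} (hx : x < 0) :
    esd (gram_isHermitian a) x = 0 := by
  rw [esd, Finset.filter_false_of_mem, Finset.card_empty, Nat.cast_zero, zero_div]
  intro i _
  exact not_le.mpr (hx.trans_le (gram_eigenvalues_nonneg a i))

/-- The empirical spectral distribution is at most its smoothing at scale `V`, evaluated at a point
shifted by `L`, up to the mass `V / L` that the Poisson kernel puts beyond distance `L`. -/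
theorem esd_sq_le_smoothESD (hn : 0 < n) (a : Matrix (Fin n) (Fin N) ℝ) {V L t : ℝ} (hV : 0 < V)
    (hL : 0 < L) (ht : 0 ≤ t) :
    esd (gram_isHermitian a) (t ^ 2) ≤ smoothESD V a (t + L) + V / L := by
  have hn' : (0 : ℝ) < n := by exact_mod_cast hn
  rw [esd_sq_eq a ht, smoothESD, div_add' _ _ _ hn'.ne']
  gcongr
  calc _ ≤ ∑ i, (cauchyStep V (t + L) (√((gram_isHermitian a).eigenvalues i)) + V / L) := by
        refine Finset.sum_le_sum fun i _ => ?_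
        split_ifs with h
        · have := le_cauchyStep hV hL (Real.sqrt_nonneg _) (add_le_add_left h L)
          linarith
        · have := cauchyStep_nonneg (V := V) (y := √((gram_isHermitian a).eigenvalues i)) hV
            (by linarith : 0 ≤ t + L)
          positivity
    _ = _ := by
        rw [Finset.sum_add_distrib, Finset.sum_const, Finset.card_univ, Fintype.card_fin,
          nsmul_eq_mul, mul_comm (n : ℝ)]

theorem smoothESD_le_esd_sq (hn : 0 < n) (a : Matrix (Fin n) (Fin N) ℝ) {V L t : ℝ} (hV : 0 < V)
    (hL : 0 < L) (ht : 0 ≤ t) :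
    smoothESD V a t ≤ esd (gram_isHermitian a) ((t + L) ^ 2) + V / L := by
  have hn' : (0 : ℝ) < n := by exact_mod_cast hn
  rw [esd_sq_eq a (by linarith), smoothESD, div_add' _ _ _ hn'.ne']
  gcongr
  calc _ ≤ ∑ i, ((if √((gram_isHermitian a).eigenvalues i) ≤ t + L then (1 : ℝ) else 0)
          + V / L) := by
        refine Finset.sum_le_sum fun i _ => ?_
        split_ifs with h
        · have := cauchyStep_le_one V t (√((gram_isHermitian a).eigenvalues i))
          have : 0 < V / L := by positivity
          linarith
        · rw [zero_add]
          exact cauchyStep_le hV hL (not_le.mp h).le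
    _ = _ := by
        rw [Finset.sum_add_distrib, Finset.sum_const, Finset.card_univ, Fintype.card_fin,
          nsmul_eq_mul, mul_comm (n : ℝ)]

end Smoothing

section Expectation

variable {Ω : Type*} {m0 : MeasurableSpace Ω} {P : Measure Ω} {n N : ℕ}
  {A : Ω → Matrix (Fin n) (Fin N) ℝ}

theorem measurable_stieltjesIm (hA : ∀ i j, Measurable fun ω => A ω i j) (V : ℝ) :
    Measurable fun p : Ω × ℝ => stieltjesIm V (A p.1) p.2 := by
  have hw : Measurable fun p : Ω × ℝ => (p.2 : ℂ) + V * Complex.I :=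
    (Complex.measurable_ofReal.comp measurable_snd).add_const _
  have h := measurable_trace_sqRes (a := fun p : Ω × ℝ => A p.1)
    (fun i j => (hA i j).comp measurable_fst) hw
  unfold stieltjesIm
  exact Complex.measurable_im.comp
    ((hw.mul (h.div_const _)).add (measurable_const.div hw))

theorem measurable_smoothESD (hn : 0 < n) (hA : ∀ i j, Measurable fun ω => A ω i j) {V x : ℝ}
    (hV : 0 < V) (hx : 0 ≤ x) : Measurable fun ω => smoothESD V (A ω) x := by
  have h1 : Measurable fun ω => ∫ u in (0 : ℝ)..x, stieltjesIm V (A ω) u := by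
    simp only [intervalIntegral.integral_of_le hx]
    exact (measurable_stieltjesIm hA V).stronglyMeasurable.integral_prod_right'.measurable
  have h2 : (fun ω => smoothESD V (A ω) x)
      = fun ω => (Real.pi / 2)⁻¹ * ∫ u in (0 : ℝ)..x, stieltjesIm V (A ω) u := by
    funext ω
    rw [integral_stieltjesIm hn _ hV, inv_mul_cancel_left₀ (by positivity)]
  rw [h2]
  exact h1.const_mul _

theorem smoothESD_le_one (hn : 0 < n) (a : Matrix (Fin n) (Fin N) ℝ) (V x : ℝ) :
    smoothESD V a x ≤ 1 := by
  have hn' : (0 : ℝ) < n := by exact_mod_cast hn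
  rw [smoothESD, div_le_one hn']
  refine (Finset.sum_le_sum fun _ _ => cauchyStep_le_one V x _).trans ?_
  simp

theorem integrable_smoothESD [IsProbabilityMeasure P] (hn : 0 < n)
    (hA : ∀ i j, Measurable fun ω => A ω i j) {V x : ℝ}
    (hV : 0 < V) (hx : 0 ≤ x) : Integrable (fun ω => smoothESD V (A ω) x) P := by
  refine Integrable.of_bound (measurable_smoothESD hn hA hV hx).aestronglyMeasurable 1
    (Eventually.of_forall fun ω => ?_)
  rw [Real.norm_of_nonneg (smoothESD_nonneg _ hV hx)]
  exact smoothESD_le_one hn _ V x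

/-- The empirical spectral distribution is the limit of its smoothings, evaluated slightly to the
right of the point, at a scale that shrinks faster than the shift. -/
theorem measurable_esd (hn : 0 < n) (hA : ∀ i j, Measurable fun ω => A ω i j) (x : ℝ) :
    Measurable fun ω => esd (gram_isHermitian (A ω)) x := by
  rcases lt_or_ge x 0 with hx | hx
  · simp only [esd_of_neg _ hx, measurable_const]
  obtain ⟨t, ht, rfl⟩ : ∃ t, 0 ≤ t ∧ x = t ^ 2 := ⟨√x, Real.sqrt_nonneg x, (Real.sq_sqrt hx).symm⟩
  set L : ℕ → ℝ := fun m => 1 / ((m : ℝ) + 1) with hLdef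
  have hL : ∀ m, 0 < L m := fun m => by simp only [hLdef]; positivity
  have hL0 : Tendsto L atTop (𝓝 0) := tendsto_one_div_add_atTop_nhds_zero_nat
  have hVL : ∀ m, L m ^ 2 / L m = L m := fun m => by
    rw [pow_two, mul_div_assoc, div_self (hL m).ne', mul_one]
  refine measurable_of_tendsto_metrizable (f := fun m ω => smoothESD (L m ^ 2) (A ω) (t + L m))
    (fun m => measurable_smoothESD hn hA (pow_pos (hL m) 2) (by linarith [hL m]))
    (tendsto_pi_nhds.mpr fun ω => ?_)
  have hev : ∀ᶠ m in atTop, esd (gram_isHermitian (A ω)) ((t + L m + L m) ^ 2)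
      = esd (gram_isHermitian (A ω)) (t ^ 2) := by
    have h2L : Tendsto (fun m => t + L m + L m) atTop (𝓝 t) := by
      simpa using (hL0.const_add t).add hL0
    have : ∀ᶠ m in atTop, ∀ i, t < √((gram_isHermitian (A ω)).eigenvalues i) →
        t + L m + L m < √((gram_isHermitian (A ω)).eigenvalues i) := by
      rw [eventually_all]
      intro i
      by_cases hi : t < √((gram_isHermitian (A ω)).eigenvalues i)
      · filter_upwards [h2L.eventually_lt_const hi] with m hm _ using hm
      · exact Eventually.of_forall fun m h => absurd h hi
    filter_upwards [this] with m hm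
    rw [esd_sq_eq _ ht, esd_sq_eq _ (by linarith [hL m])]
    congr 1
    refine Finset.sum_congr rfl fun i _ => ?_
    congr 1
    refine propext ⟨fun h => ?_, fun h => by linarith [hL m]⟩
    by_contra h'
    exact absurd (hm i (not_le.mp h')) (not_lt.mpr h)
  refine tendsto_of_tendsto_of_tendsto_of_le_of_le'
    (g := fun m => esd (gram_isHermitian (A ω)) (t ^ 2) - L m)
    (h := fun m => esd (gram_isHermitian (A ω)) (t ^ 2) + L m) ?_ ?_ ?_ ?_
  · simpa using hL0.const_sub (esd (gram_isHermitian (A ω)) (t ^ 2))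
  · simpa using hL0.const_add (esd (gram_isHermitian (A ω)) (t ^ 2))
  · refine Eventually.of_forall fun m => ?_
    have := esd_sq_le_smoothESD hn (A ω) (pow_pos (hL m) 2) (hL m) ht
    rw [hVL] at this
    linarith
  · filter_upwards [hev] with m hm
    have := smoothESD_le_esd_sq hn (A ω) (pow_pos (hL m) 2) (hL m)
      (by linarith [hL m] : 0 ≤ t + L m)
    rwa [hVL, hm] at this

theorem integrable_esd [IsProbabilityMeasure P] (hn : 0 < n)
    (hA : ∀ i j, Measurable fun ω => A ω i j) (x : ℝ) :
    Integrable (fun ω => esd (gram_isHermitian (A ω)) x) P := by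
  refine Integrable.of_bound (measurable_esd hn hA x).aestronglyMeasurable 1
    (Eventually.of_forall fun ω => ?_)
  rw [Real.norm_of_nonneg (esd_nonneg _ x)]
  exact esd_le_one _ x

/-- The number `w s(w²)` for the Stieltjes transform `s` of the expected spectral distribution of
`AAᵀ/n`, written in terms of the resolvent of `AᵀA/n`. -/
noncomputable def meanStieltjes {m0 : MeasurableSpace Ω} (P : Measure Ω)
    (A : Ω → Matrix (Fin n) (Fin N) ℝ) (w : ℂ) : ℂ :=
  w * meanTrace P A w + (((N : ℝ) / n - 1 : ℝ) : ℂ) / w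

theorem meanStieltjes_eq [IsProbabilityMeasure P] (hA : ∀ i j, Measurable fun ω => A ω i j)
    {w : ℂ} (hw : 0 < w.im) :
    meanStieltjes P A w = ∫ ω, (w * ((sqRes (cov (A ω)) w).trace / n)
      + (((N : ℝ) / n - 1 : ℝ) : ℂ) / w) ∂P ∧
    Integrable (fun ω => w * ((sqRes (cov (A ω)) w).trace / n)
      + (((N : ℝ) / n - 1 : ℝ) : ℂ) / w) P := by
  have h1 : Integrable (fun ω => w * ((sqRes (cov (A ω)) w).trace / n)) P :=
    ((integrable_trace_sqRes hA hw).div_const _).const_mul _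
  refine ⟨?_, h1.add (integrable_const _)⟩
  rw [integral_add (f := fun ω => w * ((sqRes (cov (A ω)) w).trace / n)) h1 (integrable_const _),
    integral_const_mul, integral_div, integral_const, probReal_univ, one_smul]
  rfl

theorem im_meanStieltjes [IsProbabilityMeasure P] (hA : ∀ i j, Measurable fun ω => A ω i j)
    {V : ℝ} (hV : 0 < V) (u : ℝ) :
    (meanStieltjes P A (u + V * Complex.I)).im = ∫ ω, stieltjesIm V (A ω) u ∂P := by
  obtain ⟨h1, h2⟩ := meanStieltjes_eq (P := P) hA
    (w := (u : ℂ) + V * Complex.I) (by simpa using hV)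
  rw [h1]
  exact (integral_im h2).symm

theorem im_mul_inv_sub_nonneg {l : ℝ} (hl : 0 ≤ l) {z : ℂ} (hz : 0 < z.im) :
    0 ≤ (z * ((l : ℂ) - z)⁻¹).im := by
  have hne : (l : ℂ) - z ≠ 0 := by
    intro h; have := congrArg Complex.im h; simp at this; exact hz.ne' this
  have e : z * ((l : ℂ) - z)⁻¹ = -1 + l * ((l : ℂ) - z)⁻¹ := by field_simp; ring
  rw [e, Complex.add_im, Complex.im_ofReal_mul, Complex.inv_im, Complex.sub_im, Complex.ofReal_im]
  simp only [Complex.neg_im, Complex.one_im, neg_zero, zero_sub, neg_neg, zero_add]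
  exact mul_nonneg hl (div_nonneg hz.le (Complex.normSq_nonneg _))

theorem im_mul_meanStieltjes_nonneg [IsProbabilityMeasure P] (hn : 0 < n)
    (hA : ∀ i j, Measurable fun ω => A ω i j) {w : ℂ} (hw : 0 < w.im) (hwre : 0 < w.re) :
    0 ≤ (w * meanStieltjes P A w).im := by
  have hw0 : w ≠ 0 := by rintro rfl; simp at hw
  obtain ⟨h1, h2⟩ := meanStieltjes_eq (P := P) hA hw
  rw [h1, ← integral_const_mul]
  refine le_trans ?_ (integral_im (h2.const_mul w)).le
  refine integral_nonneg fun ω => ?_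
  change 0 ≤ (w * (w * ((sqRes (cov (A ω)) w).trace / n)
    + (((N : ℝ) / n - 1 : ℝ) : ℂ) / w)).im
  rw [stieltjes_eq_sum hn (A ω) hw, mul_left_comm, Complex.im_ofReal_mul, Finset.mul_sum,
    Complex.im_sum]
  refine mul_nonneg (by positivity) (Finset.sum_nonneg fun i _ => ?_)
  rw [← mul_assoc, ← pow_two, ← Complex.ofReal_pow]
  refine im_mul_inv_sub_nonneg (sq_nonneg _) ?_
  rw [pow_two, Complex.mul_im]
  nlinarith [mul_pos hwre hw]

theorem integrable_stieltjesIm_prod [IsProbabilityMeasure P] (hn : 0 < n)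
    (hA : ∀ i j, Measurable fun ω => A ω i j) {V : ℝ} (hV : 0 < V) (x : ℝ) :
    Integrable (Function.uncurry fun (u : ℝ) (ω : Ω) => stieltjesIm V (A ω) u)
      ((volume.restrict (Set.uIoc 0 x)).prod P) := by
  have : IsFiniteMeasure ((volume : Measure ℝ).restrict (Set.uIoc 0 x)) := by
    rw [Set.uIoc]; infer_instance
  refine Integrable.of_bound (C := 1 / V) ?_ (Eventually.of_forall fun p => ?_)
  · exact ((measurable_stieltjesIm hA V).comp measurable_swap).aestronglyMeasurable
  · exact abs_stieltjesIm_le hn _ hV _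

theorem intervalIntegrable_im_meanStieltjes [IsProbabilityMeasure P] (hn : 0 < n)
    (hA : ∀ i j, Measurable fun ω => A ω i j) {V : ℝ} (hV : 0 < V) (x : ℝ) :
    IntervalIntegrable (fun u : ℝ => (meanStieltjes P A (u + V * Complex.I)).im) volume 0 x := by
  simp only [im_meanStieltjes hA hV]
  rw [intervalIntegrable_iff]
  exact (integrable_stieltjesIm_prod hn hA hV x).integral_prod_left

/-- Inversion of the Stieltjes transform at height `V`: its imaginary part integrates to the smoothed
expected distribution function. -/
theorem integral_im_meanStieltjes [IsProbabilityMeasure P] (hn : 0 < n)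
    (hA : ∀ i j, Measurable fun ω => A ω i j) {V : ℝ} (hV : 0 < V) (x : ℝ) :
    ∫ u in (0 : ℝ)..x, (meanStieltjes P A (u + V * Complex.I)).im
      = Real.pi / 2 * ∫ ω, smoothESD V (A ω) x ∂P := by
  simp only [im_meanStieltjes hA hV]
  rw [intervalIntegral_integral_swap (integrable_stieltjesIm_prod hn hA hV x)]
  simp only [integral_stieltjesIm hn _ hV]
  rw [integral_const_mul]

end Expectation

/-! ### From the self-consistent equation to the rate of convergence -/

section Rate

theorem integral_sqrt_const_div {V x : ℝ} (hV : 0 ≤ V) (hx : 0 ≤ x) :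
    IntervalIntegrable (fun u => √(V / u)) volume 0 x ∧
      ∫ u in (0 : ℝ)..x, √(V / u) = 2 * √V * √x := by
  have e : Set.EqOn (fun u : ℝ => √V * u ^ (-(1 / 2) : ℝ)) (fun u => √(V / u))
      (Set.uIoc 0 x) := fun u hu => by
    rw [Set.uIoc_of_le hx] at hu
    simp only
    rw [Real.sqrt_div hV, Real.rpow_neg hu.1.le, ← Real.sqrt_eq_rpow, div_eq_mul_inv]
  have hi : IntervalIntegrable (fun u : ℝ => √V * u ^ (-(1 / 2) : ℝ)) volume 0 x :=
    (intervalIntegral.intervalIntegrable_rpow' (by norm_num)).const_mul _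
  refine ⟨hi.congr e, ?_⟩
  rw [← intervalIntegral.integral_congr_ae (ae_of_all _ fun u hu => e hu),
    intervalIntegral.integral_const_mul,
    integral_rpow (Or.inl (by norm_num)), Real.sqrt_eq_rpow x]
  norm_num
  ring

theorem esd_mono {n N : ℕ} (a : Matrix (Fin n) (Fin N) ℝ) :
    Monotone (esd (gram_isHermitian a)) := by
  intro x y hxy
  unfold esd
  gcongr

variable {Ω : Type*} {m0 : MeasurableSpace Ω} {P : Measure Ω} {n N : ℕ}
  {A : Ω → Matrix (Fin n) (Fin N) ℝ}

theorem expectedESD_nonneg (x : ℝ) : 0 ≤ expectedESD P A x := integral_nonneg fun _ => esd_nonneg _ x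

theorem expectedESD_mono [IsProbabilityMeasure P] (hn : 0 < n)
    (hA : ∀ i j, Measurable fun ω => A ω i j) : Monotone (expectedESD P A) := fun x y h =>
  integral_mono (integrable_esd hn hA x) (integrable_esd hn hA y) fun ω => esd_mono (A ω) h

theorem expectedESD_le_one [IsProbabilityMeasure P] (hn : 0 < n)
    (hA : ∀ i j, Measurable fun ω => A ω i j) (x : ℝ) : expectedESD P A x ≤ 1 := by
  refine (integral_mono (integrable_esd hn hA x) (integrable_const 1)
    fun ω => esd_le_one (A ω) x).trans_eq ?_
  simp

theorem expectedESD_of_neg {x : ℝ} (hx : x < 0) : expectedESD P A x = 0 := by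
  simp [expectedESD, esd_of_neg _ hx]

/-- In the variable `h = w m + κ / w` the self-consistent equation for the mean trace `m` becomes a
quadratic equation. -/
theorem quadratic_eq_residual_mul {w m : ℂ} {c : ℝ} (hw : w ≠ 0) (hm : 1 + m ≠ 0) :
    (w * m + ((c - 1 : ℝ) : ℂ) / w) ^ 2
        + (w - ((c - 1 : ℝ) : ℂ) / w) * (w * m + ((c - 1 : ℝ) : ℂ) / w) + 1
      = (c + w ^ 2 * m - 1 + (1 + m)⁻¹) * (1 + m) := by
  push_cast
  field_simp
  ring

/-- The quadratic equation holds up to an error `V` at height `V`, if the self-consistent equation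
holds with an error of order `√ε / V³` where `ε = V ^ 11`. -/
theorem norm_quadratic_le [IsProbabilityMeasure P]
    (hn : 0 < n) (hA : ∀ i j, Measurable fun ω => A ω i j) {w : ℂ} {C K T V : ℝ}
    (hC : 0 ≤ C) (hV : 0 < V) (hV1 : V ≤ 1) (hwim : w.im = V) (hwT : ‖w‖ ≤ T)
    (hNK : (N : ℝ) / n ≤ K)
    (hres : ‖(N : ℂ) / n + w ^ 2 * meanTrace P A w - 1 + (1 + meanTrace P A w)⁻¹‖
      ≤ C * √(V ^ 11) * ‖w‖ / w.im ^ 3)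
    (hsmall : C * (T + K) * √V ≤ 1) :
    ‖meanStieltjes P A w ^ 2 + (w - (((N : ℝ) / n - 1 : ℝ) : ℂ) / w) * meanStieltjes P A w + 1‖
      ≤ V := by
  have hw : 0 < w.im := hwim ▸ hV
  have hw0 : w ≠ 0 := by rintro rfl; simp at hw
  have hwn : 0 < ‖w‖ := norm_pos_iff.mpr hw0
  have h1m : 1 + meanTrace P A w ≠ 0 := by
    intro h
    have := im_le_norm_mul_norm_one_add (im_mul_meanTrace_nonneg (P := P) hA hw)
    rw [h, norm_zero, mul_zero] at this
    linarith
  have hm := norm_meanTrace_le (P := P) (A := A) hn hw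
  rw [meanStieltjes, quadratic_eq_residual_mul hw0 h1m, norm_mul]
  have hbound : ‖w‖ * ‖1 + meanTrace P A w‖ ≤ (T + K) / V := by
    rw [le_div_iff₀ hV]
    have h2 : ‖1 + meanTrace P A w‖ ≤ 1 + ‖meanTrace P A w‖ := by
      simpa using norm_add_le 1 (meanTrace P A w)
    rw [hwim] at hm
    calc ‖w‖ * ‖1 + meanTrace P A w‖ * V ≤ ‖w‖ * (1 + ‖meanTrace P A w‖) * V := by gcongr
      _ = V * ‖w‖ + V * ‖w‖ * ‖meanTrace P A w‖ := by ring
      _ ≤ 1 * T + K := by gcongr; exact hm.trans hNK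
      _ = T + K := by ring
  have hsq : √(V ^ 11) = V ^ 5 * √V := by
    rw [show V ^ 11 = (V ^ 5) ^ 2 * V by ring, Real.sqrt_mul (by positivity),
      Real.sqrt_sq (by positivity)]
  rw [hwim, hsq] at hres
  calc _ ≤ C * (V ^ 5 * √V) * ‖w‖ / V ^ 3 * ‖1 + meanTrace P A w‖ := by
        gcongr
        push_cast
        exact hres
    _ = C * V ^ 2 * √V * (‖w‖ * ‖1 + meanTrace P A w‖) := by field_simp
    _ ≤ C * V ^ 2 * √V * ((T + K) / V) := by gcongr
    _ = C * (T + K) * √V * V := by field_simp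
    _ ≤ 1 * V := by gcongr
    _ = V := one_mul V

/-- The constant in the rate of convergence, in terms of a bound `K` for the aspect ratio. -/
noncomputable def rateConst (K : ℝ) : ℝ := K + 2 + 2 * stabConst K (√K + 2) * √(√K + 2)

/-- Integrating the stability estimate over `u` compares the smoothed distribution functions; the
loss `√(V / u)` at the hard edge is integrable. -/
theorem abs_integral_smoothESD_sub_mpCDF_le [IsProbabilityMeasure P] (hn : 0 < n)
    (hA : ∀ i j, Measurable fun ω => A ω i j) {K T V x : ℝ} (hV : 0 < V) (hV1 : V ≤ 1)
    (hc1 : 1 ≤ (N : ℝ) / n) (hNK : (N : ℝ) / n ≤ K) (hx : 0 ≤ x) (hxT : x ≤ T)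
    (he : ∀ u, 0 < u → u ≤ T → ∀ w : ℂ, w = u + V * Complex.I →
      ‖meanStieltjes P A w ^ 2 + (w - (((N : ℝ) / n - 1 : ℝ) : ℂ) / w) * meanStieltjes P A w + 1‖
        ≤ V) :
    |∫ ω, smoothESD V (A ω) x ∂P - mpCDF ((N : ℝ) / n) (x ^ 2)|
      ≤ 2 * stabConst K T * √T * √V := by
  have hT : 0 ≤ T := hx.trans hxT
  have hK : 0 ≤ K := by linarith
  have hκ : 0 ≤ (N : ℝ) / n - 1 := by linarith
  have hstab : 0 ≤ stabConst K T := by unfold stabConst; positivity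
  have e1 : ∫ ω, smoothESD V (A ω) x ∂P = 2 / Real.pi *
      ∫ u in (0 : ℝ)..x, (meanStieltjes P A (u + V * Complex.I)).im := by
    rw [integral_im_meanStieltjes hn hA hV]
    field_simp
  rw [e1, mpCDF_sq hc1 hx, intervalIntegral.integral_const_mul, ← mul_sub,
    ← intervalIntegral.integral_sub (intervalIntegrable_im_meanStieltjes hn hA hV x)
      (intervalIntegrable_sqrt_mpDisc hκ le_rfl hx), abs_mul, abs_of_pos (by positivity)]
  obtain ⟨hi, hv⟩ := integral_sqrt_const_div hV.le hx
  have hb : |∫ u in (0 : ℝ)..x, ((meanStieltjes P A (u + V * Complex.I)).im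
      - √(mpDisc ((N : ℝ) / n - 1) (u ^ 2)) / (2 * u))|
      ≤ ∫ u in (0 : ℝ)..x, stabConst K T * √(V / u) := by
    rw [← Real.norm_eq_abs]
    refine intervalIntegral.norm_integral_le_of_norm_le hx (Eventually.of_forall fun u hu => ?_)
      (hi.const_mul _)
    have hw : 0 < ((u : ℂ) + V * Complex.I).im := by simpa using hV
    have hwre : ((u : ℂ) + V * Complex.I).re = u := by simp
    have hwim : ((u : ℂ) + V * Complex.I).im = V := by simp
    refine abs_im_sub_density_le hV hV1 hu.1 (hu.2.trans hxT) hκ (by linarith) hwre hwim ?_ ?_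
      (he u hu.1 (hu.2.trans hxT) _ rfl)
    · rw [im_meanStieltjes hA hV]
      exact integral_nonneg fun ω => stieltjesIm_nonneg hn _ hV u
    · exact im_mul_meanStieltjes_nonneg hn hA hw (by rw [hwre]; exact hu.1)
  rw [intervalIntegral.integral_const_mul, hv] at hb
  have h2 : 2 / Real.pi ≤ 1 := by
    rw [div_le_one Real.pi_pos]; exact Real.two_le_pi
  calc _ ≤ 1 * (stabConst K T * (2 * √V * √x)) := by gcongr
    _ ≤ 1 * (stabConst K T * (2 * √V * √T)) := by gcongr
    _ = _ := by ring

/-- The smoothing step. Shifting by `√V` sandwiches the empirical distribution between its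
smoothings at scale `V`, and `F_c` is Lipschitz in the variable `√x`. -/
theorem abs_expectedESD_sub_mpCDF_le [IsProbabilityMeasure P] (hn : 0 < n)
    (hA : ∀ i j, Measurable fun ω => A ω i j) {K V : ℝ} (hV : 0 < V) (hV1 : V ≤ 1)
    (hc1 : 1 ≤ (N : ℝ) / n) (hNK : (N : ℝ) / n ≤ K)
    (he : ∀ u, 0 < u → u ≤ √K + 2 → ∀ w : ℂ, w = u + V * Complex.I →
      ‖meanStieltjes P A w ^ 2 + (w - (((N : ℝ) / n - 1 : ℝ) : ℂ) / w) * meanStieltjes P A w + 1‖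
        ≤ V) (x : ℝ) :
    |expectedESD P A x - mpCDF ((N : ℝ) / n) x| ≤ rateConst K * √V := by
  set c := (N : ℝ) / n with hc
  set T := √K + 2 with hT
  set L := √V with hLdef
  have hK : 0 ≤ K := by linarith
  have hL : 0 < L := Real.sqrt_pos.mpr hV
  have hL1 : L ≤ 1 := Real.sqrt_le_one.mpr hV1
  have hVL : V / L = L := Real.div_sqrt
  have hT0 : 2 ≤ T := by rw [hT]; linarith [Real.sqrt_nonneg K]
  set S := 2 * stabConst K T * √T with hS
  have hS0 : 0 ≤ S := by rw [hS]; unfold stabConst; positivity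
  have hM : rateConst K = K + 2 + S := rfl
  have hM0 : 0 ≤ rateConst K * L := by rw [hM]; positivity
  have hΦ : ∀ y, 0 ≤ y → y ≤ T → |∫ ω, smoothESD V (A ω) y ∂P - mpCDF c (y ^ 2)| ≤ S * L :=
    fun y hy hyT => abs_integral_smoothESD_sub_mpCDF_le hn hA hV hV1 hc1 hNK hy hyT he
  have key : ∀ t, 0 ≤ t → t ≤ T - 1 →
      |expectedESD P A (t ^ 2) - mpCDF c (t ^ 2)| ≤ rateConst K * L := by
    intro t ht htT
    have hup : expectedESD P A (t ^ 2) ≤ ∫ ω, smoothESD V (A ω) (t + L) ∂P + L := by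
      have hi := integrable_smoothESD (P := P) hn hA hV (by linarith : 0 ≤ t + L)
      refine (integral_mono (integrable_esd hn hA _) (hi.add (integrable_const L))
        fun ω => ?_).trans_eq ?_
      · have := esd_sq_le_smoothESD hn (A ω) hV hL ht
        rwa [hVL] at this
      · simp only [Pi.add_apply]
        rw [integral_add hi (integrable_const L), integral_const, probReal_univ, one_smul]
    have h1 := (abs_le.mp (hΦ (t + L) (by linarith) (by linarith))).2
    have h2 := mpCDF_sq_sub_le hc1 ht (by linarith : t ≤ t + L)
    have h3 : (c + 1) * (t + L - t) ≤ (K + 1) * L := by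
      rw [add_sub_cancel_left]; gcongr
    rw [hM, abs_le]
    refine ⟨?_, by linarith⟩
    rcases le_or_gt L t with htL | htL
    · have hi := integrable_smoothESD (P := P) hn hA hV (by linarith : 0 ≤ t - L)
      have hlo : ∫ ω, smoothESD V (A ω) (t - L) ∂P ≤ expectedESD P A (t ^ 2) + L := by
        refine (integral_mono hi ((integrable_esd hn hA (t ^ 2)).add (integrable_const L))
          fun ω => ?_).trans_eq ?_
        · have := smoothESD_le_esd_sq hn (A ω) hV hL (by linarith : 0 ≤ t - L)
          rwa [hVL, sub_add_cancel] at this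
        · simp only [Pi.add_apply]
          rw [integral_add (integrable_esd hn hA _) (integrable_const L), integral_const,
            probReal_univ, one_smul]
          rfl
      have h4 := (abs_le.mp (hΦ (t - L) (by linarith) (by linarith))).1
      have h5 := mpCDF_sq_sub_le hc1 (by linarith : 0 ≤ t - L) (by linarith : t - L ≤ t)
      have h6 : (c + 1) * (t - (t - L)) ≤ (K + 1) * L := by
        rw [sub_sub_cancel]; gcongr
      linarith
    · have h4 := expectedESD_nonneg (P := P) (A := A) (t ^ 2)
      have h5 := mpCDF_sq_sub_le hc1 le_rfl ht
      rw [mpCDF_of_nonpos hc1 (by norm_num : (0 : ℝ) ^ 2 ≤ 0)] at h5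
      have h6 : (c + 1) * (t - 0) ≤ (K + 1) * L := by
        rw [sub_zero]; gcongr
      have h7 : 0 ≤ S * L := by positivity
      linarith
  rcases lt_or_ge x 0 with hx | hx
  · rw [expectedESD_of_neg hx, mpCDF_of_nonpos hc1 hx.le, sub_zero, abs_zero]
    exact hM0
  obtain ⟨t, ht, rfl⟩ : ∃ t, 0 ≤ t ∧ x = t ^ 2 := ⟨√x, Real.sqrt_nonneg x, (Real.sq_sqrt hx).symm⟩
  rcases le_or_gt t (T - 1) with htT | htT
  · exact key t ht htT
  -- beyond the right edge of the spectrum both functions are squeezed between `F_c((T-1)²) = 1`,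
  -- up to the error, and `1`
  have hedge : (1 + √c) ^ 2 ≤ (T - 1) ^ 2 := by
    have : √c ≤ √K := Real.sqrt_le_sqrt hNK
    refine pow_le_pow_left₀ (by positivity) ?_ 2
    rw [hT]; linarith
  have hsq : (T - 1) ^ 2 ≤ t ^ 2 := pow_le_pow_left₀ (by linarith) htT.le 2
  have h1 := (abs_le.mp (key (T - 1) (by linarith) le_rfl)).1
  rw [mpCDF_of_ge hc1 hedge] at h1
  have h2 := expectedESD_mono (P := P) hn hA hsq
  have h3 := expectedESD_le_one (P := P) hn hA (t ^ 2)
  rw [mpCDF_of_ge hc1 (hedge.trans hsq), abs_le]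
  constructor <;> linarith

end Rate

theorem tendsto_sq_div_of_isLittleO {β : ℕ → ℕ}
    (hβ : (fun n => (β n : ℝ)) =o[atTop] fun n : ℕ => √(n : ℝ)) :
    Tendsto (fun n : ℕ => ((β n : ℝ) + 1) ^ 2 / n) atTop (𝓝 0) := by
  have h1 : (fun _ : ℕ => (1 : ℝ)) =o[atTop] fun n : ℕ => √(n : ℝ) := by
    rw [Asymptotics.isLittleO_one_left_iff]
    have := Real.tendsto_sqrt_atTop.comp (tendsto_natCast_atTop_atTop (R := ℝ))
    exact tendsto_norm_atTop_atTop.comp this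
  have h2 := ((hβ.add h1).tendsto_div_nhds_zero).pow 2
  simp only [div_pow] at h2
  rw [zero_pow two_ne_zero] at h2
  refine h2.congr fun n => ?_
  rw [Real.sq_sqrt (Nat.cast_nonneg n)]

/-- The rate of convergence of the expected spectral distribution under condition C0. -/
theorem isBigO_iSup_abs_expectedESD_sub_mpCDF {Ω : ℕ → Type*} [∀ n, MeasurableSpace (Ω n)]
    (P : ∀ n, Measure (Ω n)) [∀ n, IsProbabilityMeasure (P n)]
    (N : ℕ → ℕ) (A : ∀ n, Ω n → Matrix (Fin n) (Fin (N n)) ℝ)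
    (γ : ℕ → ℝ) (β : ℕ → ℕ)
    (hC0 : ConditionC0 P N A γ β)
    (hN : ∀ n : ℕ, 1 ≤ n → 1 ≤ (N n : ℝ) / (n : ℝ))
    (c : ℝ) (hc : 1 ≤ c)
    (hlim : Tendsto (fun n : ℕ => (N n : ℝ) / (n : ℝ)) atTop (𝓝 c)) :
    (fun n : ℕ => ⨆ x : ℝ, |expectedESD (P n) (A n) x
        - mpCDF ((N n : ℝ) / (n : ℝ)) x|)
      =O[atTop] fun n : ℕ =>
        max (max (qCoef (P n) (A n) ^ ((1 : ℝ) / 22)) (γ n ^ ((1 : ℝ) / 22)))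
          (max (rhoCoef (P n) (A n) ^ ((1 : ℝ) / 22))
            ((((β n : ℝ) + 1) ^ 2 / (n : ℝ)) ^ ((1 : ℝ) / 22))) := by
  obtain ⟨C₁, hC₁⟩ := hC0.cond_two
  obtain ⟨C₂, hC₂⟩ := hC0.cond_four
  set C := max (max C₁ C₂) 0 with hCdef
  have hCnn : 0 ≤ C := le_max_right _ _
  have hC₁C : C₁ ≤ C := (le_max_left _ _).trans (le_max_left _ _)
  have hC₂C : C₂ ≤ C := (le_max_right _ _).trans (le_max_left _ _)
  set K := c + 1 with hK
  have hK0 : 0 ≤ K := by linarith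
  set D := √(2 * quadConst K C) + 1 + √8 with hD
  have hD0 : 0 ≤ D := by positivity
  set ε : ℕ → ℝ := fun n => max (max (qCoef (P n) (A n)) (γ n))
    (max (rhoCoef (P n) (A n)) (((β n : ℝ) + 1) ^ 2 / n)) with hε
  have hε0 : Tendsto ε atTop (𝓝 0) := by
    have h := (hC0.q_tendsto.max hC0.gamma_tendsto).max
      (hC0.rho_tendsto.max (tendsto_sq_div_of_isLittleO hC0.beta_littleO))
    simpa using h
  -- the height `V` balances the error `√ε / V⁴` of the quadratic equation, which has to be at most
  -- `V`, against the smoothing error `√V`: with `ε = V ^ 11` there is a factor `√V` to spare, which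
  -- absorbs the constants
  set V : ℕ → ℝ := fun n => ε n ^ ((1 : ℝ) / 11) with hVdef
  have hV0 : Tendsto V atTop (𝓝 0) := by
    have := hε0.rpow_const (p := (1 : ℝ) / 11) (Or.inr (by norm_num))
    rwa [Real.zero_rpow (by norm_num)] at this
  have hsmall : Tendsto (fun n => D * (√K + 3 + K) * √(V n)) atTop (𝓝 0) := by
    have := (hV0.sqrt).const_mul (D * (√K + 3 + K))
    rwa [Real.sqrt_zero, mul_zero] at this
  refine Asymptotics.IsBigO.of_bound (rateConst K) ?_
  filter_upwards [hC₁, hC₂, eventually_gt_atTop 0, hlim.eventually_le_const (lt_add_one c),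
    hV0.eventually_le_const one_pos, hsmall.eventually_le_const one_pos]
    with n hc2 hc4 hn hNK hV1 hDV
  have hn' : (0 : ℝ) < n := by exact_mod_cast hn
  have hεpos : 0 < ε n := by
    refine lt_of_lt_of_le ?_ ((le_max_right _ _).trans (le_max_right _ _))
    positivity
  have hVpos : 0 < V n := Real.rpow_pos_of_pos hεpos _
  have hV11 : V n ^ 11 = ε n := by
    rw [← Real.rpow_natCast, ← Real.rpow_mul hεpos.le]
    norm_num
  have hsqrtV : √(V n) = ε n ^ ((1 : ℝ) / 22) := by
    rw [Real.sqrt_eq_rpow, ← Real.rpow_mul hεpos.le]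
    norm_num
  have hγ := hC0.gamma_nonneg n
  have hmain : ∀ x, |expectedESD (P n) (A n) x - mpCDF ((N n : ℝ) / n) x|
      ≤ rateConst K * √(V n) := by
    refine abs_expectedESD_sub_mpCDF_le hn (hC0.measurable_entry n) hVpos hV1
      (hN n hn) hNK fun u hu huT w hw => ?_
    have hwim : w.im = V n := by rw [hw]; simp
    have hwn : ‖w‖ ≤ √K + 3 := by
      rw [hw]
      refine (norm_add_le _ _).trans ?_
      rw [norm_mul, Complex.norm_I, mul_one, Complex.norm_real, Complex.norm_real,
        Real.norm_of_nonneg hu.le, Real.norm_of_nonneg hVpos.le]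
      linarith
    refine norm_quadratic_le hn (hC0.measurable_entry n) hD0 hVpos hV1 hwim hwn hNK ?_ hDV
    rw [hV11]
    refine norm_selfConsistent_le hn (hC0.measurable_entry n)
      (fun i j => (hC0.fourth_moment.choose_spec n i j).1) (hC0.indep_rows n)
      ((div_le_iff₀ hn').mp hNK) hCnn hγ ?_ ?_
      ((le_max_right _ _).trans (le_max_left _ _)) ((le_max_left _ _).trans (le_max_left _ _))
      ((le_max_left _ _).trans (le_max_right _ _)) ((le_max_right _ _).trans (le_max_right _ _))
      (hwim ▸ hVpos)
    · filter_upwards [hc2] with ω hω k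
      exact ⟨fun i j h => ((hω k).1 i j h).trans (by gcongr),
        fun i j l h => ((hω k).2 i j l h).trans (by gcongr)⟩
    · filter_upwards [hc4] with ω hω k i j l m h1 h2 h3 h4 h5 h6
      exact (hω k i j l m h1 h2 h3 h4 h5 h6).trans (by gcongr)
  have hR0 : 0 ≤ rateConst K * √(V n) := (abs_nonneg _).trans (hmain 0)
  have hR : 0 ≤ rateConst K := nonneg_of_mul_nonneg_left hR0 (Real.sqrt_pos.mpr hVpos)
  have hmax : √(V n) ≤ max (max (qCoef (P n) (A n) ^ ((1 : ℝ) / 22)) (γ n ^ ((1 : ℝ) / 22)))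
      (max (rhoCoef (P n) (A n) ^ ((1 : ℝ) / 22))
        ((((β n : ℝ) + 1) ^ 2 / (n : ℝ)) ^ ((1 : ℝ) / 22))) := by
    rw [hsqrtV]
    simp only [hε]
    rcases max_choice (max (qCoef (P n) (A n)) (γ n))
      (max (rhoCoef (P n) (A n)) (((β n : ℝ) + 1) ^ 2 / n)) with h | h <;> rw [h]
    · rcases max_choice (qCoef (P n) (A n)) (γ n) with h | h <;> rw [h] <;> simp
    · rcases max_choice (rhoCoef (P n) (A n)) (((β n : ℝ) + 1) ^ 2 / n) with h | h <;>
        rw [h] <;> simp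
  rw [Real.norm_of_nonneg (Real.iSup_nonneg fun x => abs_nonneg _)]
  refine (Real.iSup_le hmain hR0).trans (mul_le_mul_of_nonneg_left (hmax.trans ?_) hR)
  exact le_abs_self _

end MarchenkoPastur

theorem theorem2 {Ω : ℕ → Type*} [∀ n, MeasurableSpace (Ω n)]
    (P : ∀ n, Measure (Ω n)) [∀ n, IsProbabilityMeasure (P n)]
    (N : ℕ → ℕ) (A : ∀ n, Ω n → Matrix (Fin n) (Fin (N n)) ℝ)
    (γ : ℕ → ℝ) (β : ℕ → ℕ)
    (hC0 : MarchenkoPastur.ConditionC0 P N A γ β)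
    (hN : ∀ n : ℕ, 1 ≤ n → 1 ≤ (N n : ℝ) / (n : ℝ))
    (c : ℝ) (hc : 1 ≤ c)
    (hlim : Tendsto (fun n : ℕ => (N n : ℝ) / (n : ℝ)) atTop (𝓝 c))
    (hnorm : limsup (fun n : ℕ =>
        (∫⁻ ω, ENNReal.ofReal (MarchenkoPastur.specNorm (A n ω * (A n ω).transpose)) ∂(P n))
          / (n : ℝ≥0∞)) atTop < ⊤) :
    (fun n : ℕ => ⨆ x : ℝ, |MarchenkoPastur.expectedESD (P n) (A n) x
        - MarchenkoPastur.mpCDF ((N n : ℝ) / (n : ℝ)) x|)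
      =O[atTop] fun n : ℕ =>
        max (max (MarchenkoPastur.qCoef (P n) (A n) ^ ((1 : ℝ) / 22)) (γ n ^ ((1 : ℝ) / 22)))
          (max (MarchenkoPastur.rhoCoef (P n) (A n) ^ ((1 : ℝ) / 22))
            ((((β n : ℝ) + 1) ^ 2 / (n : ℝ)) ^ ((1 : ℝ) / 22))) :=
  MarchenkoPastur.isBigO_iSup_abs_expectedESD_sub_mpCDF P N A γ β hC0 hN c hc hlim
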